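/- Let $M$ be a connected smooth 3-manifold (without boundary) with a smooth nowhere-vanishing volume form $\Omega$, let $U\subseteq M$ be open, and let $u,B$ be vector fields that are $C^1$ on $U$ and satisfy there $d(i_B\Omega)=0$, $d(i_u\Omega)=0$ and $[u,B]=0$ (so $B$ is a magnetic field and $u$ a flux-form symmetry of it). Put $\beta=i_B\Omega$, and let $\psi$ be a real function, differentiable on $U$, with $i_u\beta=d\psi$ there. Suppose that $U$ is foliated by flux surfaces: $d\psi\neq0$ on $U$, and for every $s\in\psi(U)$ the set $S_s=U\cap\psi^{-1}(s)$ is compact and connected. For $s\in\psi(U)$ let $D_s$ be the region enclosed by $S_s$, i.e. a connected component of $M\setminus S_s$ with compact closure (assumed to exist; if $M$ itself is compact, the regions are chosen on the same side: every $s\in\psi(U)$ admits a point $p\in M$ that lies outside $\overline{D_{s'}}$ for all $s'$ near $s$). Let $V(s)=\int_{D_s}|\Omega|$ be the enclosed volume. For $t=(t_u,t_B)\in\mathbb R^2$ and $x\in S_s$ let $\phi_t(x)$ be the point reached from $x$ by flowing for time $t_u$ with $u$ and then for time $t_B$ with $B$, and let $\Gamma_s=\{t\in\mathbb R^2:\phi_t=\mathrm{Id}\text{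 on }S_s\}$. Then for every $s\in\psi(U)$: 1. $\Gamma_s$ is a lattice: $\Gamma_s=\mathbb Z T_1+\mathbb Z T_2$ for some linearly independent $T_1,T_2\in\mathbb R^2$. 2. Let $T_1,T_2$ be any generators of $\Gamma_s$, and let $\partial_{\theta_i}=T_i^{(u)}u+T_i^{(B)}B$ be the corresponding coordinate fields on $S_s$, where $T_i=(T_i^{(u)},T_i^{(B)})$. Call the pair $(T_1,T_2)$ compatibly ordered if $i_{\partial_{\theta_1}}i_{\partial_{\theta_2}}\Omega$ is positive on some velocity vector, at a point of $S_s$, of a curve that crosses $S_s$ there from $D_s$ to the exterior of $D_s$. Then $(T_1,T_2)$ or $(T_2,T_1)$ is compatibly ordered. 3. If $(T_1,T_2)$ is a compatibly ordered pair of generators of $\Gamma_s$, then $V(s)$ is finite and $V$ is differentiable at $s$ with $$\frac{dV}{d\psi}(s)=\Delta(s),\qquad \Delta=\det[T_1\;T_2],$$ where $[T_1\;T_2]$ is the matrix with columns $T_1,T_2$; that is, $dV=\Delta(\psi)\,d\psi$. -/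

import Mathlib

open Set Filter Topology MeasureTheory
open scoped Manifold ContDiff ENNReal

namespace FluxSurface

/-- The model space `ℝ³` with its Euclidean norm. -/
abbrev E3 : Type := EuclideanSpace ℝ (Fin 3)

section Forms

variable {M : Type*} [TopologicalSpace M] [ChartedSpace E3 M]

/-- A vector field on the 3-manifold `M`. -/
abbrev VField (M : Type*) [TopologicalSpace M] [ChartedSpace E3 M] : Type _ :=
  (x : M) → TangentSpace (𝓡 3) x

/-- A differential `k`-form on the 3-manifold `M`, with no regularity required. -/
abbrev DForm (M : Type*) [TopologicalSpace M] [ChartedSpace E3 M] (k : ℕ) : Type _ :=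
  (x : M) → (TangentSpace (𝓡 3) x) [⋀^Fin k]→L[ℝ] ℝ

/-- The expression of a form in a chart `e`: its pullback by `e.symm` (meaningful on `e.target`). -/
noncomputable def chartForm {k : ℕ} (η : DForm M k) (e : OpenPartialHomeomorph M E3) (y : E3) :
    E3 [⋀^Fin k]→L[ℝ] ℝ :=
  (η (e.symm y)).compContinuousLinearMap (mfderiv (𝓡 3) (𝓡 3) e.symm y)

/-- The form `η` is closed on the open set `U`: its exterior derivative vanishes in every chart. -/
def IsClosedOn {k : ℕ} (η : DForm M k) (U : Set M) : Prop :=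
  ∀ e ∈ atlas E3 M, ∀ y ∈ e.target, e.symm y ∈ U → extDeriv (chartForm η e) y = 0

/-- The interior product `i_X η`, that is `η(X, ·, …, ·)`. -/
noncomputable def interiorProd {k : ℕ} (X : VField M) (η : DForm M (k + 1)) : DForm M k :=
  fun x => ContinuousAlternatingMap.curryLeft (E := E3) (η x) (X x)

/-- A volume form: a smooth, nowhere vanishing 3-form. -/
structure IsVolumeForm (Ω : DForm M 3) : Prop where
  smooth : ∀ e ∈ atlas E3 M, ContDiffOn ℝ ∞ (chartForm Ω e) e.target
  ne_zero : ∀ x, Ω x ≠ 0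

/-- The vector field `X` preserves the volume form `Ω` on the open set `U`, i.e.
`L_X Ω = d (i_X Ω) = 0` there. -/
def PreservesVolumeOn (Ω : DForm M 3) (X : VField M) (U : Set M) : Prop :=
  IsClosedOn (interiorProd X Ω) U

/-- The vector field `X` is of class `C¹` on `U`. -/
def IsC1On [IsManifold (𝓡 3) ∞ M] (X : VField M) (U : Set M) : Prop :=
  ContMDiffOn (𝓡 3) (𝓡 3).tangent 1 (fun x => (⟨x, X x⟩ : TangentBundle (𝓡 3) M)) U

end Forms

section Volume

variable {M : Type*} [TopologicalSpace M] [ChartedSpace E3 M]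

/-- Countably many of the preferred charts cover `M`. -/
theorem exists_chart_seq (M : Type*) [TopologicalSpace M] [ChartedSpace E3 M]
    [SecondCountableTopology M] [Nonempty M] :
    ∃ c : ℕ → M, ⋃ n, (chartAt E3 (c n)).source = univ := by
  obtain ⟨s, hs, hcov⟩ :=
    TopologicalSpace.countable_cover_nhds (fun x : M => chart_source_mem_nhds E3 x)
  have hne : s.Nonempty := by
    obtain ⟨x⟩ := ‹Nonempty M›
    have hx : x ∈ ⋃ y ∈ s, (chartAt E3 y).source := hcov ▸ mem_univ x
    obtain ⟨y, hy, -⟩ := mem_iUnion₂.1 hx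
    exact ⟨y, hy⟩
  obtain ⟨c, rfl⟩ := hs.exists_eq_range hne
  exact ⟨c, by simpa using hcov⟩

/-- Centres of a sequence of charts covering `M`. -/
noncomputable def chartSeq (M : Type*) [TopologicalSpace M] [ChartedSpace E3 M]
    [SecondCountableTopology M] [Nonempty M] : ℕ → M :=
  (exists_chart_seq M).choose

/-- A partition of `M` into countably many pieces, the `n`-th one inside the `n`-th chart. -/
noncomputable def piece (M : Type*) [TopologicalSpace M] [ChartedSpace E3 M]
    [SecondCountableTopology M] [Nonempty M] (n : ℕ) : Set M :=
  disjointed (fun k => (chartAt E3 (chartSeq M k)).source) n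

/-- The density `|Ω(∂₁, ∂₂, ∂₃)|` of a 3-form in a chart. -/
noncomputable def chartDensity (Ω : DForm M 3) (e : OpenPartialHomeomorph M E3) (y : E3) : ℝ≥0∞ :=
  ‖chartForm Ω e y (fun i => EuclideanSpace.basisFun (Fin 3) ℝ i)‖ₑ

/-- The volume measure `|Ω|` of a 3-form `Ω`: in each chart it has density `|Ω(∂₁, ∂₂, ∂₃)|` with
respect to Lebesgue measure. The manifold is cut into countably many pieces, each inside a chart,
and the contributions are added; by the change of variables formula the result does not depend on
the pieces. -/
noncomputable def volumeMeasure [SecondCountableTopology M] [Nonempty M] [MeasurableSpace M]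
    (Ω : DForm M 3) : Measure M :=
  Measure.sum fun n : ℕ =>
    let e := chartAt E3 (chartSeq M n)
    (((volume : Measure E3).restrict (e.target ∩ e.symm ⁻¹' piece M n)).withDensity
      (chartDensity Ω e)).map e.symm

end Volume

section Symmetry

variable {M : Type*} [TopologicalSpace M] [ChartedSpace E3 M]

/-- On the open set `U`, the field `B` is a magnetic field (it preserves `Ω`), and `u` is a
flux-form symmetry of `B` (it preserves `Ω` and commutes with `B`) with flux function `ψ`, that is
`i_u β = dψ` for the flux form `β = i_B Ω`. -/
structure IsFluxFormSymmetryOn [IsManifold (𝓡 3) ∞ M] (Ω : DForm M 3) (B u : VField M)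
    (ψ : M → ℝ) (U : Set M) : Prop where
  regB : IsC1On B U
  regu : IsC1On u U
  volB : PreservesVolumeOn Ω B U
  volu : PreservesVolumeOn Ω u U
  comm : ∀ x ∈ U, VectorField.mlieBracket (𝓡 3) u B x = 0
  diff : ∀ x ∈ U, MDifferentiableAt (𝓡 3) 𝓘(ℝ, ℝ) ψ x
  dpsi : ∀ x ∈ U, ∀ ξ : TangentSpace (𝓡 3) x,
    interiorProd u (interiorProd B Ω) x ![ξ] = mfderiv (𝓡 3) 𝓘(ℝ, ℝ) ψ x ξ

/-- The level set of `ψ` at height `s` in the region `U`. -/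
def surf (ψ : M → ℝ) (U : Set M) (s : ℝ) : Set M := U ∩ ψ ⁻¹' {s}

/-- The open set `U` is foliated by flux surfaces: `ψ` is regular in `U`, and each of its level
sets in `U` is compact and connected, hence a bounded regular component of a level set of `ψ`. -/
structure IsFoliatedByFluxSurfaces (ψ : M → ℝ) (U : Set M) : Prop where
  isOpen : IsOpen U
  regular : ∀ x ∈ U, mfderiv (𝓡 3) 𝓘(ℝ, ℝ) ψ x ≠ 0
  compact : ∀ s ∈ ψ '' U, IsCompact (surf ψ U s)
  connected : ∀ s ∈ ψ '' U, IsConnected (surf ψ U s)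

/-- Starting from `x` and following the vector field `X` for the time `t`, one arrives at `y`. -/
def FlowsTo (X : VField M) (t : ℝ) (x y : M) : Prop :=
  ∃ γ : ℝ → M, IsMIntegralCurve (I := 𝓡 3) γ X ∧ γ 0 = x ∧ γ t = y

/-- `φ_t(x) = y`, where `φ` is the action of `ℝ²` generated by `(u, B)`: one reaches `y` from `x`
by following `u` for the time `t.1` and then `B` for the time `t.2`. -/
def ActsTo (u B : VField M) (t : ℝ × ℝ) (x y : M) : Prop :=
  ∃ z, FlowsTo u t.1 x z ∧ FlowsTo B t.2 z y

/-- The set `Γ` of periods of the action on `S`, i.e. of all `t ∈ ℝ²` such that `φ_t` is the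
identity on `S`. -/
def periods (u B : VField M) (S : Set M) : Set (ℝ × ℝ) :=
  {t | ∀ x ∈ S, ActsTo u B t x x}

/-- `T₁` and `T₂` generate `Γ` as an additive group. -/
def Generates (Γ : Set (ℝ × ℝ)) (T₁ T₂ : ℝ × ℝ) : Prop :=
  Γ = (AddSubgroup.closure {T₁, T₂} : AddSubgroup (ℝ × ℝ))

/-- The determinant of the matrix with columns `T₁` and `T₂`. -/
noncomputable def Delta (T₁ T₂ : ℝ × ℝ) : ℝ :=
  Matrix.det !![T₁.1, T₂.1; T₁.2, T₂.2]

/-- The infinitesimal generator of the action in the direction `T`. If `(T₁, T₂)` generates the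
period lattice of a flux surface, which is then parametrised by `θ ↦ φ_{θ₁ T₁ + θ₂ T₂}(x)`, then
`generator u B Tᵢ` is the coordinate field `∂_{θᵢ}`. -/
noncomputable def generator (u B : VField M) (T : ℝ × ℝ) : VField M :=
  fun x => T.1 • u x + T.2 • B x

/-- The curve `c` leaves the region `D` through `S` at time `0`. -/
def LeavesThrough (c : ℝ → M) (S D : Set M) : Prop :=
  c 0 ∈ S ∧ MDifferentiableAt 𝓘(ℝ, ℝ) (𝓡 3) c 0 ∧
    (∀ᶠ t in 𝓝[<] 0, c t ∈ D) ∧ (∀ᶠ t in 𝓝[>] 0, c t ∉ closure D)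

/-- The order of the pair `(T₁, T₂)` is compatible with the orientation of `S` as the boundary of
the region `D`, with the sign convention of `dψ = i_u i_B Ω`: the 1-form
`i_{∂_{θ₁}} i_{∂_{θ₂}} Ω` is positive on a vector that points out of `D`. -/
def CompatiblyOrdered (Ω : DForm M 3) (u B : VField M) (S D : Set M) (T₁ T₂ : ℝ × ℝ) : Prop :=
  ∃ c : ℝ → M, LeavesThrough c S D ∧
    0 < interiorProd (generator u B T₁) (interiorProd (generator u B T₂) Ω) (c 0)
      ![(mfderiv 𝓘(ℝ, ℝ) (𝓡 3) c 0 (1 : ℝ) : TangentSpace (𝓡 3) (c 0))]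

/-- `D` is a region enclosed by `S`: a connected component of the complement of `S` with compact
closure. -/
def Encloses (S D : Set M) : Prop :=
  (∃ x ∈ Sᶜ, D = connectedComponentIn Sᶜ x) ∧ IsCompact (closure D)

/-- For each flux surface, labelled by `s ∈ J`, the set `D s` is the region enclosed by `S s`.
If `M` is connected and not compact, there is at most one such region. In a compact `M` both
sides of `S s` could qualify, and one has to choose the same side for neighbouring surfaces: there
is a point that stays outside. -/
structure IsEnclosedFamily (S D : ℝ → Set M) (J : Set ℝ) : Prop where
  encloses : ∀ s ∈ J, Encloses (S s) (D s)
  sameSide : CompactSpace M → ∀ s ∈ J, ∃ p, ∀ᶠ s' in 𝓝 s, p ∉ closure (D s')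

end Symmetry

end FluxSurface

namespace FluxSurface

/-! ### Integrals over the unit interval that depend on a parameter. -/

section ParametricIntegral

variable {E Q : Type*} [NormedAddCommGroup E] [NormedSpace ℝ E] [FiniteDimensional ℝ E]
  [NormedAddCommGroup Q] [NormedSpace ℝ Q]

/-! Since `i_u i_B Ω = dψ` has no zeros on `U`, the fields `u` and `B` are independent there and
tangent to the level sets of `ψ`. As they commute, every point has a flow box (`exists_flowBox`): a
chart in which `u`, `B` are the first two coordinate fields and `ψ` is the third coordinate. In it
`|Ω|` is Lebesgue measure, because `Ω(B, u, ∂_ψ) = dψ(∂_ψ) = 1` (`IsFlowBox.chartDensity_eq_one`).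

Translations in flow boxes give a local action of `ℝ²` on a compact level set `S`, which extends to
a global one (`HasFlowBoxes.exists_action`). Its orbits are open, so it is transitive on the
connected set `S`. It is locally free, so the periods are discrete; `S` is compact, so they come
within bounded distance of every point of `ℝ²`. Hence they form a lattice, whose fundamental domain
has area `|Δ|`. Cutting this domain into finitely many tiles, each inside a flow box, shows that the
layer `p₁ < ψ < p₂` has volume `|Δ| (p₂ - p₁) + o(p₂ - p₁)` as both ends tend to `s`
(`IsFlowAction.eventually_volumeMeasure_band`).

By connectedness of `M`, the regions enclosed by neighbouring surfaces lie on the same side of them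
(`IsRegionFamily.forall_below_or_forall_above`), so two such regions differ exactly by the layer in
between. Therefore `V' = σ |Δ|`, where `σ = ±1` records the side (`IsRegionFamily.exists_side`).
Finally `i_{∂θ₁} i_{∂θ₂} Ω = Δ dψ`, so a compatible order is one for which `Δ` has the sign `σ`
(`IsSide.mul_abs_Delta_eq`). -/

theorem continuousOn_integral_unitInterval {f : E → ℝ → Q} {V : Set E} (hV : IsOpen V)
    (hf : ContinuousOn (fun p : E × ℝ => f p.1 p.2) (V ×ˢ Icc 0 1)) :
    ContinuousOn (fun w => ∫ σ in (0 : ℝ)..1, f w σ) V := by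
  have : ProperSpace E := FiniteDimensional.proper ℝ E
  intro w hw
  obtain ⟨r, hr, hrV⟩ := Metric.nhds_basis_closedBall.mem_iff.1 (hV.mem_nhds hw)
  obtain ⟨C, hC⟩ := ((isCompact_closedBall w r).prod isCompact_Icc).exists_bound_of_continuousOn
    (hf.mono (prod_mono hrV Subset.rfl))
  have hI : uIoc (0 : ℝ) 1 ⊆ Icc 0 1 := by rw [uIoc_of_le zero_le_one]; exact Ioc_subset_Icc_self
  refine ContinuousAt.continuousWithinAt ?_
  refine intervalIntegral.continuousAt_of_dominated_interval (bound := fun _ => C) ?_ ?_ ?_ ?_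
  · filter_upwards [Metric.closedBall_mem_nhds w hr] with x hx
    have : ContinuousOn (f x) (Icc 0 1) :=
      hf.comp (f := fun σ => (x, σ)) (by fun_prop) fun σ hσ => ⟨hrV hx, hσ⟩
    exact (this.mono hI).aestronglyMeasurable measurableSet_uIoc
  · filter_upwards [Metric.closedBall_mem_nhds w hr] with x hx
    exact .of_forall fun σ hσ => hC (x, σ) ⟨hx, hI hσ⟩
  · exact intervalIntegrable_const
  · refine .of_forall fun σ hσ => ?_
    have : ContinuousOn (fun x => f x σ) V :=
      hf.comp (f := fun x => (x, σ)) (by fun_prop) fun x hx => ⟨hx, hI hσ⟩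
    exact this.continuousAt (hV.mem_nhds hw)

theorem hasFDerivAt_integral_unitInterval {f : E → ℝ → Q} {f' : E → ℝ → E →L[ℝ] Q} {V : Set E}
    (hV : IsOpen V) (hf : ∀ w ∈ V, ContinuousOn (f w) (Icc 0 1))
    (hf' : ContinuousOn (fun p : E × ℝ => f' p.1 p.2) (V ×ˢ Icc 0 1))
    (hd : ∀ w ∈ V, ∀ σ ∈ Icc (0 : ℝ) 1, HasFDerivAt (fun x => f x σ) (f' w σ) w)
    {w : E} (hw : w ∈ V) :
    HasFDerivAt (fun w => ∫ σ in (0 : ℝ)..1, f w σ) (∫ σ in (0 : ℝ)..1, f' w σ) w := by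
  have : ProperSpace E := FiniteDimensional.proper ℝ E
  obtain ⟨r, hr, hrV⟩ := Metric.nhds_basis_closedBall.mem_iff.1 (hV.mem_nhds hw)
  obtain ⟨C, hC⟩ := ((isCompact_closedBall w r).prod isCompact_Icc).exists_bound_of_continuousOn
    (hf'.mono (prod_mono hrV Subset.rfl))
  have hI : uIoc (0 : ℝ) 1 ⊆ Icc 0 1 := by rw [uIoc_of_le zero_le_one]; exact Ioc_subset_Icc_self
  refine intervalIntegral.hasFDerivAt_integral_of_dominated_of_fderiv_le (bound := fun _ => C)
    (Metric.closedBall_mem_nhds w hr) ?_ ?_ ?_ ?_ ?_ ?_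
  · filter_upwards [Metric.closedBall_mem_nhds w hr] with x hx
    exact ((hf x (hrV hx)).mono hI).aestronglyMeasurable measurableSet_uIoc
  · exact ContinuousOn.intervalIntegrable (by rw [uIcc_of_le zero_le_one]; exact hf w hw)
  · have : ContinuousOn (f' w) (Icc 0 1) :=
      hf'.comp (f := fun σ => (w, σ)) (by fun_prop) fun σ hσ => ⟨hw, hσ⟩
    exact (this.mono hI).aestronglyMeasurable measurableSet_uIoc
  · exact .of_forall fun σ hσ x hx => hC (x, σ) ⟨hx, hI hσ⟩
  · exact intervalIntegrable_const
  · exact .of_forall fun σ hσ x hx => hd x (hrV hx) σ (hI hσ)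

end ParametricIntegral

/-! ### A Poincaré lemma along the leaves of a product. -/

section Poincare

variable {P Q : Type*} [NormedAddCommGroup P] [NormedSpace ℝ P] [FiniteDimensional ℝ P]
  [NormedAddCommGroup Q] [NormedSpace ℝ Q] [CompleteSpace Q]

/-- The Poincaré lemma for 1-forms on `P` that depend on a real parameter. -/
theorem exists_primitive_with_parameter {η : P × ℝ → P →L[ℝ] Q} {w₀ : P × ℝ} {ρ : ℝ}
    (hη : ContDiffOn ℝ 1 η (Metric.ball w₀ ρ))
    (hclosed : ∀ w ∈ Metric.ball w₀ ρ, ∀ v v' : P,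
      fderiv ℝ η w (v, 0) v' = fderiv ℝ η w (v', 0) v) :
    ∃ (F : P × ℝ → Q) (F' : P × ℝ → (P × ℝ) →L[ℝ] Q),
      ContinuousOn F' (Metric.ball w₀ ρ) ∧
      ∀ w ∈ Metric.ball w₀ ρ, HasFDerivAt F (F' w) w ∧ ∀ v, F' w (v, 0) = η w v := by
  set V := Metric.ball w₀ ρ with hVdef
  have hV : IsOpen V := Metric.isOpen_ball
  set c := w₀.1
  -- the segment from the axis
  let ℓ : ℝ → (P × ℝ) →L[ℝ] (P × ℝ) := fun σ =>
    (σ • ContinuousLinearMap.fst ℝ P ℝ).prod (ContinuousLinearMap.snd ℝ P ℝ)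
  let g : ℝ → P × ℝ → P × ℝ := fun σ w => (c + σ • (w.1 - c), w.2)
  have hg : ∀ σ w, HasFDerivAt (g σ) (ℓ σ) w := by
    intro σ w
    have h1 : HasFDerivAt (fun w : P × ℝ => c + σ • (w.1 - c))
        (σ • ContinuousLinearMap.fst ℝ P ℝ) w :=
      ((hasFDerivAt_fst.sub_const c).const_smul σ).const_add c
    exact h1.prodMk hasFDerivAt_snd
  have hgV : ∀ w ∈ V, ∀ σ ∈ Icc (0 : ℝ) 1, g σ w ∈ V := by
    intro w hw σ hσ
    rw [hVdef, Metric.mem_ball, Prod.dist_eq, max_lt_iff] at hw ⊢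
    refine ⟨?_, hw.2⟩
    have : dist (c + σ • (w.1 - c)) c = σ * dist w.1 c := by
      rw [dist_eq_norm, add_sub_cancel_left, norm_smul, Real.norm_of_nonneg hσ.1, dist_eq_norm]
    calc dist (c + σ • (w.1 - c)) c = σ * dist w.1 c := this
      _ ≤ 1 * dist w.1 c := by gcongr; exact hσ.2
      _ < ρ := by rw [one_mul]; exact hw.1
  have hgc : Continuous fun p : (P × ℝ) × ℝ => g p.2 p.1 := by fun_prop
  have hηd : ∀ w ∈ V, HasFDerivAt η (fderiv ℝ η w) w := fun w hw =>
    ((hη.differentiableOn one_ne_zero).differentiableAt (hV.mem_nhds hw)).hasFDerivAt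
  have hη'c : ContinuousOn (fderiv ℝ η) V := hη.continuousOn_fderiv_of_isOpen hV le_rfl
  -- Only the `P` component is contracted to the centre and the parameter stays fixed, so closedness
  -- is needed in the `P` directions alone.
  let f : P × ℝ → ℝ → Q := fun w σ => η (g σ w) (w.1 - c)
  let f' : P × ℝ → ℝ → (P × ℝ) →L[ℝ] Q := fun w σ =>
    (η (g σ w)).comp (ContinuousLinearMap.fst ℝ P ℝ) +
      ((fderiv ℝ η (g σ w)).comp (ℓ σ)).flip (w.1 - c)
  have hmaps : MapsTo (fun p : (P × ℝ) × ℝ => g p.2 p.1) (V ×ˢ Icc 0 1) V :=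
    fun p hp => hgV p.1 hp.1 p.2 hp.2
  have hηg : ContinuousOn (fun p : (P × ℝ) × ℝ => η (g p.2 p.1)) (V ×ˢ Icc 0 1) :=
    hη.continuousOn.comp hgc.continuousOn hmaps
  have hη'g : ContinuousOn (fun p : (P × ℝ) × ℝ => fderiv ℝ η (g p.2 p.1)) (V ×ˢ Icc 0 1) :=
    hη'c.comp hgc.continuousOn hmaps
  have hℓ : Continuous fun p : (P × ℝ) × ℝ => ℓ p.2 := by
    have : (fun p : (P × ℝ) × ℝ => ℓ p.2) = fun p : (P × ℝ) × ℝ =>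
        p.2 • (ContinuousLinearMap.inl ℝ P ℝ).comp (ContinuousLinearMap.fst ℝ P ℝ) +
          (ContinuousLinearMap.inr ℝ P ℝ).comp (ContinuousLinearMap.snd ℝ P ℝ) := by
      funext p
      ext <;> simp [ℓ]
    rw [this]
    fun_prop
  have hf'c : ContinuousOn (fun p : (P × ℝ) × ℝ => f' p.1 p.2) (V ×ˢ Icc 0 1) := by
    refine (hηg.clm_comp continuousOn_const).add ?_
    have h1 : ContinuousOn (fun p : (P × ℝ) × ℝ => (fderiv ℝ η (g p.2 p.1)).comp (ℓ p.2))
        (V ×ˢ Icc 0 1) := hη'g.clm_comp hℓ.continuousOn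
    have h2 : ContinuousOn (fun p : (P × ℝ) × ℝ =>
        ((fderiv ℝ η (g p.2 p.1)).comp (ℓ p.2)).flip) (V ×ˢ Icc 0 1) :=
      (ContinuousLinearMap.flipₗᵢ ℝ (P × ℝ) P Q).continuous.comp_continuousOn h1
    exact h2.clm_apply (by fun_prop)
  have hd : ∀ w ∈ V, ∀ σ ∈ Icc (0 : ℝ) 1, HasFDerivAt (fun x => f x σ) (f' w σ) w := by
    intro w hw σ hσ
    have h1 : HasFDerivAt (fun x => η (g σ x)) ((fderiv ℝ η (g σ w)).comp (ℓ σ)) w :=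
      (hηd _ (hgV w hw σ hσ)).comp w (hg σ w)
    exact h1.clm_apply (hasFDerivAt_fst.sub_const c)
  have hfc : ∀ w ∈ V, ContinuousOn (f w) (Icc 0 1) := by
    intro w hw
    have h1 : ContinuousOn (fun σ => η (g σ w)) (Icc 0 1) :=
      hηg.comp (f := fun σ => (w, σ)) (by fun_prop) fun σ hσ => ⟨hw, hσ⟩
    exact h1.clm_apply continuousOn_const
  refine ⟨fun w => ∫ σ in (0 : ℝ)..1, f w σ, fun w => ∫ σ in (0 : ℝ)..1, f' w σ,
    continuousOn_integral_unitInterval hV hf'c, fun w hw =>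
    ⟨hasFDerivAt_integral_unitInterval hV hfc hf'c hd hw, fun v => ?_⟩⟩
  have hf'w : ContinuousOn (f' w) (Icc 0 1) :=
    hf'c.comp (f := fun σ => (w, σ)) (by fun_prop) fun σ hσ => ⟨hw, hσ⟩
  rw [ContinuousLinearMap.intervalIntegral_apply
    (ContinuousOn.intervalIntegrable (by rw [uIcc_of_le zero_le_one]; exact hf'w))]
  -- By closedness the integrand in the direction `(v, 0)` is an exact `σ`-derivative, and the
  -- fundamental theorem of calculus evaluates it.
  have hderiv : ∀ σ ∈ uIcc (0 : ℝ) 1, HasDerivAt (fun σ => σ • η (g σ w) v) (f' w σ (v, 0)) σ := by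
    intro σ hσ
    rw [uIcc_of_le zero_le_one] at hσ
    have h1 : HasDerivAt (fun σ => g σ w) ((w.1 - c, 0) : P × ℝ) σ := by
      have : HasDerivAt (fun σ : ℝ => c + σ • (w.1 - c)) (w.1 - c) σ := by
        simpa using ((hasDerivAt_id σ).smul_const (w.1 - c)).const_add c
      exact this.prodMk (hasDerivAt_const σ w.2)
    have h2 := (hηd _ (hgV w hw σ hσ)).comp_hasDerivAt σ h1
    have h3 := h2.clm_apply (hasDerivAt_const σ v)
    have h4 : HasDerivAt (fun σ => σ • η (g σ w) v) _ σ := (hasDerivAt_id σ).smul h3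
    convert h4 using 1
    simp only [f', add_apply, ContinuousLinearMap.comp_apply,
      ContinuousLinearMap.flip_apply, ContinuousLinearMap.coe_fst', id, one_smul, map_zero,
      add_zero,
      Function.comp_apply]
    have : ℓ σ (v, 0) = σ • ((v, 0) : P × ℝ) := by simp [ℓ]
    rw [this, map_smul, smul_apply, hclosed _ (hgV w hw σ hσ) v (w.1 - c),
      add_comm]
  have hw1 : g 1 w = w := by ext <;> simp [g]
  rw [intervalIntegral.integral_eq_sub_of_hasDerivAt hderiv
    (ContinuousOn.intervalIntegrable (by
      rw [uIcc_of_le zero_le_one]; exact hf'w.clm_apply continuousOn_const))]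
  simp [hw1]

end Poincare

/-! ### Simultaneous straightening of two commuting `C¹` fields in `ℝ³`. -/

section EuclideanFlowBox

/-- The linear coordinates `(t, r) ↦ (t₁, t₂, r)` on `ℝ³`. -/
noncomputable def toE3 : ((ℝ × ℝ) × ℝ) ≃L[ℝ] E3 :=
  LinearEquiv.toContinuousLinearEquiv
    { toFun := fun p => !₂[p.1.1, p.1.2, p.2]
      invFun := fun y => ((y 0, y 1), y 2)
      map_add' := fun p q => by ext i; fin_cases i <;> simp
      map_smul' := fun c p => by ext i; fin_cases i <;> simp
      left_inv := fun p => by simp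
      right_inv := fun y => by ext i; fin_cases i <;> simp }

@[simp] theorem toE3_apply_zero (p : (ℝ × ℝ) × ℝ) : toE3 p 0 = p.1.1 := rfl
@[simp] theorem toE3_apply_one (p : (ℝ × ℝ) × ℝ) : toE3 p 1 = p.1.2 := rfl
@[simp] theorem toE3_apply_two (p : (ℝ × ℝ) × ℝ) : toE3 p 2 = p.2 := rfl
@[simp] theorem toE3_symm_apply (y : E3) : toE3.symm y = ((y 0, y 1), y 2) := rfl

/-- A linear endomorphism that maps two vectors to `e₀, e₁` and has a nonzero third component
that vanishes on them is invertible. -/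
theorem exists_equiv_of_apply_eq {L : E3 →L[ℝ] E3} {x y : E3}
    (hx : L x = toE3 ((1, 0), 0)) (hy : L y = toE3 ((0, 1), 0)) (hz : ∃ v, L v 2 ≠ 0) :
    ∃ e : E3 ≃L[ℝ] E3, (e : E3 →L[ℝ] E3) = L := by
  obtain ⟨v, hv⟩ := hz
  have hsurj : Function.Surjective L := by
    intro w
    refine ⟨(w 2 / L v 2) • v + (w 0 - w 2 / L v 2 * L v 0) • x +
      (w 1 - w 2 / L v 2 * L v 1) • y, ?_⟩
    ext i
    fin_cases i <;> simp [hx, hy, hv]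
  have hinj : Function.Injective L := LinearMap.injective_iff_surjective.2 hsurj
  exact ⟨ContinuousLinearEquiv.ofBijective L (LinearMap.ker_eq_bot.2 hinj)
    (LinearMap.range_eq_top.2 hsurj), by ext; rfl⟩

/-- The linear combination `t₁ X + t₂ Y` as a linear map of `t`. -/
noncomputable def pairMap {E : Type*} [NormedAddCommGroup E] [NormedSpace ℝ E] (x y : E) :
    (ℝ × ℝ) →L[ℝ] E :=
  (ContinuousLinearMap.fst ℝ ℝ ℝ).smulRight x + (ContinuousLinearMap.snd ℝ ℝ ℝ).smulRight y

@[simp] theorem pairMap_apply {E : Type*} [NormedAddCommGroup E] [NormedSpace ℝ E] (x y : E)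
    (t : ℝ × ℝ) : pairMap x y t = t.1 • x + t.2 • y := rfl

/-- Linear coordinates adapted to two independent vectors in the kernel of a linear form. -/
theorem exists_adapted_equiv {x y : E3} (hind : LinearIndependent ℝ ![x, y]) {α : E3 →L[ℝ] ℝ}
    (hα : α ≠ 0) (hx : α x = 0) (hy : α y = 0) :
    ∃ Λ : E3 ≃L[ℝ] (ℝ × ℝ) × ℝ, (∀ v, (Λ v).2 = α v) ∧ Λ x = ((1, 0), 0) ∧ Λ y = ((0, 1), 0) := by
  obtain ⟨v, hv⟩ : ∃ v, α v = 1 := by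
    obtain ⟨v, hv⟩ : ∃ v, α v ≠ 0 := by
      by_contra! h
      exact hα (ContinuousLinearMap.ext h)
    exact ⟨(α v)⁻¹ • v, by simp [hv]⟩
  let m : (ℝ × ℝ) × ℝ →L[ℝ] E3 := (pairMap x y).coprod
    ((ContinuousLinearMap.id ℝ ℝ).smulRight v)
  have hm : ∀ p : (ℝ × ℝ) × ℝ, m p = p.1.1 • x + p.1.2 • y + p.2 • v := fun p => by simp [m]
  have hαm : ∀ p, α (m p) = p.2 := fun p => by simp [hm, hx, hy, hv]
  have hinj : Function.Injective m := by
    rw [injective_iff_map_eq_zero]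
    intro p hp
    have h2 : p.2 = 0 := by rw [← hαm, hp, map_zero]
    have h1 : p.1.1 • x + p.1.2 • y = 0 := by simpa [hm, h2] using hp
    obtain ⟨ha, hb⟩ := (LinearIndependent.pair_iff.1 hind) _ _ h1
    ext <;> simp [ha, hb, h2]
  have hdim : Module.finrank ℝ ((ℝ × ℝ) × ℝ) = Module.finrank ℝ E3 := by simp
  let e : ((ℝ × ℝ) × ℝ) ≃L[ℝ] E3 :=
    (LinearMap.linearEquivOfInjective (m : (ℝ × ℝ) × ℝ →ₗ[ℝ] E3) hinj hdim).toContinuousLinearEquiv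
  have he : ∀ p, e p = m p := fun p => rfl
  refine ⟨e.symm, fun w => ?_, ?_, ?_⟩
  · rw [← hαm, ← he, e.apply_symm_apply]
  · rw [e.symm_apply_eq, he]; simp [hm]
  · rw [e.symm_apply_eq, he]; simp [hm]

theorem continuousOn_clm_prod {T E F G : Type*} [TopologicalSpace T] [NormedAddCommGroup E]
    [NormedSpace ℝ E] [NormedAddCommGroup F] [NormedSpace ℝ F] [NormedAddCommGroup G]
    [NormedSpace ℝ G] {a : T → E →L[ℝ] F} {b : T → E →L[ℝ] G} {s : Set T}
    (ha : ContinuousOn a s) (hb : ContinuousOn b s) :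
    ContinuousOn (fun x => (a x).prod (b x)) s := by
  have h : (fun x => (a x).prod (b x)) = fun x =>
      (ContinuousLinearMap.inl ℝ F G).comp (a x) + (ContinuousLinearMap.inr ℝ F G).comp (b x) := by
    funext x
    ext v <;> simp
  rw [h]
  exact (continuousOn_const.clm_comp ha).add (continuousOn_const.clm_comp hb)

-- No flows are constructed. On each level set of `f` the coframe dual to `X, Y` is an `ℝ²`-valued
-- 1-form, and it is closed exactly because `X` and `Y` commute. A primitive of it gives the two
-- flow times as coordinates, and `f` is the third. The inverse function theorem turns these
-- functions into a chart.
set_option maxHeartbeats 1000000 in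
theorem exists_euclidean_flowBox {X Y : E3 → E3} {f : E3 → ℝ} {O : Set E3} (hO : IsOpen O)
    (hX : ContDiffOn ℝ 1 X O) (hY : ContDiffOn ℝ 1 Y O) (hf : ContDiffOn ℝ 1 f O)
    (hbr : ∀ q ∈ O, fderiv ℝ Y q (X q) = fderiv ℝ X q (Y q))
    (hfX : ∀ q ∈ O, fderiv ℝ f q (X q) = 0) (hfY : ∀ q ∈ O, fderiv ℝ f q (Y q) = 0)
    (hf0 : ∀ q ∈ O, fderiv ℝ f q ≠ 0) {p : E3} (hp : p ∈ O)
    (hind : LinearIndependent ℝ ![X p, Y p]) :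
    ∃ χ : OpenPartialHomeomorph E3 E3, p ∈ χ.source ∧ χ.source ⊆ O ∧ ∀ q ∈ χ.source,
      χ q 2 = f q ∧ ∃ L : E3 ≃L[ℝ] E3, HasFDerivAt χ (L : E3 →L[ℝ] E3) q ∧
        L (X q) = toE3 ((1, 0), 0) ∧ L (Y q) = toE3 ((0, 1), 0) := by
  have hXd : ∀ q ∈ O, HasFDerivAt X (fderiv ℝ X q) q := fun q hq =>
    ((hX.differentiableOn one_ne_zero).differentiableAt (hO.mem_nhds hq)).hasFDerivAt
  have hYd : ∀ q ∈ O, HasFDerivAt Y (fderiv ℝ Y q) q := fun q hq =>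
    ((hY.differentiableOn one_ne_zero).differentiableAt (hO.mem_nhds hq)).hasFDerivAt
  have hfd : ∀ q ∈ O, HasFDerivAt f (fderiv ℝ f q) q := fun q hq =>
    ((hf.differentiableOn one_ne_zero).differentiableAt (hO.mem_nhds hq)).hasFDerivAt
  obtain ⟨Λ, hΛ2, hΛX, hΛY⟩ := exists_adapted_equiv hind (hf0 p hp) (hfX p hp) (hfY p hp)
  let π : E3 →L[ℝ] ℝ × ℝ := (ContinuousLinearMap.fst ℝ (ℝ × ℝ) ℝ).comp (Λ : E3 →L[ℝ] (ℝ × ℝ) × ℝ)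
  -- This chart straightens only the level sets of `f`; the coordinates inside a level set are still
  -- linear ones.
  let G : E3 → (ℝ × ℝ) × ℝ := fun q => (π q, f q)
  have hGd : ∀ q ∈ O, HasFDerivAt G (π.prod (fderiv ℝ f q)) q := fun q hq =>
    π.hasFDerivAt.prodMk (hfd q hq)
  have hGp : HasFDerivAt G (Λ : E3 →L[ℝ] (ℝ × ℝ) × ℝ) p := by
    convert hGd p hp using 1
    ext v <;> simp [π, hΛ2]
  have hGc : ContDiffAt ℝ 1 G p :=
    π.contDiff.contDiffAt.prodMk (hf.contDiffAt (hO.mem_nhds hp))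
  let Θ := hGc.toOpenPartialHomeomorph G hGp one_ne_zero
  have hΘ : ∀ q, Θ q = G q := fun q => rfl
  have hpΘ : p ∈ Θ.source := hGc.mem_toOpenPartialHomeomorph_source hGp one_ne_zero
  have hHc : ContDiffAt ℝ 1 Θ.symm (G p) := hGc.to_localInverse hGp one_ne_zero
  have hHp : Θ.symm (G p) = p := Θ.left_inv hpΘ
  -- the frame in the adapted plane
  let S : E3 → (ℝ × ℝ) →L[ℝ] E3 := fun q => pairMap (X q) (Y q)
  let A : E3 → (ℝ × ℝ) →L[ℝ] (ℝ × ℝ) := fun q => π.comp (S q)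
  have hSc : ContDiffOn ℝ 1 S O :=
    (contDiffOn_const.smulRight hX).add (contDiffOn_const.smulRight hY)
  have hAc : ContDiffOn ℝ 1 A O := contDiffOn_const.clm_comp hSc
  have hAp : A p = 1 := by
    ext <;> simp [A, S, π, hΛX, hΛY]
  -- a ball on which everything is regular
  have hev : ∀ᶠ w in 𝓝 (G p), ContDiffAt ℝ 1 Θ.symm w ∧ w ∈ Θ.target ∧ Θ.symm w ∈ O ∧
      IsUnit (A (Θ.symm w)) := by
    have hcont : ContinuousAt Θ.symm (G p) := hHc.continuousAt
    refine (hHc.eventually (by simp)).and ((Θ.open_target.eventually_mem (Θ.map_source hpΘ)).and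
      ((hcont.eventually (by rw [hHp]; exact hO.mem_nhds hp)).and ?_))
    have hA1 : ContinuousAt A (Θ.symm (G p)) := by
      rw [hHp]; exact hAc.continuousOn.continuousAt (hO.mem_nhds hp)
    refine (hA1.comp hcont).eventually (Units.isOpen.mem_nhds ?_)
    simp [hHp, hAp]
  obtain ⟨ρ, hρ, hball⟩ := Metric.eventually_nhds_iff_ball.1 hev
  let a : (ℝ × ℝ) × ℝ → (ℝ × ℝ) →L[ℝ] (ℝ × ℝ) := fun w => A (Θ.symm w)
  -- The dual coframe in the chart `G`: the inverse of the matrix of `X, Y` in the leaf coordinates.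
  let η : (ℝ × ℝ) × ℝ → (ℝ × ℝ) →L[ℝ] (ℝ × ℝ) := fun w => Ring.inverse (a w)
  have hac : ∀ w ∈ Metric.ball (G p) ρ, ContDiffAt ℝ 1 a w := fun w hw =>
    (hAc.contDiffAt (hO.mem_nhds (hball w hw).2.2.1)).comp w (hball w hw).1
  have hηc : ∀ w ∈ Metric.ball (G p) ρ, ContDiffAt ℝ 1 η w := by
    intro w hw
    obtain ⟨un, hun⟩ := (hball w hw).2.2.2
    have h1 : ContDiffAt ℝ 1 Ring.inverse (a w) := by
      change ContDiffAt ℝ 1 Ring.inverse (A (Θ.symm w))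
      rw [← hun]; exact contDiffAt_ringInverse ℝ un
    exact h1.comp w (hac w hw)
  have hηa : ∀ w ∈ Metric.ball (G p) ρ, ∀ t, η w (a w t) = t := fun w hw t =>
    DFunLike.congr_fun (Ring.inverse_mul_cancel _ (hball w hw).2.2.2) t
  have haη : ∀ w ∈ Metric.ball (G p) ρ, ∀ t, a w (η w t) = t := fun w hw t =>
    DFunLike.congr_fun (Ring.mul_inverse_cancel _ (hball w hw).2.2.2) t
  -- Differentiating `η (a t) = t` along `a s` expresses `dη(a s)(a t)` through the derivative of `S
  -- t` in the direction `S s`. The vanishing bracket makes the latter symmetric in `s` and `t`;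
  -- then put `s = η v`, `t = η v'`.
  have hclosed : ∀ w ∈ Metric.ball (G p) ρ, ∀ v v' : ℝ × ℝ,
      fderiv ℝ η w (v, 0) v' = fderiv ℝ η w (v', 0) v := by
    intro w hw
    obtain ⟨hHw, hwt, hqO, -⟩ := hball w hw
    set q := Θ.symm w with hq
    have hqs : q ∈ Θ.source := Θ.map_target hwt
    have hHd : HasFDerivAt Θ.symm (fderiv ℝ Θ.symm w) w :=
      (hHw.differentiableAt one_ne_zero).hasFDerivAt
    have hHG : ∀ s, fderiv ℝ Θ.symm w (a w s, 0) = S q s := by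
      intro s
      have h1 : HasFDerivAt (Θ.symm ∘ G) ((fderiv ℝ Θ.symm w).comp (π.prod (fderiv ℝ f q))) q := by
        refine HasFDerivAt.comp q ?_ (hGd q hqO)
        have : G q = w := Θ.right_inv hwt
        rw [this]; exact hHd
      have h2 : Θ.symm ∘ G =ᶠ[𝓝 q] id := by
        filter_upwards [Θ.open_source.mem_nhds hqs] with x hx using Θ.left_inv hx
      have h3 := h1.unique ((hasFDerivAt_id q).congr_of_eventuallyEq h2)
      have h4 := DFunLike.congr_fun h3 (S q s)
      have h5 : fderiv ℝ f q (S q s) = 0 := by simp [S, hfX q hqO, hfY q hqO]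
      have h6 : a w s = π (S q s) := rfl
      rw [h6]
      simpa [h5] using h4
    have hdiff : ∀ s t, η w (π (fderiv ℝ (fun x => S x t) q (S q s))) +
        fderiv ℝ η w (a w s, 0) (a w t) = 0 := by
      intro s t
      have hSt : HasFDerivAt (fun x => S x t) (fderiv ℝ (fun x => S x t) q) q :=
        (((hSc.differentiableOn one_ne_zero).differentiableAt (hO.mem_nhds hqO)).clm_apply
          (differentiableAt_const t)).hasFDerivAt
      have h1 : HasFDerivAt (fun x => a x t)
          (π.comp ((fderiv ℝ (fun x => S x t) q).comp (fderiv ℝ Θ.symm w))) w :=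
        π.hasFDerivAt.comp w (HasFDerivAt.comp (g := fun x => S x t) w hSt hHd)
      have h2 : HasFDerivAt η (fderiv ℝ η w) w :=
        ((hηc w hw).differentiableAt one_ne_zero).hasFDerivAt
      have h3 := h2.clm_apply h1
      have h4 : (fun x => η x (a x t)) =ᶠ[𝓝 w] fun _ => t := by
        filter_upwards [Metric.isOpen_ball.mem_nhds hw] with x hx using hηa x hx t
      have h5 := h3.unique ((hasFDerivAt_const t w).congr_of_eventuallyEq h4)
      have h6 := DFunLike.congr_fun h5 (a w s, 0)
      simpa [hHG] using h6
    have hsymm : ∀ s t, fderiv ℝ (fun x => S x t) q (S q s) =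
        fderiv ℝ (fun x => S x s) q (S q t) := by
      have hS' : ∀ t v, fderiv ℝ (fun x => S x t) q v =
          t.1 • fderiv ℝ X q v + t.2 • fderiv ℝ Y q v := fun t v =>
        DFunLike.congr_fun
          (((hXd q hqO).const_smul t.1).add ((hYd q hqO).const_smul t.2)).fderiv v
      intro s t
      rw [hS', hS']
      simp only [S, pairMap_apply, map_add, map_smul, hbr q hqO]
      module
    intro v v'
    have e1 := hdiff (η w v) (η w v')
    have e2 := hdiff (η w v') (η w v)
    rw [hsymm, haη w hw, haη w hw] at e1
    rw [haη w hw, haη w hw] at e2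
    exact add_left_cancel (e1.trans e2.symm)
  obtain ⟨F, F', hF'c, hF⟩ := exists_primitive_with_parameter
    (fun w hw => (hηc w hw).contDiffWithinAt) hclosed
  -- the flow box
  let K : E3 → E3 := fun q => toE3 (F (G q), f q)
  let K' : E3 → E3 →L[ℝ] E3 := fun q =>
    (toE3 : (ℝ × ℝ) × ℝ →L[ℝ] E3).comp
      (((F' (G q)).comp (π.prod (fderiv ℝ f q))).prod (fderiv ℝ f q))
  have hGO : ContinuousOn G O := fun q hq => (hGd q hq).continuousAt.continuousWithinAt
  let W : Set E3 := Θ.source ∩ (O ∩ G ⁻¹' Metric.ball (G p) ρ)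
  have hW : IsOpen W := Θ.open_source.inter (hGO.isOpen_inter_preimage hO Metric.isOpen_ball)
  have hpW : p ∈ W := ⟨hpΘ, hp, Metric.mem_ball_self hρ⟩
  have hKd : ∀ q ∈ W, HasFDerivAt K (K' q) q := fun q hq =>
    (toE3 : (ℝ × ℝ) × ℝ →L[ℝ] E3).hasFDerivAt.comp q
      (((hF _ hq.2.2).1.comp q (hGd q hq.2.1)).prodMk (hfd q hq.2.1))
  have hK'c : ContinuousOn K' W := by
    have h1 : ContinuousOn (fderiv ℝ f) W :=
      (hf.continuousOn_fderiv_of_isOpen hO le_rfl).mono fun q hq => hq.2.1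
    have h2 : ContinuousOn (fun q => F' (G q)) W :=
      hF'c.comp (hGO.mono fun q hq => hq.2.1) fun q hq => hq.2.2
    have h3 : ContinuousOn (fun q => π.prod (fderiv ℝ f q)) W :=
      continuousOn_clm_prod continuousOn_const h1
    exact continuousOn_const.clm_comp (continuousOn_clm_prod (h2.clm_comp h3) h1)
  have hη1 : ∀ q ∈ W, ∀ t, F' (G q) (π (S q t), 0) = t := by
    intro q hq t
    rw [(hF _ hq.2.2).2]
    have : a (G q) t = π (S q t) := by
      have : Θ.symm (G q) = q := Θ.left_inv hq.1
      simp [a, A, this]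
    rw [← this, hηa _ hq.2.2]
  have hKX : ∀ q ∈ W, K' q (X q) = toE3 ((1, 0), 0) := fun q hq => by
    have := hη1 q hq (1, 0)
    simp only [S, pairMap_apply, one_smul, zero_smul, add_zero] at this
    simp [K', hfX q hq.2.1, this]
  have hKY : ∀ q ∈ W, K' q (Y q) = toE3 ((0, 1), 0) := fun q hq => by
    have := hη1 q hq (0, 1)
    simp only [S, pairMap_apply, one_smul, zero_smul, zero_add] at this
    simp [K', hfY q hq.2.1, this]
  have hequiv : ∀ q ∈ W, ∃ L : E3 ≃L[ℝ] E3, (L : E3 →L[ℝ] E3) = K' q := by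
    intro q hq
    refine exists_equiv_of_apply_eq (hKX q hq) (hKY q hq) ?_
    by_contra! h
    exact hf0 q hq.2.1 (ContinuousLinearMap.ext fun v => by simpa [K'] using h v)
  obtain ⟨L, hL⟩ := hequiv p hpW
  have hstrict : HasStrictFDerivAt K (L : E3 →L[ℝ] E3) p := by
    rw [hL]
    exact hasStrictFDerivAt_of_hasFDerivAt_of_continuousAt
      ((hW.eventually_mem hpW).mono hKd) (hK'c.continuousAt (hW.mem_nhds hpW))
  let χ := (hstrict.toOpenPartialHomeomorph K).restrOpen W hW
  have hχ : ∀ q, χ q = K q := fun q => rfl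
  refine ⟨χ, ⟨hstrict.mem_toOpenPartialHomeomorph_source, hpW⟩, fun q hq => hq.2.2.1,
    fun q hq => ⟨by rw [hχ]; rfl, ?_⟩⟩
  obtain ⟨L', hL'⟩ := hequiv q hq.2
  have hL'' : ∀ v, L' v = K' q v := fun v => DFunLike.congr_fun hL' v
  exact ⟨L', by rw [hL']; exact hKd q hq.2, by rw [hL'', hKX q hq.2], by rw [hL'', hKY q hq.2]⟩

end EuclideanFlowBox

/-! ### Flow boxes on the manifold. -/

section FlowBox

variable {M : Type*} [TopologicalSpace M] [ChartedSpace E3 M]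

/-- A flow box for two commuting vector fields tangent to the level sets of `ψ`: a differentiable
chart of `U` in which they are the first two coordinate fields and `ψ` is the third coordinate. -/
structure IsFlowBox (v w : VField M) (ψ : M → ℝ) (U : Set M) (χ : OpenPartialHomeomorph M E3) :
    Prop where
  subset : χ.source ⊆ U
  mdiff : χ.MDifferentiable (𝓡 3) (𝓡 3)
  map_fst : ∀ x ∈ χ.source, mfderiv (𝓡 3) (𝓡 3) χ x (v x) = toE3 ((1, 0), 0)
  map_snd : ∀ x ∈ χ.source, mfderiv (𝓡 3) (𝓡 3) χ x (w x) = toE3 ((0, 1), 0)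
  third : ∀ x ∈ χ.source, χ x 2 = ψ x

theorem interiorProd_interiorProd (X Y : VField M) (Ω : DForm M 3) (x : M)
    (ξ : TangentSpace (𝓡 3) x) :
    interiorProd X (interiorProd Y Ω) x ![ξ] = Ω x ![Y x, X x, ξ] := rfl

theorem chartForm_apply {k : ℕ} (η : DForm M k) (e : OpenPartialHomeomorph M E3) (y : E3)
    (v : Fin k → E3) :
    chartForm η e y v = η (e.symm y) (fun i => mfderiv (𝓡 3) (𝓡 3) e.symm y (v i)) := rfl

theorem continuousOn_form_apply {T : Type*} [TopologicalSpace T] {η : T → E3 [⋀^Fin 3]→L[ℝ] ℝ}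
    {X Y : T → E3} {s : Set T} (hη : ContinuousOn η s) (hX : ContinuousOn X s)
    (hY : ContinuousOn Y s) (v : E3) : ContinuousOn (fun y => η y ![X y, Y y, v]) s := by
  have h1 : ContinuousOn (fun y => (η y).curryLeft (X y)) s :=
    (ContinuousAlternatingMap.curryLeftLI
      (𝕜 := ℝ) (E := E3) (F := ℝ)).continuous.comp_continuousOn hη |>.clm_apply hX
  have h2 : ContinuousOn (fun y => ((η y).curryLeft (X y)).curryLeft (Y y)) s :=
    (ContinuousAlternatingMap.curryLeftLI
      (𝕜 := ℝ) (E := E3) (F := ℝ)).continuous.comp_continuousOn h1 |>.clm_apply hY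
  exact (continuous_eval_const (F := E3 [⋀^Fin 1]→L[ℝ] ℝ) ![v]).comp_continuousOn h2

variable [IsManifold (𝓡 3) ∞ M]

theorem isManifold_one : IsManifold (𝓡 3) 1 M := IsManifold.of_le (n := ∞) (by norm_cast)

/-- Everything is pulled back by an atlas chart to the Euclidean case. The identity `dψ = Ω(B, u,
·)` supplies what is missing there: `ψ` is `C¹`, it is constant along `u` and `B`, and `u`, `B` are
independent. -/
theorem exists_flowBox {Ω : DForm M 3} (hΩ : IsVolumeForm Ω) {B u : VField M} {ψ : M → ℝ}
    {U : Set M} (hU : IsOpen U) (hreg : ∀ x ∈ U, mfderiv (𝓡 3) 𝓘(ℝ, ℝ) ψ x ≠ 0)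
    (hsym : IsFluxFormSymmetryOn Ω B u ψ U) {x : M} (hx : x ∈ U) :
    ∃ χ : OpenPartialHomeomorph M E3, IsFlowBox u B ψ U χ ∧ x ∈ χ.source := by
  have : IsManifold (𝓡 3) 1 M := isManifold_one
  have : IsManifold (𝓡 3) (minSmoothness ℝ 2) M := by
    rw [minSmoothness_of_isRCLikeNormedField]
    exact IsManifold.of_le (n := ∞) (by norm_cast)
  set e := chartAt E3 x with he_def
  have he : e ∈ atlas E3 M := chart_mem_atlas E3 x
  have hemd : e.MDifferentiable (𝓡 3) (𝓡 3) := mdifferentiable_of_mem_atlas he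
  let O : Set E3 := e.target ∩ e.symm ⁻¹' U
  have hO : IsOpen O := e.isOpen_inter_preimage_symm hU
  let pull : VField M → E3 → E3 := fun X y =>
    VectorField.mpullback (𝓡 3) (𝓡 3) e.symm X y
  have hinv : ∀ y ∈ e.target, (mfderiv (𝓡 3) (𝓡 3) e.symm y).IsInvertible := fun y hy =>
    ⟨hemd.symm.mfderiv hy, rfl⟩
  have hpull : ∀ (X : VField M) (y : E3), y ∈ e.target →
      mfderiv (𝓡 3) (𝓡 3) e.symm y (pull X y) = X (e.symm y) := by
    intro X y hy
    exact (hinv y hy).self_apply_inverse _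
  have hsmooth : ∀ y ∈ e.target, ContMDiffAt (𝓡 3) (𝓡 3) ∞ e.symm y := fun y hy =>
    (contMDiffOn_symm_of_mem_maximalAtlas (IsManifold.subset_maximalAtlas he)).contMDiffAt
      (e.open_target.mem_nhds hy)
  have hC1 : ∀ X : VField M, IsC1On X U → ContDiffOn ℝ 1 (pull X) O := by
    intro X hX y hy
    have h1 : ContMDiffAt (𝓡 3) (𝓡 3).tangent 1 (fun x => (⟨x, X x⟩ : TangentBundle (𝓡 3) M))
      (e.symm y) := (hX _ hy.2).contMDiffAt (hU.mem_nhds hy.2)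
    have h2 := h1.mpullback_vectorField_preimage (hsmooth y hy.1) (hinv y hy.1)
      (by norm_cast)
    exact (contMDiffAt_vectorSpace_iff_contDiffAt.1 h2).contDiffWithinAt
  have hXc := hC1 u hsym.regu
  have hYc := hC1 B hsym.regB
  have hbr : ∀ y ∈ O, fderiv ℝ (pull B) y (pull u y) = fderiv ℝ (pull u) y (pull B y) := by
    intro y hy
    have hu : MDifferentiableAt (𝓡 3) (𝓡 3).tangent
        (fun x => (⟨x, u x⟩ : TangentBundle (𝓡 3) M)) (e.symm y) :=
      ((hsym.regu _ hy.2).contMDiffAt (hU.mem_nhds hy.2)).mdifferentiableAt one_ne_zero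
    have hB : MDifferentiableAt (𝓡 3) (𝓡 3).tangent
        (fun x => (⟨x, B x⟩ : TangentBundle (𝓡 3) M)) (e.symm y) :=
      ((hsym.regB _ hy.2).contMDiffAt (hU.mem_nhds hy.2)).mdifferentiableAt one_ne_zero
    have h1 := VectorField.mpullback_mlieBracket hu hB (hsmooth y hy.1)
      (by simp; norm_cast)
    rw [VectorField.mpullback_apply, hsym.comm _ hy.2, map_zero,
      ← VectorField.mlieBracketWithin_univ,
      VectorField.mlieBracketWithin_eq_lieBracketWithin] at h1
    have h2 : 0 = VectorField.lieBracketWithin ℝ (pull u) (pull B) univ y := h1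
    rw [VectorField.lieBracketWithin_univ] at h2
    exact sub_eq_zero.1 h2.symm
  let f : E3 → ℝ := ψ ∘ e.symm
  let f' : E3 → E3 →L[ℝ] ℝ := fun y =>
    (mfderiv (𝓡 3) 𝓘(ℝ, ℝ) ψ (e.symm y)).comp (mfderiv (𝓡 3) (𝓡 3) e.symm y)
  have hfd : ∀ y ∈ O, HasFDerivAt f (f' y) y := fun y hy =>
    ((hsym.diff _ hy.2).hasMFDerivAt.comp y
      (hemd.mdifferentiableAt_symm hy.1).hasMFDerivAt).hasFDerivAt
  have hf' : ∀ y ∈ O, ∀ v, fderiv ℝ f y v = chartForm Ω e y ![pull B y, pull u y, v] := by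
    intro y hy v
    refine (DFunLike.congr_fun (hfd y hy).fderiv v).trans ?_
    have h1 := hsym.dpsi _ hy.2 (mfderiv (𝓡 3) (𝓡 3) e.symm y v)
    rw [interiorProd_interiorProd] at h1
    refine h1.symm.trans (congrArg (Ω (e.symm y)) ?_)
    funext i
    fin_cases i
    · exact (hpull B y hy.1).symm
    · exact (hpull u y hy.1).symm
    · rfl
  -- `ψ` is only assumed differentiable, but its differential is a contraction of continuous
  -- objects.
  have hfc : ContDiffOn ℝ 1 f O := by
    refine (contDiffOn_succ_iff_fderiv_of_isOpen (n := 0) hO).2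
      ⟨fun y hy => (hfd y hy).differentiableAt.differentiableWithinAt, by simp, ?_⟩
    refine contDiffOn_clm_apply.2 fun v => contDiffOn_zero.2 ?_
    exact (continuousOn_form_apply (((hΩ.smooth e he).continuousOn).mono inter_subset_left)
      hYc.continuousOn hXc.continuousOn v).congr fun y hy => hf' y hy v
  have hfX : ∀ y ∈ O, fderiv ℝ f y (pull u y) = 0 := fun y hy => by
    rw [hf' y hy]
    exact (chartForm Ω e y).map_eq_zero_of_eq _ (i := 1) (j := 2) rfl (by decide)
  have hfY : ∀ y ∈ O, fderiv ℝ f y (pull B y) = 0 := fun y hy => by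
    rw [hf' y hy]
    exact (chartForm Ω e y).map_eq_zero_of_eq _ (i := 0) (j := 2) rfl (by decide)
  have hf0 : ∀ y ∈ O, fderiv ℝ f y ≠ 0 := by
    intro y hy h0
    refine hreg _ hy.2 ?_
    ext ξ
    obtain ⟨v, rfl⟩ := hemd.symm.mfderiv_surjective hy.1 ξ
    have h1 := DFunLike.congr_fun ((hfd y hy).fderiv.symm.trans h0) v
    exact h1
  have hxe : x ∈ e.source := mem_chart_source E3 x
  have hp : e x ∈ O := ⟨e.map_source hxe, by simpa [e.left_inv hxe] using hx⟩
  -- If `u` and `B` were dependent here, then `Ω(B, u, ·)`, and with it `dψ`, would vanish.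
  have hind : LinearIndependent ℝ ![pull u (e x), pull B (e x)] := by
    by_contra h
    refine hf0 _ hp (ContinuousLinearMap.ext fun v => ?_)
    rw [hf' _ hp]
    refine AlternatingMap.map_linearDependent (K := ℝ) (M := E3) (N := ℝ)
      (chartForm Ω e (e x)).toAlternatingMap _ fun hli => h ?_
    have h2 := hli.comp ![(1 : Fin 3), 0] (by decide)
    have h3 : (![pull B (e x), pull u (e x), v] ∘ ![(1 : Fin 3), 0]) =
        ![pull u (e x), pull B (e x)] := by
      funext i
      fin_cases i <;> rfl
    rwa [h3] at h2
  obtain ⟨χ, hpχ, hχO, hχ⟩ := exists_euclidean_flowBox hO hXc hYc hfc hbr hfX hfY hf0 hp hind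
  have hχmd : χ.MDifferentiable (𝓡 3) (𝓡 3) := by
    refine ⟨fun q hq => ?_, fun z hz => ?_⟩
    · obtain ⟨L, hL, -⟩ := (hχ q hq).2
      exact hL.differentiableAt.mdifferentiableAt.mdifferentiableWithinAt
    · obtain ⟨L, hL, -⟩ := (hχ _ (χ.map_target hz)).2
      exact (χ.hasFDerivAt_symm hz hL).differentiableAt.mdifferentiableAt.mdifferentiableWithinAt
  have hsrc : ∀ z ∈ (e.trans χ).source, z ∈ e.source ∧ e z ∈ χ.source := fun z hz => by
    simpa using hz
  have hcomp : ∀ (X : VField M), ∀ z ∈ (e.trans χ).source, ∀ L : E3 ≃L[ℝ] E3,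
      HasFDerivAt χ (L : E3 →L[ℝ] E3) (e z) →
      mfderiv (𝓡 3) (𝓡 3) (e.trans χ) z (X z) = L (pull X (e z)) := by
    intro X z hz L hL
    obtain ⟨hz1, hz2⟩ := hsrc z hz
    have h1 : mfderiv (𝓡 3) (𝓡 3) (e.trans χ) z =
        (mfderiv (𝓡 3) (𝓡 3) χ (e z)).comp (mfderiv (𝓡 3) (𝓡 3) e z) :=
      mfderiv_comp z (hχmd.mdifferentiableAt hz2) (hemd.mdifferentiableAt hz1)
    have h2 : mfderiv (𝓡 3) (𝓡 3) χ (e z) = (L : E3 →L[ℝ] E3) := by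
      rw [mfderiv_eq_fderiv]; exact hL.fderiv
    have h3 : mfderiv (𝓡 3) (𝓡 3) e z (X z) = pull X (e z) := by
      have h4 := hpull X (e z) (e.map_source hz1)
      rw [e.left_inv hz1] at h4
      rw [← h4]
      have h5 := DFunLike.congr_fun (hemd.comp_symm_deriv (e.map_source hz1)) (pull X (e z))
      rw [e.left_inv hz1] at h5
      exact h5
    rw [h1, h2]
    exact congrArg L h3
  refine ⟨e.trans χ, ⟨fun z hz => ?_, hemd.trans hχmd, fun z hz => ?_, fun z hz => ?_,
    fun z hz => ?_⟩, by simpa using ⟨hxe, hpχ⟩⟩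
  · obtain ⟨hz1, hz2⟩ := hsrc z hz
    have := (hχO hz2).2
    rwa [mem_preimage, e.left_inv hz1] at this
  · obtain ⟨L, hL, hLX, -⟩ := (hχ _ (hsrc z hz).2).2
    rw [hcomp u z hz L hL, hLX]
  · obtain ⟨L, hL, -, hLY⟩ := (hχ _ (hsrc z hz).2).2
    rw [hcomp B z hz L hL, hLY]
  · have := (hχ _ (hsrc z hz).2).1
    simpa [f, e.left_inv (hsrc z hz).1] using this

end FlowBox

/-! ### The measure `|Ω|` in arbitrary differentiable charts. -/

section VolumeMeasure

theorem measurableSet_inter_preimage_of_isOpen {X Y : Type*} [TopologicalSpace X]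
    [MeasurableSpace X] [BorelSpace X] [TopologicalSpace Y] [MeasurableSpace Y] [BorelSpace Y]
    {f : X → Y} {s : Set X} (hf : ContinuousOn f s) (hs : IsOpen s) {A : Set Y}
    (hA : MeasurableSet A) : MeasurableSet (s ∩ f ⁻¹' A) := by
  have h1 : Measurable (s.domRestrict f) :=
    (continuousOn_iff_continuous_domRestrict.1 hf).measurable
  have h2 := hs.measurableSet.subtype_image (h1 hA)
  convert h2 using 1
  ext x
  simp [and_comm]

theorem measurableSet_image_of_subset_source {X Y : Type*} [TopologicalSpace X]
    [MeasurableSpace X] [BorelSpace X] [TopologicalSpace Y] [MeasurableSpace Y] [BorelSpace Y]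
    (e : OpenPartialHomeomorph X Y) {A : Set X} (hA : MeasurableSet A) (hAe : A ⊆ e.source) :
    MeasurableSet (e '' A) := by
  rw [e.image_eq_target_inter_inv_preimage hAe]
  exact measurableSet_inter_preimage_of_isOpen e.continuousOn_symm e.open_target hA

/-- Forms of top degree are multiples of the determinant; this supplies the Jacobian for the change
of variables. -/
theorem abs_alternating_comp_linear (f : E3 [⋀^Fin 3]→L[ℝ] ℝ) (h : E3 →L[ℝ] E3) (b : Fin 3 → E3)
    (hb : b = EuclideanSpace.basisFun (Fin 3) ℝ) :
    ‖f (fun i => h (b i))‖ₑ = ENNReal.ofReal |h.det| * ‖f b‖ₑ := by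
  let bb : Module.Basis (Fin 3) ℝ E3 := (EuclideanSpace.basisFun (Fin 3) ℝ).toBasis
  have hbb : b = bb := by rw [hb]; simp [bb]
  have h1 := AlternatingMap.eq_smul_basis_det bb f.toAlternatingMap
  have h2 : ∀ v, f v = f bb * bb.det v := fun v => DFunLike.congr_fun h1 v
  have h3 : bb.det (fun i => h (bb i)) = h.det := by
    have := bb.det_comp (h : E3 →ₗ[ℝ] E3) bb
    rw [bb.det_self, mul_one] at this
    exact this
  rw [hbb, h2, h3, enorm_mul, mul_comm, Real.enorm_eq_ofReal_abs h.det]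

variable {M : Type*} [TopologicalSpace M] [ChartedSpace E3 M]

theorem chartDensity_eq_det_mul {Ω : DForm M 3} {χ e : OpenPartialHomeomorph M E3}
    (hχ : ∀ y ∈ χ.target, MDifferentiableAt (𝓡 3) (𝓡 3) χ.symm y)
    (he : e.MDifferentiable (𝓡 3) (𝓡 3)) {y : E3} (hy : y ∈ χ.target)
    (hye : χ.symm y ∈ e.source) :
    ∃ h' : E3 →L[ℝ] E3, HasFDerivAt (e ∘ χ.symm) h' y ∧
      chartDensity Ω χ y = ENNReal.ofReal |h'.det| * chartDensity Ω e (e (χ.symm y)) := by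
  let h' : E3 →L[ℝ] E3 :=
    (mfderiv (𝓡 3) (𝓡 3) e (χ.symm y)).comp (mfderiv (𝓡 3) (𝓡 3) χ.symm y)
  refine ⟨h', ((he.mdifferentiableAt hye).hasMFDerivAt.comp y (hχ y hy).hasMFDerivAt).hasFDerivAt,
    ?_⟩
  rw [chartDensity, chartDensity, ← abs_alternating_comp_linear _ h' _ rfl]
  congr 1
  rw [chartForm_apply, chartForm_apply, e.left_inv hye]
  congr 1
  funext i
  have h1 := DFunLike.congr_fun (he.symm_comp_deriv hye)
    (mfderiv (𝓡 3) (𝓡 3) χ.symm y (EuclideanSpace.basisFun (Fin 3) ℝ i))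
  exact h1.symm

theorem measurableSet_piece [SecondCountableTopology M] [Nonempty M] [MeasurableSpace M]
    [BorelSpace M] (n : ℕ) : MeasurableSet (piece M n) :=
  MeasurableSet.disjointed (fun k => (chartAt E3 (chartSeq M k)).open_source.measurableSet) n

theorem iUnion_piece [SecondCountableTopology M] [Nonempty M] : ⋃ n, piece M n = univ := by
  unfold piece
  rw [iUnion_disjointed]
  exact (exists_chart_seq M).choose_spec

theorem piece_subset [SecondCountableTopology M] [Nonempty M] (n : ℕ) :
    piece M n ⊆ (chartAt E3 (chartSeq M n)).source :=
  disjointed_subset _ n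

theorem map_withDensity_chart_apply {N : Type*} [TopologicalSpace N] [MeasurableSpace N]
    [BorelSpace N] {e : OpenPartialHomeomorph N E3} {P A : Set N}
    (hP : MeasurableSet P) (hPe : P ⊆ e.source) (hA : MeasurableSet A) (f : E3 → ℝ≥0∞) :
    ((((volume : Measure E3).restrict (e.target ∩ e.symm ⁻¹' P)).withDensity f).map e.symm) A =
      ∫⁻ y in e '' (A ∩ P), f y := by
  have hK : MeasurableSet (e.target ∩ e.symm ⁻¹' P) :=
    measurableSet_inter_preimage_of_isOpen e.continuousOn_symm e.open_target hP
  have hae : AEMeasurable e.symm ((volume : Measure E3).restrict (e.target ∩ e.symm ⁻¹' P)) :=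
    (e.continuousOn_symm.aemeasurable e.open_target.measurableSet).mono_measure
      (Measure.restrict_mono inter_subset_left le_rfl)
  have hnull : NullMeasurableSet (e.symm ⁻¹' A)
      ((volume : Measure E3).restrict (e.target ∩ e.symm ⁻¹' P)) := hae.nullMeasurable hA
  rw [Measure.map_apply_of_aemeasurable (hae.mono_ac (withDensity_absolutelyContinuous _ _)) hA,
    withDensity_apply₀ _ hnull, Measure.restrict_restrict₀ hnull,
    e.image_eq_target_inter_inv_preimage (inter_subset_right.trans hPe)]
  congr 2
  ext y
  simp only [mem_inter_iff, mem_preimage]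
  tauto

variable [IsManifold (𝓡 3) ∞ M] [SecondCountableTopology M] [Nonempty M] [MeasurableSpace M]
  [BorelSpace M]

/-- The volume measure is computed in any differentiable chart. -/
theorem volumeMeasure_apply_of_subset (Ω : DForm M 3) {χ : OpenPartialHomeomorph M E3}
    (hχ : ∀ y ∈ χ.target, MDifferentiableAt (𝓡 3) (𝓡 3) χ.symm y) {A : Set M}
    (hA : MeasurableSet A) (hAs : A ⊆ χ.source) :
    volumeMeasure Ω A = ∫⁻ y in χ '' A, chartDensity Ω χ y := by
  have : IsManifold (𝓡 3) 1 M := isManifold_one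
  have hdecomp : χ '' A = ⋃ n, χ '' (A ∩ piece M n) := by
    rw [← image_iUnion, ← inter_iUnion, iUnion_piece, inter_univ]
  have hmeas : ∀ n, MeasurableSet (χ '' (A ∩ piece M n)) := fun n =>
    measurableSet_image_of_subset_source χ (hA.inter (measurableSet_piece n))
      (inter_subset_left.trans hAs)
  have hdisj : Pairwise (Function.onFun Disjoint fun n => χ '' (A ∩ piece M n)) := by
    intro m n hmn
    have h1 : Disjoint (piece M m) (piece M n) := disjoint_disjointed _ hmn
    exact (h1.mono inter_subset_right inter_subset_right).image χ.injOn
      (inter_subset_left.trans hAs) (inter_subset_left.trans hAs)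
  rw [hdecomp, lintegral_iUnion hmeas hdisj, volumeMeasure, Measure.sum_apply _ hA]
  congr 1
  funext n
  set e := chartAt E3 (chartSeq M n)
  have he : e.MDifferentiable (𝓡 3) (𝓡 3) := mdifferentiable_chart _
  change (((volume.restrict (e.target ∩ e.symm ⁻¹' piece M n)).withDensity
        (chartDensity Ω e)).map e.symm) A = _
  rw [map_withDensity_chart_apply (measurableSet_piece n) (piece_subset n) hA]
  have himg : e '' (A ∩ piece M n) = (e ∘ χ.symm) '' (χ '' (A ∩ piece M n)) := by
    rw [image_comp]
    exact congrArg _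
      (χ.toPartialEquiv.symm_image_image_of_subset_source (inter_subset_left.trans hAs)).symm
  have hmem : ∀ y ∈ χ '' (A ∩ piece M n), y ∈ χ.target ∧ χ.symm y ∈ e.source := by
    rintro _ ⟨x, hx, rfl⟩
    exact ⟨χ.map_source (hAs hx.1), by rw [χ.left_inv (hAs hx.1)]; exact piece_subset n hx.2⟩
  have hd : ∀ y, ∃ h' : E3 →L[ℝ] E3, y ∈ χ '' (A ∩ piece M n) → HasFDerivAt (e ∘ χ.symm) h' y ∧
      chartDensity Ω χ y = ENNReal.ofReal |h'.det| * chartDensity Ω e (e (χ.symm y)) := by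
    intro y
    by_cases hy : y ∈ χ '' (A ∩ piece M n)
    · obtain ⟨h', hh⟩ := chartDensity_eq_det_mul (Ω := Ω) hχ he (hmem y hy).1 (hmem y hy).2
      exact ⟨h', fun _ => hh⟩
    · exact ⟨0, fun h => absurd h hy⟩
  choose h' hh' using hd
  have hinj : InjOn (e ∘ χ.symm) (χ '' (A ∩ piece M n)) := by
    intro y hy z hz hyz
    exact χ.symm.injOn (hmem y hy).1 (hmem z hz).1 (e.injOn (hmem y hy).2 (hmem z hz).2 hyz)
  -- This change of variables needs only an injective differentiable transition map, so flow boxes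
  -- are admitted although they are not smooth charts.
  rw [himg, lintegral_image_eq_lintegral_abs_det_fderiv_mul volume (hmeas n)
    (fun y hy => (hh' y hy).1.hasFDerivWithinAt) hinj]
  exact setLIntegral_congr_fun (hmeas n) fun y hy => (hh' y hy).2.symm

/-- In a chart the density is continuous, hence bounded on a small ball; compactness passes from
local to global finiteness. -/
theorem volumeMeasure_lt_top_of_isCompact {Ω : DForm M 3} (hΩ : IsVolumeForm Ω) {K : Set M}
    (hK : IsCompact K) : volumeMeasure Ω K < ⊤ := by
  have : IsManifold (𝓡 3) 1 M := isManifold_one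
  refine hK.measure_lt_top_of_nhdsWithin fun x _ => ?_
  set e := chartAt E3 x
  have hxe : x ∈ e.source := mem_chart_source E3 x
  have hcont : ContinuousOn (fun y => chartForm Ω e y
      (fun i => EuclideanSpace.basisFun (Fin 3) ℝ i)) e.target :=
    (continuous_eval_const (F := E3 [⋀^Fin 3]→L[ℝ] ℝ) _).comp_continuousOn
      (hΩ.smooth e (chart_mem_atlas E3 x)).continuousOn
  obtain ⟨r, hr, hrt⟩ := Metric.nhds_basis_closedBall.mem_iff.1
    (e.open_target.mem_nhds (e.map_source hxe))
  obtain ⟨C, hC⟩ := (isCompact_closedBall (e x) r).exists_bound_of_continuousOn (hcont.mono hrt)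
  let A : Set M := e.source ∩ e ⁻¹' Metric.ball (e x) r
  have hAo : IsOpen A := e.isOpen_inter_preimage Metric.isOpen_ball
  refine ⟨A, mem_nhdsWithin_of_mem_nhds (hAo.mem_nhds ⟨hxe, Metric.mem_ball_self hr⟩), ?_⟩
  rw [volumeMeasure_apply_of_subset Ω
    (fun y hy => (mdifferentiable_chart x).mdifferentiableAt_symm hy) hAo.measurableSet
    inter_subset_left]
  have hsub : e '' A ⊆ Metric.closedBall (e x) r := by
    rintro _ ⟨z, hz, rfl⟩
    exact Metric.ball_subset_closedBall hz.2
  calc ∫⁻ y in e '' A, chartDensity Ω e y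
      ≤ ∫⁻ y in e '' A, ENNReal.ofReal C := by
        refine setLIntegral_mono' (measurableSet_image_of_subset_source e hAo.measurableSet
          inter_subset_left) fun y hy => ?_
        rw [chartDensity, ← ofReal_norm]
        exact ENNReal.ofReal_le_ofReal (hC y (hsub hy))
    _ = ENNReal.ofReal C * volume (e '' A) := setLIntegral_const _ _
    _ < ⊤ := ENNReal.mul_lt_top ENNReal.ofReal_lt_top
        ((measure_mono hsub).trans_lt (isCompact_closedBall _ _).measure_lt_top)

end VolumeMeasure

/-! ### In a flow box the volume is Lebesgue measure. -/

section FlowBoxVolume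

variable {M : Type*} [TopologicalSpace M] [ChartedSpace E3 M]
  {Ω : DForm M 3} {B u : VField M} {ψ : M → ℝ} {U : Set M} {χ : OpenPartialHomeomorph M E3}

theorem IsFlowBox.mfderiv_symm_fst (hχ : IsFlowBox u B ψ U χ) {y : E3} (hy : y ∈ χ.target) :
    mfderiv (𝓡 3) (𝓡 3) χ.symm y (toE3 ((1, 0), 0) : E3) = u (χ.symm y) := by
  rw [← hχ.map_fst _ (χ.map_target hy)]
  have h1 := DFunLike.congr_fun (hχ.mdiff.symm_comp_deriv (χ.map_target hy)) (u (χ.symm y))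
  rw [χ.right_inv hy] at h1
  exact h1

theorem IsFlowBox.mfderiv_symm_snd (hχ : IsFlowBox u B ψ U χ) {y : E3} (hy : y ∈ χ.target) :
    mfderiv (𝓡 3) (𝓡 3) χ.symm y (toE3 ((0, 1), 0) : E3) = B (χ.symm y) := by
  rw [← hχ.map_snd _ (χ.map_target hy)]
  have h1 := DFunLike.congr_fun (hχ.mdiff.symm_comp_deriv (χ.map_target hy)) (B (χ.symm y))
  rw [χ.right_inv hy] at h1
  exact h1

theorem IsFlowBox.mfderiv_psi_symm (hχ : IsFlowBox u B ψ U χ)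
    (hψ : ∀ x ∈ U, MDifferentiableAt (𝓡 3) 𝓘(ℝ, ℝ) ψ x) {y : E3} (hy : y ∈ χ.target) (v : E3) :
    mfderiv (𝓡 3) 𝓘(ℝ, ℝ) ψ (χ.symm y) (mfderiv (𝓡 3) (𝓡 3) χ.symm y v) = v 2 := by
  let g' : E3 →L[ℝ] ℝ :=
    (mfderiv (𝓡 3) 𝓘(ℝ, ℝ) ψ (χ.symm y)).comp (mfderiv (𝓡 3) (𝓡 3) χ.symm y)
  have h1 : HasFDerivAt (ψ ∘ χ.symm) g' y :=
    ((hψ _ (hχ.subset (χ.map_target hy))).hasMFDerivAt.comp y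
      (hχ.mdiff.mdifferentiableAt_symm hy).hasMFDerivAt).hasFDerivAt
  have h2 : ψ ∘ χ.symm =ᶠ[𝓝 y] (EuclideanSpace.proj 2 : E3 →L[ℝ] ℝ) := by
    filter_upwards [χ.open_target.mem_nhds hy] with z hz
    have := hχ.third _ (χ.map_target hz)
    rw [χ.right_inv hz] at this
    exact this.symm
  exact DFunLike.congr_fun
    (h1.unique (((EuclideanSpace.proj 2 : E3 →L[ℝ] ℝ).hasFDerivAt).congr_of_eventuallyEq h2)) v

variable [IsManifold (𝓡 3) ∞ M]

/-- The coordinate fields are `u`, `B` and some `∂_ψ` with `dψ(∂_ψ) = 1`, and `Ω(B, u, ∂_ψ) =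
dψ(∂_ψ)`. -/
theorem IsFlowBox.chartDensity_eq_one (hχ : IsFlowBox u B ψ U χ)
    (hsym : IsFluxFormSymmetryOn Ω B u ψ U) {y : E3} (hy : y ∈ χ.target) :
    chartDensity Ω χ y = 1 := by
  have h1 := hsym.dpsi _ (hχ.subset (χ.map_target hy))
    (mfderiv (𝓡 3) (𝓡 3) χ.symm y (toE3 ((0, 0), 1)))
  rw [hχ.mfderiv_psi_symm hsym.diff hy, interiorProd_interiorProd,
    ← hχ.mfderiv_symm_fst hy, ← hχ.mfderiv_symm_snd hy] at h1
  have h2 : chartForm Ω χ y ![toE3 ((0, 1), 0), toE3 ((1, 0), 0), toE3 ((0, 0), 1)] = 1 := by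
    rw [chartForm_apply]
    refine Eq.trans (congrArg (Ω (χ.symm y)) ?_) h1
    funext i
    fin_cases i <;> rfl
  have h3 := (chartForm Ω χ y).toAlternatingMap.map_swap
    ![toE3 ((0, 1), 0), toE3 ((1, 0), 0), toE3 ((0, 0), 1)] (i := 0) (j := 1) (by decide)
  have h4 : (fun i => EuclideanSpace.basisFun (Fin 3) ℝ i) =
      ![toE3 ((0, 1), 0), toE3 ((1, 0), 0), toE3 ((0, 0), 1)] ∘ Equiv.swap (0 : Fin 3) 1 := by
    funext i
    ext j
    fin_cases i <;> fin_cases j <;> simp [toE3, Equiv.swap_apply_def]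
  rw [chartDensity, h4]
  -- The coordinate basis lists `u` before `B`, opposite to the order in `i_u i_B Ω`; the resulting
  -- sign disappears in the density.
  have h5 : chartForm Ω χ y (![toE3 ((0, 1), 0), toE3 ((1, 0), 0), toE3 ((0, 0), 1)] ∘
      Equiv.swap (0 : Fin 3) 1) = -1 := h3.trans (congrArg Neg.neg h2)
  rw [h5]
  simp

theorem IsFlowBox.volumeMeasure_apply [SecondCountableTopology M] [Nonempty M] [MeasurableSpace M]
    [BorelSpace M] (hχ : IsFlowBox u B ψ U χ) (hsym : IsFluxFormSymmetryOn Ω B u ψ U) {A : Set M}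
    (hA : MeasurableSet A) (hAs : A ⊆ χ.source) : volumeMeasure Ω A = volume (χ '' A) := by
  rw [volumeMeasure_apply_of_subset Ω (fun y hy => hχ.mdiff.mdifferentiableAt_symm hy) hA hAs,
    ← setLIntegral_one]
  refine setLIntegral_congr_fun (measurableSet_image_of_subset_source χ hA hAs) ?_
  rintro _ ⟨x, hx, rfl⟩
  exact hχ.chartDensity_eq_one hsym (χ.map_source (hAs hx))

end FlowBoxVolume

/-! ### Topology of the foliation and of the enclosed regions. -/

section ProperFoliation

variable {X : Type*} [TopologicalSpace X]

/-- The part of `U` where `ψ` takes values in `I`. -/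
def band (ψ : X → ℝ) (U : Set X) (I : Set ℝ) : Set X := U ∩ ψ ⁻¹' I

/-- The level sets of the continuous open map `ψ` on the open set `U` are compact and connected. -/
structure IsProperFoliation (ψ : X → ℝ) (U : Set X) : Prop where
  isOpen : IsOpen U
  continuousOn : ContinuousOn ψ U
  openMap : ∀ V ⊆ U, IsOpen V → IsOpen (ψ '' V)
  compact : ∀ s ∈ ψ '' U, IsCompact (surf ψ U s)
  connected : ∀ s ∈ ψ '' U, IsConnected (surf ψ U s)

variable {ψ : X → ℝ} {U : Set X}

theorem band_mono {X : Type*} {ψ : X → ℝ} {U : Set X} {I J : Set ℝ} (h : I ⊆ J) :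
    band ψ U I ⊆ band ψ U J :=
  inter_subset_inter_right _ (preimage_mono h)

theorem mem_band_of_mem_surf {X : Type*} {ψ : X → ℝ} {U : Set X} {s : ℝ} {I : Set ℝ}
    {x : X} (hx : x ∈ surf ψ U s) (hs : s ∈ I) :
    x ∈ band ψ U I := by
  refine ⟨hx.1, ?_⟩
  have : ψ x = s := hx.2
  rwa [mem_preimage, this]

theorem band_nonempty {X : Type*} {ψ : X → ℝ} {U : Set X} {I : Set ℝ} {s : ℝ} (hs : s ∈ I)
    (hI : I ⊆ ψ '' U) :
    (band ψ U I).Nonempty := by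
  obtain ⟨x, hx, rfl⟩ := hI hs
  exact ⟨x, hx, hs⟩

namespace IsProperFoliation

theorem isOpen_image (h : IsProperFoliation ψ U) : IsOpen (ψ '' U) :=
  h.openMap U Subset.rfl h.isOpen

theorem isOpen_band (h : IsProperFoliation ψ U) {I : Set ℝ} (hI : IsOpen I) :
    IsOpen (band ψ U I) :=
  h.continuousOn.isOpen_inter_preimage h.isOpen hI

/-- A separation of the band would, since `ψ` is open, give two open sets of values covering `I`.
These meet because `I` is connected, and a connected level set over a common value cannot be split.
-/
theorem isPreconnected_band (h : IsProperFoliation ψ U) {I : Set ℝ} (hI : IsPreconnected I)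
    (hIU : I ⊆ ψ '' U) : IsPreconnected (band ψ U I) := by
  intro V₁ V₂ hV₁ hV₂ hcover ⟨x₁, hx₁, hx₁V⟩ ⟨x₂, hx₂, hx₂V⟩
  have key := hI (ψ '' (U ∩ V₁)) (ψ '' (U ∩ V₂))
    (h.openMap _ inter_subset_left (h.isOpen.inter hV₁))
    (h.openMap _ inter_subset_left (h.isOpen.inter hV₂)) ?_
    ⟨ψ x₁, hx₁.2, x₁, ⟨hx₁.1, hx₁V⟩, rfl⟩ ⟨ψ x₂, hx₂.2, x₂, ⟨hx₂.1, hx₂V⟩, rfl⟩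
  · obtain ⟨s, hs, ⟨y₁, hy₁, hy₁s⟩, ⟨y₂, hy₂, hy₂s⟩⟩ := key
    have hsub : surf ψ U s ⊆ V₁ ∪ V₂ := fun z hz => hcover (mem_band_of_mem_surf hz hs)
    obtain ⟨z, hz, hzV⟩ := (h.connected s (hIU hs)).isPreconnected V₁ V₂ hV₁ hV₂ hsub
      ⟨y₁, ⟨hy₁.1, hy₁s⟩, hy₁.2⟩ ⟨y₂, ⟨hy₂.1, hy₂s⟩, hy₂.2⟩
    exact ⟨z, mem_band_of_mem_surf hz hs, hzV⟩
  · intro s hs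
    obtain ⟨y, hy, rfl⟩ := hIU hs
    exact (hcover ⟨hy, hs⟩).imp (fun hyV => ⟨y, ⟨hy, hyV⟩, rfl⟩) fun hyV => ⟨y, ⟨hy, hyV⟩, rfl⟩

theorem band_mem_nhds (h : IsProperFoliation ψ U) {s : ℝ} {I : Set ℝ} (hI : I ∈ 𝓝 s) {x : X}
    (hx : x ∈ surf ψ U s) : band ψ U I ∈ 𝓝 x := by
  have hs : ψ x = s := hx.2
  refine inter_mem (h.isOpen.mem_nhds hx.1) ?_
  exact (h.continuousOn.continuousAt (h.isOpen.mem_nhds hx.1)).preimage_mem_nhds (by rwa [hs])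

theorem surf_subset_closure_band (h : IsProperFoliation ψ U) {s : ℝ} {I : Set ℝ}
    (hI : s ∈ closure I) : surf ψ U s ⊆ closure (band ψ U I) := by
  intro x hx
  rw [mem_closure_iff]
  intro V hV hxV
  have hs : ψ x = s := hx.2
  obtain ⟨r, ⟨y, hy, rfl⟩, hrI⟩ := mem_closure_iff.1 hI (ψ '' (U ∩ V))
    (h.openMap _ inter_subset_left (h.isOpen.inter hV)) ⟨x, ⟨hx.1, hxV⟩, hs⟩
  exact ⟨y, hy.2, hy.1, hrI⟩

theorem neg (h : IsProperFoliation ψ U) : IsProperFoliation (fun x => -ψ x) U where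
  isOpen := h.isOpen
  continuousOn := h.continuousOn.neg
  openMap V hV hVo := by
    have : (fun x => -ψ x) '' V = (fun r : ℝ => -r) '' (ψ '' V) := by rw [image_image]
    rw [this]
    exact (Homeomorph.neg ℝ).isOpenMap _ (h.openMap V hV hVo)
  compact s hs := by
    obtain ⟨x, hx, rfl⟩ := hs
    have : surf (fun x => -ψ x) U (-ψ x) = surf ψ U (ψ x) := by ext; simp [surf]
    rw [this]
    exact h.compact _ ⟨x, hx, rfl⟩
  connected s hs := by
    obtain ⟨x, hx, rfl⟩ := hs
    have : surf (fun x => -ψ x) U (-ψ x) = surf ψ U (ψ x) := by ext; simp [surf]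
    rw [this]
    exact h.connected _ ⟨x, hx, rfl⟩

variable [T2Space X] [LocallyCompactSpace X]

/-- Level sets close to a given one are contained in a given neighbourhood of it. -/
theorem eventually_surf_subset (h : IsProperFoliation ψ U) {s : ℝ} (hs : s ∈ ψ '' U) {O : Set X}
    (hO : IsOpen O) (hsO : surf ψ U s ⊆ O) : ∀ᶠ r in 𝓝 s, surf ψ U r ⊆ O := by
  obtain ⟨V, hV, hsV, hVO, hVc⟩ := exists_open_between_and_isCompact_closure (h.compact s hs)
    (hO.inter h.isOpen) (subset_inter hsO inter_subset_left)
  have hVU : V ⊆ U := subset_closure.trans (hVO.trans inter_subset_right)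
  have hF : IsCompact (frontier V) :=
    hVc.of_isClosed_subset isClosed_frontier frontier_subset_closure
  have hFU : frontier V ⊆ U := frontier_subset_closure.trans (hVO.trans inter_subset_right)
  -- The image of the compact frontier is closed and misses `s`. So nearby level sets miss the
  -- frontier of `V`, and being connected and meeting `V` they stay inside.
  have h1 : ∀ᶠ r in 𝓝 s, r ∉ ψ '' frontier V := by
    refine (hF.image_of_continuousOn (h.continuousOn.mono hFU)).isClosed.isOpen_compl.mem_nhds ?_
    rintro ⟨x, hx, hxs⟩
    have : x ∈ V := hsV ⟨hFU hx, hxs⟩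
    rw [hV.frontier_eq] at hx
    exact hx.2 this
  have h2 : ∀ᶠ r in 𝓝 s, r ∈ ψ '' V := by
    obtain ⟨x, hx⟩ := (h.connected s hs).nonempty
    exact (h.openMap V hVU hV).mem_nhds ⟨x, hsV hx, hx.2⟩
  filter_upwards [h1, h2] with r hr1 hr2
  obtain ⟨x, hx, hxr⟩ := hr2
  have hsub : surf ψ U r ⊆ V := by
    refine (h.connected r ⟨x, hVU hx, hxr⟩).isPreconnected.subset_of_closure_inter_subset hV
      ⟨x, ⟨hVU hx, hxr⟩, hx⟩ ?_
    rintro y ⟨hyc, hyr⟩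
    by_contra hyV
    exact hr1 ⟨y, by rw [hV.frontier_eq]; exact ⟨hyc, hyV⟩, hyr.2⟩
  exact hsub.trans (subset_closure.trans (hVO.trans inter_subset_left))

theorem eventually_surf_subset_isCompact (h : IsProperFoliation ψ U) {s : ℝ} (hs : s ∈ ψ '' U) :
    ∃ K ⊆ U, IsCompact K ∧ ∀ᶠ r in 𝓝 s, surf ψ U r ⊆ K := by
  obtain ⟨V, hV, hsV, hVU, hVc⟩ := exists_open_between_and_isCompact_closure (h.compact s hs)
    h.isOpen inter_subset_left
  refine ⟨closure V, hVU, hVc, ?_⟩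
  filter_upwards [h.eventually_surf_subset hs hV hsV] with r hr using hr.trans subset_closure

end IsProperFoliation

/-- The properties of an enclosed region. -/
structure IsRegion (S D : Set X) : Prop where
  isOpen : IsOpen D
  nonempty : D.Nonempty
  isPreconnected : IsPreconnected D
  disjoint : Disjoint D S
  closure_subset : closure D ⊆ D ∪ S
  isCompact : IsCompact (closure D)

/-- Components of an open set are open in a locally connected space. A closure point off `S` can be
added to the component without losing connectedness, so it already belongs to it. -/
theorem Encloses.isRegion [LocallyConnectedSpace X] {S D : Set X} (hS : IsClosed S)
    (h : Encloses S D) : IsRegion S D := by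
  obtain ⟨⟨x, hx, rfl⟩, hc⟩ := h
  have hpre : IsPreconnected (connectedComponentIn Sᶜ x) := isPreconnected_connectedComponentIn
  refine ⟨hS.isOpen_compl.connectedComponentIn, ⟨x, mem_connectedComponentIn hx⟩, hpre,
    disjoint_left.2 fun y hy hyS => connectedComponentIn_subset _ _ hy hyS, ?_, hc⟩
  · intro y hy
    by_cases hyS : y ∈ S
    · exact Or.inr hyS
    · left
      have h1 : IsPreconnected (insert y (connectedComponentIn Sᶜ x)) :=
        hpre.subset_closure (subset_insert _ _) (insert_subset hy subset_closure)
      exact h1.subset_connectedComponentIn (mem_insert_of_mem _ (mem_connectedComponentIn hx))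
        (insert_subset hyS (connectedComponentIn_subset _ _)) (mem_insert _ _)

theorem IsRegion.subset_of_isPreconnected {S D T : Set X} (h : IsRegion S D)
    (hT : IsPreconnected T) (hTS : Disjoint T S) (hTD : (T ∩ D).Nonempty) : T ⊆ D :=
  hT.subset_of_closure_inter_subset h.isOpen hTD fun _ hx =>
    (h.closure_subset hx.1).resolve_right fun hxS => hTS.le_bot ⟨hx.2, hxS⟩

/-- If the region `D₁` is bounded by `S₁`, on whose other side there is a layer `L` bounded by
`S₁` and `S₂`, then the region inside `S₂` that contains them is their union. -/
theorem IsRegion.eq_union {S₁ S₂ D₁ D₂ L : Set X} (h₁ : IsRegion S₁ D₁) (h₂ : IsRegion S₂ D₂)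
    (hopen : IsOpen (D₁ ∪ L)) (hL : closure L ⊆ L ∪ S₂) (hSL : S₁ ⊆ L)
    (hD : D₁ ⊆ D₂) (hLD : L ⊆ D₂) : D₂ = D₁ ∪ L := by
  refine Subset.antisymm ?_ (union_subset hD hLD)
  obtain ⟨x, hx⟩ := h₁.nonempty
  refine h₂.isPreconnected.subset_of_closure_inter_subset hopen ⟨x, hD hx, Or.inl hx⟩ ?_
  rintro y ⟨hy, hyD⟩
  rw [closure_union] at hy
  rcases hy with hy | hy
  · exact (h₁.closure_subset hy).imp_right fun hyS => hSL hyS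
  · exact Or.inr ((hL hy).resolve_right fun hyS => h₂.disjoint.le_bot ⟨hyD, hyS⟩)

/-- A family of regions over an interval `(a, b)` of level sets. -/
structure IsRegionFamily (ψ : X → ℝ) (U : Set X) (D : ℝ → Set X) (a b : ℝ) : Prop where
  foliation : IsProperFoliation ψ U
  subset_image : Ioo a b ⊆ ψ '' U
  isRegion : ∀ s ∈ Ioo a b, IsRegion (surf ψ U s) (D s)
  bounded : ∃ K ⊆ U, IsCompact K ∧ band ψ U (Ioo a b) ⊆ K
  outside : CompactSpace X → ∃ p, ∀ s ∈ Ioo a b, p ∉ closure (D s)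

namespace IsRegionFamily

variable {D : ℝ → Set X} {a b : ℝ}

/-- Changing the sign of `ψ` exchanges the two sides, so that regions lying above need no separate
decomposition argument. -/
theorem neg (h : IsRegionFamily ψ U D a b) :
    IsRegionFamily (fun x => -ψ x) U (fun s => D (-s)) (-b) (-a) := by
  have hmem : ∀ s, s ∈ Ioo (-b) (-a) → -s ∈ Ioo a b := fun s hs =>
    ⟨by linarith [hs.2], by linarith [hs.1]⟩
  refine ⟨h.foliation.neg, fun s hs => ?_, fun s hs => ?_, ?_, fun hc => ?_⟩
  · obtain ⟨x, hx, hxs⟩ := h.subset_image (hmem s hs)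
    exact ⟨x, hx, by simp [hxs]⟩
  · have : surf (fun x => -ψ x) U s = surf ψ U (-s) := by
      ext x; simp [surf, neg_eq_iff_eq_neg]
    rw [this]
    exact h.isRegion _ (hmem s hs)
  · obtain ⟨K, hKU, hK, hb⟩ := h.bounded
    refine ⟨K, hKU, hK, fun x hx => hb ⟨hx.1, ?_⟩⟩
    simpa using hmem _ hx.2
  · obtain ⟨p, hp⟩ := h.outside hc
    exact ⟨p, fun s hs => hp _ (hmem s hs)⟩

theorem isCompact_band [T2Space X] (h : IsRegionFamily ψ U D a b) {I : Set ℝ} (hI : IsClosed I)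
    (hIab : I ⊆ Ioo a b) : IsCompact (band ψ U I) := by
  obtain ⟨K, hKU, hK, hb⟩ := h.bounded
  have : band ψ U I = K ∩ ψ ⁻¹' I := by
    refine Subset.antisymm (fun x hx => ⟨hb (band_mono hIab hx), hx.2⟩) fun x hx => ⟨hKU hx.1, hx.2⟩
  rw [this]
  exact hK.of_isClosed_subset
    ((h.foliation.continuousOn.mono hKU).preimage_isClosed_of_isClosed hK.isClosed hI)
    inter_subset_left

variable {s : ℝ}

theorem isPreconnected_below (h : IsRegionFamily ψ U D a b) (hs : s ∈ Ioo a b) :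
    IsPreconnected (band ψ U (Ioo a s)) :=
  h.foliation.isPreconnected_band isPreconnected_Ioo
    ((Ioo_subset_Ioo_right hs.2.le).trans h.subset_image)

theorem isPreconnected_above (h : IsRegionFamily ψ U D a b) (hs : s ∈ Ioo a b) :
    IsPreconnected (band ψ U (Ioo s b)) :=
  h.foliation.isPreconnected_band isPreconnected_Ioo
    ((Ioo_subset_Ioo_left hs.1.le).trans h.subset_image)

theorem disjoint_band_surf {X : Type*} {ψ : X → ℝ} {U : Set X} {s : ℝ} {I : Set ℝ} (hI : s ∉ I) :
    Disjoint (band ψ U I) (surf ψ U s) := by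
  rw [disjoint_left]
  rintro x hx hxs
  have : ψ x = s := hxs.2
  exact hI (this ▸ hx.2)

theorem subset_of_inter_nonempty_below (h : IsRegionFamily ψ U D a b) (hs : s ∈ Ioo a b)
    (hne : (band ψ U (Ioo a s) ∩ D s).Nonempty) : band ψ U (Ioo a s) ⊆ D s :=
  (h.isRegion s hs).subset_of_isPreconnected (h.isPreconnected_below hs)
    (disjoint_band_surf (by simp)) hne

theorem subset_of_inter_nonempty_above (h : IsRegionFamily ψ U D a b) (hs : s ∈ Ioo a b)
    (hne : (band ψ U (Ioo s b) ∩ D s).Nonempty) : band ψ U (Ioo s b) ⊆ D s :=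
  (h.isRegion s hs).subset_of_isPreconnected (h.isPreconnected_above hs)
    (disjoint_band_surf (by simp)) hne

theorem surf_subset_closure (h : IsRegionFamily ψ U D a b) (hs : s ∈ Ioo a b)
    (hD : band ψ U (Ioo a s) ⊆ D s ∨ band ψ U (Ioo s b) ⊆ D s) :
    surf ψ U s ⊆ closure (D s) := by
  rcases hD with hD | hD
  · refine (h.foliation.surf_subset_closure_band ?_).trans (closure_mono hD)
    rw [closure_Ioo hs.1.ne]
    exact right_mem_Icc.2 hs.1.le
  · refine (h.foliation.surf_subset_closure_band ?_).trans (closure_mono hD)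
    rw [closure_Ioo hs.2.ne]
    exact left_mem_Icc.2 hs.2.le

variable [PreconnectedSpace X]

/-- As `M` is connected, `D s` has a frontier point, which lies on the surface. Near it `D s` meets
the band off the surface, and each half of the band is connected and disjoint from the surface, so
it is swallowed whole once met. -/
theorem below_or_above (h : IsRegionFamily ψ U D a b) (hs : s ∈ Ioo a b) :
    band ψ U (Ioo a s) ⊆ D s ∨ band ψ U (Ioo s b) ⊆ D s := by
  have hR := h.isRegion s hs
  obtain ⟨x, hx⟩ := (h.foliation.connected s (h.subset_image hs)).nonempty
  have hne : D s ≠ univ := fun hu => hR.disjoint.le_bot ⟨hu ▸ mem_univ x, hx⟩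
  obtain ⟨y, hy⟩ := nonempty_frontier_iff.2 ⟨hR.nonempty, hne⟩
  rw [hR.isOpen.frontier_eq] at hy
  have hyS : y ∈ surf ψ U s := (hR.closure_subset hy.1).resolve_left hy.2
  obtain ⟨z, hz, hzD⟩ := mem_closure_iff_nhds.1 hy.1 _
    (h.foliation.band_mem_nhds (Ioo_mem_nhds hs.1 hs.2) hyS)
  have hzs : ψ z ≠ s := fun hzs => hR.disjoint.le_bot ⟨hzD, hz.1, hzs⟩
  rcases hzs.lt_or_gt with hlt | hgt
  · exact Or.inl (h.subset_of_inter_nonempty_below hs ⟨z, ⟨hz.1, hz.2.1, hlt⟩, hzD⟩)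
  · exact Or.inr (h.subset_of_inter_nonempty_above hs ⟨z, ⟨hz.1, hgt, hz.2.2⟩, hzD⟩)

theorem surf_subset_closure' (h : IsRegionFamily ψ U D a b) (hs : s ∈ Ioo a b) :
    surf ψ U s ⊆ closure (D s) :=
  h.surf_subset_closure hs (h.below_or_above hs)

/-- If both halves were inside, `closure (D s)` would also be open, hence the whole space. The space
would then be compact, and the point that stays outside gives the contradiction. -/
theorem not_above_of_below (h : IsRegionFamily ψ U D a b) (hs : s ∈ Ioo a b)
    (hb : band ψ U (Ioo a s) ⊆ D s) : ¬ band ψ U (Ioo s b) ⊆ D s := by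
  intro ha
  have hR := h.isRegion s hs
  have heq : D s ∪ surf ψ U s = D s ∪ band ψ U (Ioo a b) := by
    refine Subset.antisymm (union_subset_union_right _ fun x hx => mem_band_of_mem_surf hx hs) ?_
    refine union_subset subset_union_left fun x hx => ?_
    rcases lt_trichotomy (ψ x) s with hlt | heq | hgt
    · exact Or.inl (hb ⟨hx.1, hx.2.1, hlt⟩)
    · exact Or.inr ⟨hx.1, heq⟩
    · exact Or.inl (ha ⟨hx.1, hgt, hx.2.2⟩)
  have hclos : closure (D s) = D s ∪ surf ψ U s :=
    Subset.antisymm hR.closure_subset (union_subset subset_closure (h.surf_subset_closure' hs))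
  have hclopen : IsClopen (closure (D s)) := by
    refine ⟨isClosed_closure, ?_⟩
    rw [hclos, heq]
    exact hR.isOpen.union (h.foliation.isOpen_band isOpen_Ioo)
  have huniv := hclopen.eq_univ hR.nonempty.closure
  obtain ⟨p, hp⟩ := h.outside ⟨huniv ▸ hR.isCompact⟩
  exact hp s hs (huniv ▸ mem_univ p)

/-- Here the two regions overlap and each contains the bounding surface of the other, so the union
of their closures is clopen. -/
theorem not_above_below (h : IsRegionFamily ψ U D a b) {s₁ s₂ : ℝ} (h₁ : s₁ ∈ Ioo a b)
    (h₂ : s₂ ∈ Ioo a b) (hlt : s₁ < s₂) (ha : band ψ U (Ioo s₁ b) ⊆ D s₁)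
    (hb : band ψ U (Ioo a s₂) ⊆ D s₂) : False := by
  have hR₁ := h.isRegion s₁ h₁
  have hR₂ := h.isRegion s₂ h₂
  have heq : closure (D s₁) ∪ closure (D s₂) = D s₁ ∪ D s₂ := by
    refine Subset.antisymm (union_subset
      (hR₁.closure_subset.trans (union_subset subset_union_left ?_))
      (hR₂.closure_subset.trans (union_subset subset_union_right ?_)))
      (union_subset_union subset_closure subset_closure)
    · exact fun x hx => Or.inr (hb (mem_band_of_mem_surf hx ⟨h₁.1, hlt⟩))
    · exact fun x hx => Or.inl (ha (mem_band_of_mem_surf hx ⟨hlt, h₂.2⟩))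
  have hclopen : IsClopen (closure (D s₁) ∪ closure (D s₂)) :=
    ⟨isClosed_closure.union isClosed_closure, heq ▸ hR₁.isOpen.union hR₂.isOpen⟩
  have huniv := hclopen.eq_univ hR₁.nonempty.closure.inl
  obtain ⟨p, hp⟩ := h.outside ⟨huniv ▸ hR₁.isCompact.union hR₂.isCompact⟩
  have : p ∈ closure (D s₁) ∪ closure (D s₂) := huniv ▸ mem_univ p
  exact this.elim (hp s₁ h₁) (hp s₂ h₂)

/-- Here the regions face away from each other; adding the compact layer between the surfaces closes
the gap and again gives a clopen compact set. -/
theorem not_below_above [T2Space X] (h : IsRegionFamily ψ U D a b) {s₁ s₂ : ℝ} (h₁ : s₁ ∈ Ioo a b)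
    (h₂ : s₂ ∈ Ioo a b) (hb : band ψ U (Ioo a s₁) ⊆ D s₁)
    (ha : band ψ U (Ioo s₂ b) ⊆ D s₂) : False := by
  have hR₁ := h.isRegion s₁ h₁
  have hR₂ := h.isRegion s₂ h₂
  have hsub : Icc s₁ s₂ ⊆ Ioo a b := Icc_subset_Ioo h₁.1 h₂.2
  have hK := h.isCompact_band isClosed_Icc hsub
  have heq : closure (D s₁) ∪ closure (D s₂) ∪ band ψ U (Icc s₁ s₂) =
      D s₁ ∪ D s₂ ∪ band ψ U (Ioo a b) := by
    refine Subset.antisymm (union_subset (union_subset ?_ ?_) ?_) (union_subset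
      (subset_union_of_subset_left (union_subset_union subset_closure subset_closure) _) ?_)
    · exact hR₁.closure_subset.trans (union_subset (fun x hx => Or.inl (Or.inl hx))
        fun x hx => Or.inr (mem_band_of_mem_surf hx h₁))
    · exact hR₂.closure_subset.trans (union_subset (fun x hx => Or.inl (Or.inr hx))
        fun x hx => Or.inr (mem_band_of_mem_surf hx h₂))
    · exact (band_mono hsub).trans subset_union_right
    · intro x hx
      rcases lt_or_ge (ψ x) s₁ with hx1 | hx1
      · exact Or.inl (Or.inl (subset_closure (hb ⟨hx.1, hx.2.1, hx1⟩)))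
      rcases lt_or_ge s₂ (ψ x) with hx2 | hx2
      · exact Or.inl (Or.inr (subset_closure (ha ⟨hx.1, hx2, hx.2.2⟩)))
      · exact Or.inr ⟨hx.1, hx1, hx2⟩
  have hclopen : IsClopen (closure (D s₁) ∪ closure (D s₂) ∪ band ψ U (Icc s₁ s₂)) :=
    ⟨(isClosed_closure.union isClosed_closure).union hK.isClosed,
      heq ▸ (hR₁.isOpen.union hR₂.isOpen).union (h.foliation.isOpen_band isOpen_Ioo)⟩
  have huniv := hclopen.eq_univ hR₁.nonempty.closure.inl.inl
  obtain ⟨p, hp⟩ := h.outside ⟨huniv ▸ (hR₁.isCompact.union hR₂.isCompact).union hK⟩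
  have : p ∈ closure (D s₁) ∪ closure (D s₂) ∪ band ψ U (Icc s₁ s₂) := huniv ▸ mem_univ p
  rcases this with (hp1 | hp2) | hp3
  · exact hp s₁ h₁ hp1
  · exact hp s₂ h₂ hp2
  -- A point of the layer lies on its own level set, hence in the closure of the region of that
  -- level.
  · exact hp _ (hsub hp3.2) (h.surf_subset_closure' (hsub hp3.2) ⟨hp3.1, rfl⟩)

/-- The enclosed regions are all on the same side. -/
theorem forall_below_or_forall_above [T2Space X] (h : IsRegionFamily ψ U D a b) :
    (∀ s ∈ Ioo a b, band ψ U (Ioo a s) ⊆ D s) ∨ (∀ s ∈ Ioo a b, band ψ U (Ioo s b) ⊆ D s) := by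
  by_contra! hcon
  obtain ⟨⟨s₁, h₁, hs₁⟩, s₂, h₂, hs₂⟩ := hcon
  have ha₁ := (h.below_or_above h₁).resolve_left hs₁
  have hb₂ := (h.below_or_above h₂).resolve_right hs₂
  rcases lt_trichotomy s₁ s₂ with hlt | rfl | -
  · exact h.not_above_below h₁ h₂ hlt ha₁ hb₂
  · exact hs₁ hb₂
  · exact h.not_below_above h₂ h₁ hb₂ ha₁

theorem disjoint_above (h : IsRegionFamily ψ U D a b) (hs : s ∈ Ioo a b)
    (hb : band ψ U (Ioo a s) ⊆ D s) : Disjoint (D s) (band ψ U (Ico s b)) := by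
  rw [disjoint_left]
  intro x hx hxb
  rcases hxb.2.1.eq_or_lt with heq | hlt
  · exact (h.isRegion s hs).disjoint.le_bot ⟨hx, hxb.1, heq.symm⟩
  · exact h.not_above_of_below hs hb
      (h.subset_of_inter_nonempty_above hs ⟨x, ⟨hxb.1, hlt, hxb.2.2⟩, hx⟩)

theorem disjoint_closure_above (h : IsRegionFamily ψ U D a b) (hs : s ∈ Ioo a b)
    (hb : band ψ U (Ioo a s) ⊆ D s) : Disjoint (closure (D s)) (band ψ U (Ioo s b)) :=
  ((h.disjoint_above hs hb).mono_right (band_mono Ioo_subset_Ico_self)).closure_left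
    (h.foliation.isOpen_band isOpen_Ioo)

/-- This turns differences of enclosed volumes into volumes of layers. The layer contains the inner
surface and not the outer one, since the regions are open. -/
theorem eq_union_band [T2Space X] (h : IsRegionFamily ψ U D a b) {s₁ s₂ : ℝ} (h₁ : s₁ ∈ Ioo a b)
    (h₂ : s₂ ∈ Ioo a b) (hlt : s₁ < s₂) (hb₁ : band ψ U (Ioo a s₁) ⊆ D s₁)
    (hb₂ : band ψ U (Ioo a s₂) ⊆ D s₂) :
    D s₂ = D s₁ ∪ band ψ U (Ico s₁ s₂) ∧ Disjoint (D s₁) (band ψ U (Ico s₁ s₂)) := by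
  refine ⟨?_, (h.disjoint_above h₁ hb₁).mono_right (band_mono (Ico_subset_Ico_right h₂.2.le))⟩
  have hR₁ := h.isRegion s₁ h₁
  have hR₂ := h.isRegion s₂ h₂
  refine hR₁.eq_union hR₂ ?_ ?_ (fun x hx => mem_band_of_mem_surf hx (left_mem_Ico.2 hlt)) ?_ ?_
  · have : D s₁ ∪ band ψ U (Ico s₁ s₂) = D s₁ ∪ band ψ U (Ioo a s₂) := by
      refine Subset.antisymm (union_subset_union_right _
        (band_mono fun r hr => ⟨h₁.1.trans_le hr.1, hr.2⟩)) (union_subset subset_union_left ?_)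
      intro x hx
      rcases lt_or_ge (ψ x) s₁ with hx1 | hx1
      · exact Or.inl (hb₁ ⟨hx.1, hx.2.1, hx1⟩)
      · exact Or.inr ⟨hx.1, hx1, hx.2.2⟩
    rw [this]
    exact hR₁.isOpen.union (h.foliation.isOpen_band isOpen_Ioo)
  · refine (closure_minimal (band_mono Ico_subset_Icc_self)
      (h.isCompact_band isClosed_Icc (Icc_subset_Ioo h₁.1 h₂.2)).isClosed).trans fun x hx => ?_
    rcases hx.2.2.eq_or_lt with heq | hlt'
    · exact Or.inr ⟨hx.1, heq⟩
    · exact Or.inl ⟨hx.1, hx.2.1, hlt'⟩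
  -- `D s₁` is connected, avoids the surface of level `s₂` because that one lies above it, and
  -- shares a lower band with `D s₂`.
  · refine hR₂.subset_of_isPreconnected hR₁.isPreconnected ?_ ?_
    · exact (h.disjoint_above h₁ hb₁).mono_right fun x hx =>
        mem_band_of_mem_surf (I := Ico s₁ b) hx ⟨hlt.le, h₂.2⟩
    · obtain ⟨r, hr⟩ := exists_between h₁.1
      obtain ⟨x, hx⟩ := band_nonempty (ψ := ψ) (U := U) (I := Ioo a s₁) hr
        ((Ioo_subset_Ioo_right h₁.2.le).trans h.subset_image)
      exact ⟨x, hb₁ hx, hb₂ (band_mono (Ioo_subset_Ioo_right hlt.le) hx)⟩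
  · exact (band_mono (J := Ioo a s₂) fun r hr => ⟨h₁.1.trans_le hr.1, hr.2⟩).trans hb₂

theorem eq_union_band_of_above [T2Space X] (h : IsRegionFamily ψ U D a b) {s₁ s₂ : ℝ}
    (h₁ : s₁ ∈ Ioo a b) (h₂ : s₂ ∈ Ioo a b) (hlt : s₁ < s₂) (ha₁ : band ψ U (Ioo s₁ b) ⊆ D s₁)
    (ha₂ : band ψ U (Ioo s₂ b) ⊆ D s₂) :
    D s₁ = D s₂ ∪ band ψ U (Ioc s₁ s₂) ∧ Disjoint (D s₂) (band ψ U (Ioc s₁ s₂)) := by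
  have hband : ∀ r c : ℝ, band (fun x => -ψ x) U (Ioo (-c) (-r)) = band ψ U (Ioo r c) := by
    intro r c; ext x; simp [band, and_comm]
  have hband' : band (fun x => -ψ x) U (Ico (-s₂) (-s₁)) = band ψ U (Ioc s₁ s₂) := by
    ext x; simp [band, and_comm]
  have hmem : ∀ s ∈ Ioo a b, -s ∈ Ioo (-b) (-a) := fun s hs =>
    ⟨by linarith [hs.2], by linarith [hs.1]⟩
  have key := h.neg.eq_union_band (hmem _ h₂) (hmem _ h₁) (neg_lt_neg hlt)
    (by rw [hband, neg_neg]; exact ha₂) (by rw [hband, neg_neg]; exact ha₁)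
  simpa only [neg_neg, hband'] using key

theorem disjoint_closure_below (h : IsRegionFamily ψ U D a b) (hs : s ∈ Ioo a b)
    (ha : band ψ U (Ioo s b) ⊆ D s) : Disjoint (closure (D s)) (band ψ U (Ioo a s)) := by
  refine Disjoint.closure_left ?_ (h.foliation.isOpen_band isOpen_Ioo)
  rw [disjoint_left]
  intro x hx hxb
  exact h.not_above_of_below hs (h.subset_of_inter_nonempty_below hs ⟨x, hxb, hx⟩) ha

end IsRegionFamily

theorem IsEnclosedFamily.exists_isRegionFamily {M : Type*} [TopologicalSpace M] [T2Space M]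
    [LocallyCompactSpace M] [LocallyConnectedSpace M] {ψ : M → ℝ} {U : Set M} {D : ℝ → Set M}
    (hψ : IsProperFoliation ψ U) (hD : IsEnclosedFamily (surf ψ U) D (ψ '' U)) {s : ℝ}
    (hs : s ∈ ψ '' U) : ∃ a b, s ∈ Ioo a b ∧ IsRegionFamily ψ U D a b := by
  obtain ⟨K, hKU, hK, hKs⟩ := hψ.eventually_surf_subset_isCompact hs
  have hout : ∃ p : M, CompactSpace M → ∀ᶠ s' in 𝓝 s, p ∉ closure (D s') := by
    by_cases hc : CompactSpace M
    · exact (hD.sameSide hc s hs).imp fun p hp _ => hp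
    -- For noncompact `M` the condition on `p` is void and any point serves.
    · obtain ⟨x, -, -⟩ := hs
      exact ⟨x, fun h => absurd h hc⟩
  obtain ⟨p, hp⟩ := hout
  have hp' : ∀ᶠ s' in 𝓝 s, CompactSpace M → p ∉ closure (D s') := by
    by_cases hc : CompactSpace M
    · filter_upwards [hp hc] with r hr _ using hr
    · exact .of_forall fun r h => absurd h hc
  obtain ⟨a, b, hab, hsub⟩ := mem_nhds_iff_exists_Ioo_subset.1
    ((hψ.isOpen_image.eventually_mem hs).and (hKs.and hp'))
  refine ⟨a, b, hab, hψ, fun r hr => (hsub hr).1, fun r hr => ?_, ⟨K, hKU, hK, fun x hx => ?_⟩,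
    fun hc => ⟨p, fun r hr => (hsub hr).2.2 hc⟩⟩
  · exact (hD.encloses r (hsub hr).1).isRegion (hψ.compact r (hsub hr).1).isClosed
  · exact (hsub hx.2).2.1 ⟨hx.1, rfl⟩

end ProperFoliation

/-! ### The action of `ℝ²` on a compact level set. -/

section LocalAction

/-- A local one-parameter law on a ball of a normed space extends to a homomorphism. -/
theorem exists_extension_of_local_hom {E G : Type*} [NormedAddCommGroup E] [NormedSpace ℝ E]
    [Monoid G] {a : E → G} {ε : ℝ} (hε : 0 < ε) (h0 : a 0 = 1)
    (hadd : ∀ t t', ‖t‖ + ‖t'‖ < ε → a (t + t') = a t * a t') :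
    ∃ φ : E → G, (∀ t t', φ (t + t') = φ t * φ t') ∧ ∀ t, ‖t‖ < ε → φ t = a t := by
  have hpow : ∀ (k : ℕ) (t : E), k * ‖t‖ < ε → a ((k : ℝ) • t) = a t ^ k := by
    intro k t
    induction k with
    | zero => intro _; simp [h0]
    | succ k ih =>
      intro hk
      push_cast at hk ⊢
      rw [add_one_mul] at hk
      have h1 : ‖(k : ℝ) • t‖ = k * ‖t‖ := by simp [norm_smul]
      rw [add_smul, one_smul, hadd _ _ (by rw [h1]; exact hk),
        ih (by linarith [norm_nonneg t]), pow_succ]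
  -- The extension will be `a (t / N) ^ N`; the added one makes `‖t / N‖ < ε` strict.
  let N : E → ℕ := fun t => ⌊‖t‖ / ε⌋₊ + 1
  have hN : ∀ t, ‖t‖ < N t * ε := by
    intro t
    rw [← div_lt_iff₀ hε]
    simpa [N] using Nat.lt_floor_add_one (‖t‖ / ε)
  have hpos : ∀ (n : ℕ) (t : E), ‖t‖ < n * ε → (0 : ℝ) < n := by
    intro n t h
    by_contra hn
    have : (n : ℝ) * ε ≤ 0 := mul_nonpos_of_nonpos_of_nonneg (not_lt.1 hn) hε.le
    linarith [norm_nonneg t]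
  have hrefine : ∀ (m n : ℕ) (t : E), (0 : ℝ) < m → ‖t‖ < n * ε →
      a ((n : ℝ)⁻¹ • t) ^ n = a (((n * m : ℕ) : ℝ)⁻¹ • t) ^ (n * m) := by
    intro m n t hm h
    have hn := hpos n t h
    have h1 : ((n : ℝ)⁻¹ • t) = (m : ℝ) • (((n * m : ℕ) : ℝ)⁻¹ • t) := by
      rw [smul_smul]
      congr 1
      push_cast
      field_simp
    rw [h1, hpow m, ← pow_mul, mul_comm m n]
    have h2 : (m : ℝ) * ‖((n * m : ℕ) : ℝ)⁻¹ • t‖ = (n : ℝ)⁻¹ * ‖t‖ := by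
      rw [norm_smul, norm_inv, Real.norm_natCast]
      push_cast
      field_simp
    rwa [h2, inv_mul_lt_iff₀ hn]
  -- Two subdivisions are compared through their common refinement into `m * n` steps.
  have hindep : ∀ (m n : ℕ) (t : E), ‖t‖ < m * ε → ‖t‖ < n * ε →
      a ((m : ℝ)⁻¹ • t) ^ m = a ((n : ℝ)⁻¹ • t) ^ n := by
    intro m n t hm hn
    rw [hrefine n m t (hpos n t hn) hm, hrefine m n t (hpos m t hm) hn, mul_comm m n]
  refine ⟨fun t => a ((N t : ℝ)⁻¹ • t) ^ N t, fun t t' => ?_, fun t ht => ?_⟩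
  -- A common subdivision fine enough for both `t` and `t'`, and so for their sum; the small steps
  -- commute because addition does.
  · let n := N t + N t'
    have hn : ‖t‖ + ‖t'‖ < n * ε := by
      have := add_lt_add (hN t) (hN t')
      simpa [n, add_mul] using this
    have hnt : ‖t‖ < n * ε := by linarith [norm_nonneg t']
    have hnt' : ‖t'‖ < n * ε := by linarith [norm_nonneg t]
    have hn0 := hpos n t hnt
    have hsum : ‖(n : ℝ)⁻¹ • t‖ + ‖(n : ℝ)⁻¹ • t'‖ < ε := by
      rw [norm_smul, norm_smul, ← mul_add, norm_inv, Real.norm_natCast, inv_mul_lt_iff₀ hn0]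
      exact hn
    have hcomm : Commute (a ((n : ℝ)⁻¹ • t)) (a ((n : ℝ)⁻¹ • t')) := by
      rw [commute_iff_eq, ← hadd _ _ hsum, ← hadd _ _ (by rwa [add_comm] at hsum), add_comm]
    dsimp only
    rw [hindep _ n _ (hN _) ((norm_add_le _ _).trans_lt hn), hindep _ n _ (hN t) hnt,
      hindep _ n _ (hN t') hnt', smul_add, hadd _ _ hsum, hcomm.mul_pow]
  · have := hindep (N t) 1 t (hN t) (by simpa using ht)
    simpa using this

variable {M : Type*} [TopologicalSpace M] [ChartedSpace E3 M] {u B : VField M} {ψ : M → ℝ}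
  {U : Set M} {χ : OpenPartialHomeomorph M E3}

theorem IsFlowBox.mfderiv_symm_generator (hχ : IsFlowBox u B ψ U χ) {y : E3} (hy : y ∈ χ.target)
    (T : ℝ × ℝ) :
    mfderiv (𝓡 3) (𝓡 3) χ.symm y (toE3 (T, 0) : E3) = generator u B T (χ.symm y) := by
  have h : (toE3 (T, 0) : E3) = T.1 • toE3 ((1, 0), 0) + T.2 • toE3 ((0, 1), 0) := by
    ext i; fin_cases i <;> simp
  have h1 := (mfderiv (𝓡 3) (𝓡 3) χ.symm y).map_add (T.1 • toE3 ((1, 0), 0) : E3)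
    (T.2 • toE3 ((0, 1), 0) : E3)
  have h2 := (mfderiv (𝓡 3) (𝓡 3) χ.symm y).map_smul T.1 (toE3 ((1, 0), 0) : E3)
  have h3 := (mfderiv (𝓡 3) (𝓡 3) χ.symm y).map_smul T.2 (toE3 ((0, 1), 0) : E3)
  rw [hχ.mfderiv_symm_fst hy] at h2
  rw [hχ.mfderiv_symm_snd hy] at h3
  rw [h]
  exact h1.trans (congrArg₂ _ h2 h3)

theorem IsFlowBox.mfderiv_generator (hχ : IsFlowBox u B ψ U χ) {x : M} (hx : x ∈ χ.source)
    (T : ℝ × ℝ) :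
    mfderiv (𝓡 3) (𝓡 3) χ x (generator u B T x) = toE3 (T, 0) := by
  have h1 := hχ.mfderiv_symm_generator (χ.map_source hx) T
  rw [χ.left_inv hx] at h1
  rw [← h1]
  have h2 := DFunLike.congr_fun (hχ.mdiff.comp_symm_deriv (χ.map_source hx)) (toE3 (T, 0) : E3)
  rw [χ.left_inv hx] at h2
  exact h2

/-- Straight lines in a flow box are integral curves. -/
theorem IsFlowBox.isMIntegralCurveAt_line (hχ : IsFlowBox u B ψ U χ) {y : E3} {T : ℝ × ℝ} {τ₀ τ : ℝ}
    (hτ : y + (τ - τ₀) • toE3 (T, 0) ∈ χ.target) :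
    IsMIntegralCurveAt (I := 𝓡 3) (fun τ => χ.symm (y + (τ - τ₀) • toE3 (T, 0)))
      (generator u B T) τ := by
  have hcont : Continuous fun τ : ℝ => y + (τ - τ₀) • toE3 (T, 0) := by fun_prop
  filter_upwards [hcont.continuousAt.preimage_mem_nhds (χ.open_target.mem_nhds hτ)] with r hr
  have h1 : HasMFDerivAt 𝓘(ℝ, ℝ) (𝓡 3) (fun τ : ℝ => y + (τ - τ₀) • toE3 (T, 0)) r
      ((1 : ℝ →L[ℝ] ℝ).smulRight (toE3 (T, 0))) := by
    have : HasDerivAt (fun τ : ℝ => y + (τ - τ₀) • toE3 (T, 0)) (toE3 (T, 0)) r := by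
      simpa using (((hasDerivAt_id r).sub_const τ₀).smul_const (toE3 (T, 0))).const_add y
    exact this.hasFDerivAt.hasMFDerivAt
  have h2 := (hχ.mdiff.mdifferentiableAt_symm hr).hasMFDerivAt.comp r h1
  have h3 := hχ.mfderiv_symm_generator hr T
  refine (show HasMFDerivAt 𝓘(ℝ, ℝ) (𝓡 3)
    (fun τ => χ.symm (y + (τ - τ₀) • toE3 (T, 0))) r _ from h2).congr_mfderiv ?_
  rw [← h3]
  ext
  exact (congrArg (mfderiv (𝓡 3) (𝓡 3) χ.symm (y + (r - τ₀) • toE3 (T, 0)))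
    (one_smul ℝ (toE3 (T, 0)))).trans (one_smul ℝ _).symm

/-- Integral curves are straight lines in a flow box. -/
theorem IsFlowBox.eventually_eq_line (hχ : IsFlowBox u B ψ U χ) {γ : ℝ → M} {T : ℝ × ℝ} {τ₀ : ℝ}
    (hγ : IsMIntegralCurveAt (I := 𝓡 3) γ (generator u B T) τ₀) (h0 : γ τ₀ ∈ χ.source) :
    ∀ᶠ τ in 𝓝 τ₀, γ τ ∈ χ.source ∧ χ (γ τ) = χ (γ τ₀) + (τ - τ₀) • toE3 (T, 0) := by
  have hsrc : ∀ᶠ τ in 𝓝 τ₀, γ τ ∈ χ.source :=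
    hγ.self_of_nhds.continuousAt.preimage_mem_nhds (χ.open_source.mem_nhds h0)
  obtain ⟨ρ, hρ, hball⟩ := Metric.eventually_nhds_iff_ball.1 (hγ.and hsrc)
  have hd : ∀ τ ∈ Metric.ball τ₀ ρ,
      HasDerivAt (fun τ => χ (γ τ) - (τ - τ₀) • toE3 (T, 0)) 0 τ := by
    intro τ hτ
    obtain ⟨h1, h2⟩ := hball τ hτ
    let g' : ℝ →L[ℝ] E3 := (mfderiv (𝓡 3) (𝓡 3) χ (γ τ)).comp
      ((1 : ℝ →L[ℝ] ℝ).smulRight (generator u B T (γ τ)))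
    have h3 : HasFDerivAt (fun τ => χ (γ τ)) g' τ :=
      ((hχ.mdiff.mdifferentiableAt h2).hasMFDerivAt.comp τ h1).hasFDerivAt
    have hg' : g' 1 = toE3 (T, 0) :=
      (congrArg (mfderiv (𝓡 3) (𝓡 3) χ (γ τ)) (one_smul ℝ (generator u B T (γ τ)))).trans
        (hχ.mfderiv_generator h2 T)
    have h4 : HasDerivAt (fun τ => χ (γ τ)) (toE3 (T, 0)) τ := hg' ▸ h3.hasDerivAt
    have h5 := h4.sub (((hasDerivAt_id τ).sub_const τ₀).smul_const (toE3 (T, 0)))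
    rw [one_smul, sub_self] at h5
    exact h5
  filter_upwards [Metric.ball_mem_nhds τ₀ hρ] with τ hτ
  refine ⟨(hball τ hτ).2, ?_⟩
  have h6 := Metric.isOpen_ball.is_const_of_deriv_eq_zero (convex_ball τ₀ ρ).isPreconnected
    (fun τ hτ => (hd τ hτ).differentiableAt.differentiableWithinAt)
    (fun τ hτ => (hd τ hτ).deriv) hτ (Metric.mem_ball_self hρ)
  simpa [sub_eq_iff_eq_add] using h6

/-- Every point of `U` lies in a flow box. -/
def HasFlowBoxes (u B : VField M) (ψ : M → ℝ) (U : Set M) : Prop :=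
  ∀ x ∈ U, ∃ χ : OpenPartialHomeomorph M E3, IsFlowBox u B ψ U χ ∧ x ∈ χ.source

/-- In a flow box both curves are straight lines of the same velocity, so the coincidence set is
open; it is closed because `M` is Hausdorff. Only `c₁` has to stay in `U`, so the competitor may be
an arbitrary integral curve in `M`. -/
theorem HasFlowBoxes.integralCurve_eqOn [T2Space M] (h : HasFlowBoxes u B ψ U) {T : ℝ × ℝ}
    {c₁ c₂ : ℝ → M} {I : Set ℝ} (hI : IsPreconnected I)
    (h₁ : ∀ τ ∈ I, IsMIntegralCurveAt (I := 𝓡 3) c₁ (generator u B T) τ)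
    (h₂ : ∀ τ ∈ I, IsMIntegralCurveAt (I := 𝓡 3) c₂ (generator u B T) τ)
    (hU : ∀ τ ∈ I, c₁ τ ∈ U) {τ₀ : ℝ} (hτ₀ : τ₀ ∈ I) (heq : c₁ τ₀ = c₂ τ₀) : EqOn c₁ c₂ I := by
  have hint : ∀ τ ∈ I, c₁ τ = c₂ τ → τ ∈ interior {τ | c₁ τ = c₂ τ} := by
    intro τ hτ heq
    rw [mem_interior_iff_mem_nhds]
    obtain ⟨χ, hχ, hx⟩ := h _ (hU τ hτ)
    filter_upwards [hχ.eventually_eq_line (h₁ τ hτ) hx, hχ.eventually_eq_line (h₂ τ hτ) (heq ▸ hx)]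
      with r hr₁ hr₂
    refine χ.injOn hr₁.1 hr₂.1 ?_
    rw [hr₁.2, hr₂.2, heq]
  refine fun τ hτ => interior_subset (s := {τ | c₁ τ = c₂ τ}) 
    ((hI.subset_of_closure_inter_subset isOpen_interior
    ⟨τ₀, hτ₀, hint τ₀ hτ₀ heq⟩ ?_) hτ)
  rintro τ ⟨hτc, hτ⟩
  refine hint τ hτ ?_
  by_contra hne
  have hev : ∀ᶠ r in 𝓝 τ, c₁ r ≠ c₂ r :=
    ((h₁ τ hτ).self_of_nhds.continuousAt.prodMk (h₂ τ hτ).self_of_nhds.continuousAt).eventually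
      (isClosed_diagonal.isOpen_compl.mem_nhds hne)
  obtain ⟨r, hr, hr'⟩ := mem_closure_iff_nhds.1 hτc _ hev
  exact hr (interior_subset (s := {τ | c₁ τ = c₂ τ}) hr')

/-- A Lebesgue number argument: each box leaves room for a fixed radius of times around all points
near its base point, and compactness takes the minimum over finitely many boxes. -/
theorem HasFlowBoxes.exists_uniform (h : HasFlowBoxes u B ψ U) {S : Set M} (hS : IsCompact S)
    (hSU : S ⊆ U) : ∃ ε > 0, ∀ x ∈ S, ∃ χ : OpenPartialHomeomorph M E3, IsFlowBox u B ψ U χ ∧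
      x ∈ χ.source ∧ ∀ t : ℝ × ℝ, ‖t‖ < ε → χ x + toE3 (t, 0) ∈ χ.target := by
  refine hS.induction_on (p := fun S => ∃ ε > 0, ∀ x ∈ S, ∃ χ : OpenPartialHomeomorph M E3,
    IsFlowBox u B ψ U χ ∧ x ∈ χ.source ∧ ∀ t : ℝ × ℝ, ‖t‖ < ε → χ x + toE3 (t, 0) ∈ χ.target)
    ⟨1, one_pos, by simp⟩ ?_ ?_ ?_
  · rintro s t hst ⟨ε, hε, ht⟩
    exact ⟨ε, hε, fun x hx => ht x (hst hx)⟩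
  · rintro s t ⟨ε, hε, hs⟩ ⟨ε', hε', ht⟩
    refine ⟨min ε ε', lt_min hε hε', fun x hx => ?_⟩
    rcases hx with hx | hx
    · obtain ⟨χ, h1, h2, h3⟩ := hs x hx
      exact ⟨χ, h1, h2, fun t ht => h3 t (ht.trans_le (min_le_left _ _))⟩
    · obtain ⟨χ, h1, h2, h3⟩ := ht x hx
      exact ⟨χ, h1, h2, fun t ht => h3 t (ht.trans_le (min_le_right _ _))⟩
  · intro x hx
    obtain ⟨χ, hχ, hxχ⟩ := h x (hSU hx)
    have hcont : ContinuousAt (fun p : M × (ℝ × ℝ) => χ p.1 + toE3 (p.2, 0)) (x, 0) := by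
      have h1 : ContinuousAt (fun p : M × (ℝ × ℝ) => χ p.1) (x, 0) :=
        ContinuousAt.comp (f := Prod.fst) (x := ((x, 0) : M × (ℝ × ℝ)))
          (χ.continuousAt hxχ) continuousAt_fst
      have h2 : Continuous (fun p : M × (ℝ × ℝ) => toE3 (p.2, 0)) := by fun_prop
      exact h1.add h2.continuousAt
    have hmem : ∀ᶠ p in 𝓝 ((x, 0) : M × (ℝ × ℝ)), χ p.1 + toE3 (p.2, 0) ∈ χ.target := by
      refine hcont.preimage_mem_nhds (χ.open_target.mem_nhds ?_)
      have : toE3 (0, 0) = 0 := map_zero toE3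
      simpa [this] using χ.map_source hxχ
    rw [nhds_prod_eq] at hmem
    obtain ⟨p, hp, q, hq, hpq⟩ := eventually_prod_iff.1 hmem
    obtain ⟨ε, hε, hball⟩ := Metric.eventually_nhds_iff_ball.1 hq
    refine ⟨{y | p y} ∩ χ.source, mem_nhdsWithin_of_mem_nhds
      (inter_mem hp (χ.open_source.mem_nhds hxχ)), ε, hε, fun y hy => ⟨χ, hχ, hy.2, fun t ht => ?_⟩⟩
    exact hpq hy.1 (hball t (by simpa using ht))

variable {s : ℝ}

theorem IsFlowBox.symm_mem_surf (hχ : IsFlowBox u B ψ U χ) {x : M} (hx : x ∈ surf ψ U s)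
    (hxχ : x ∈ χ.source) {t : ℝ × ℝ} (ht : χ x + toE3 (t, 0) ∈ χ.target) :
    χ.symm (χ x + toE3 (t, 0)) ∈ surf ψ U s := by
  have h1 := χ.map_target ht
  refine ⟨hχ.subset h1, ?_⟩
  have h2 : ψ x = s := hx.2
  rw [mem_preimage, mem_singleton_iff, ← hχ.third _ h1, χ.right_inv ht]
  simp [hχ.third _ hxχ, h2]

theorem toE3_smul (τ : ℝ) (t : ℝ × ℝ) : toE3 (τ • t, 0) = τ • toE3 (t, 0) := by
  rw [← map_smul]; simp

theorem toE3_add (t t' : ℝ × ℝ) : toE3 (t + t', 0) = toE3 (t, 0) + toE3 (t', 0) := by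
  rw [← map_add]; simp

/-- The action of `ℝ²` on a compact level set, generated by `u` and `B`. -/
structure IsFlowAction (u B : VField M) (ψ : M → ℝ) (U : Set M) (s : ℝ)
    (φ : ℝ × ℝ → surf ψ U s → surf ψ U s) : Prop where
  zero : ∀ x, φ 0 x = x
  add : ∀ t t' x, φ (t + t') x = φ t (φ t' x)
  box : ∀ (χ : OpenPartialHomeomorph M E3), IsFlowBox u B ψ U χ → ∀ (x : surf ψ U s),
    (x : M) ∈ χ.source → ∀ t : ℝ × ℝ, (∀ τ ∈ Icc (0 : ℝ) 1, χ x + τ • toE3 (t, 0) ∈ χ.target) →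
    (φ t x : M) = χ.symm (χ x + toE3 (t, 0))
  curve : ∀ (x : surf ψ U s) (T : ℝ × ℝ),
    IsMIntegralCurve (I := 𝓡 3) (fun τ : ℝ => (φ (τ • T) x : M)) (generator u B T)

theorem HasFlowBoxes.exists_action [T2Space M] (h : HasFlowBoxes u B ψ U)
    (hS : IsCompact (surf ψ U s)) :
    ∃ φ : ℝ × ℝ → surf ψ U s → surf ψ U s, IsFlowAction u B ψ U s φ := by
  obtain ⟨ε, hε, hbox⟩ := h.exists_uniform hS inter_subset_left
  have hbox' := fun x : surf ψ U s => hbox x x.2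
  choose κ hκ hκs hκt using hbox'
  -- Translation in the box chosen for the starting point; the identity for large `t` is a dummy
  -- value that the extension lemma ignores.
  let a : ℝ × ℝ → Function.End (surf ψ U s) := fun t x =>
    if ht : ‖t‖ < ε then ⟨(κ x).symm (κ x x + toE3 (t, 0)),
      (hκ x).symm_mem_surf x.2 (hκs x) (hκt x t ht)⟩ else x
  have ha : ∀ (t : ℝ × ℝ) x, ‖t‖ < ε → (a t x : M) = (κ x).symm (κ x x + toE3 (t, 0)) := by
    intro t x ht
    simp only [a, dif_pos ht]
  have hseg : ∀ t : ℝ × ℝ, ‖t‖ < ε → ∀ τ ∈ Icc (0 : ℝ) 1, ‖τ • t‖ < ε := by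
    intro t ht τ hτ
    rw [norm_smul, Real.norm_of_nonneg hτ.1]
    exact (mul_le_of_le_one_left (norm_nonneg t) hτ.2).trans_lt ht
  -- By uniqueness of integral curves the result does not depend on the box. The whole segment has
  -- to lie in the target, which need not be convex.
  have habox : ∀ (χ : OpenPartialHomeomorph M E3), IsFlowBox u B ψ U χ → ∀ (x : surf ψ U s),
      (x : M) ∈ χ.source → ∀ t : ℝ × ℝ, ‖t‖ < ε →
      (∀ τ ∈ Icc (0 : ℝ) 1, χ x + τ • toE3 (t, 0) ∈ χ.target) →
      (a t x : M) = χ.symm (χ x + toE3 (t, 0)) := by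
    intro χ hχ x hx t ht hseg'
    have hκseg : ∀ τ ∈ Icc (0 : ℝ) 1, κ x x + (τ - 0) • toE3 (t, 0) ∈ (κ x).target := by
      intro τ hτ
      rw [sub_zero, ← toE3_smul]
      exact hκt x _ (hseg t ht τ hτ)
    have := h.integralCurve_eqOn (T := t) (I := Icc (0 : ℝ) 1) isPreconnected_Icc
      (c₁ := fun τ => (κ x).symm (κ x x + (τ - 0) • toE3 (t, 0)))
      (c₂ := fun τ => χ.symm (χ x + (τ - 0) • toE3 (t, 0)))
      (fun τ hτ => (hκ x).isMIntegralCurveAt_line (hκseg τ hτ))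
      (fun τ hτ => hχ.isMIntegralCurveAt_line (by simpa using hseg' τ hτ))
      (fun τ hτ => (hκ x).subset ((κ x).map_target (hκseg τ hτ)))
      (left_mem_Icc.2 zero_le_one)
      (by simp [(κ x).left_inv (hκs x), χ.left_inv hx]) (right_mem_Icc.2 zero_le_one)
    rw [ha t x ht]
    simpa using this
  have ha0 : a 0 = 1 := by
    funext x
    apply Subtype.ext
    have h00 : toE3 (0, 0) = 0 := map_zero toE3
    rw [ha 0 x (by simpa using hε), h00, add_zero, (κ x).left_inv (hκs x)]
    rfl
  have hadd : ∀ t t' : ℝ × ℝ, ‖t‖ + ‖t'‖ < ε → a (t + t') = a t * a t' := by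
    intro t t' htt'
    have ht : ‖t‖ < ε := by linarith [norm_nonneg t']
    have ht' : ‖t'‖ < ε := by linarith [norm_nonneg t]
    funext x
    apply Subtype.ext
    change (a (t + t') x : M) = (a t (a t' x) : M)
    have hy := ha t' x ht'
    have hyt : κ x x + toE3 (t', 0) ∈ (κ x).target := hκt x t' ht'
    have hκy : κ x (a t' x) = κ x x + toE3 (t', 0) := by rw [hy, (κ x).right_inv hyt]
    rw [habox (κ x) (hκ x) (a t' x) (by rw [hy]; exact (κ x).map_target hyt) t ht ?_, hκy,
      ha _ x ((norm_add_le t t').trans_lt htt'), toE3_add, add_assoc, add_comm (toE3 (t, 0))]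
    intro τ hτ
    rw [hκy, ← toE3_smul, add_assoc, ← toE3_add]
    refine hκt x _ ((norm_add_le _ _).trans_lt ?_)
    rw [norm_smul, Real.norm_of_nonneg hτ.1]
    have := mul_le_of_le_one_left (norm_nonneg t) hτ.2
    linarith
  obtain ⟨φ, hφadd, hφa⟩ := exists_extension_of_local_hom hε ha0 hadd
  have hφ0 : ∀ x, φ 0 x = x := fun x => by rw [hφa 0 (by simpa using hε), ha0]; rfl
  have hφadd' : ∀ t t' x, φ (t + t') x = φ t (φ t' x) := fun t t' x => by rw [hφadd]; rfl
  have hcurve : ∀ (x : surf ψ U s) (T : ℝ × ℝ),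
      IsMIntegralCurve (I := 𝓡 3) (fun τ : ℝ => (φ (τ • T) x : M)) (generator u B T) := by
    intro x T τ₀
    set y := φ (τ₀ • T) x with hy
    have hyt : κ y y + (τ₀ - τ₀) • toE3 (T, 0) ∈ (κ y).target := by
      simpa using (κ y).map_source (hκs y)
    have h1 := ((hκ y).isMIntegralCurveAt_line hyt).self_of_nhds
    have h2 : (fun τ : ℝ => (φ (τ • T) x : M)) =ᶠ[𝓝 τ₀]
        fun τ => (κ y).symm (κ y y + (τ - τ₀) • toE3 (T, 0)) := by
      have hc : Continuous fun τ : ℝ => ‖(τ - τ₀) • T‖ := by fun_prop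
      filter_upwards [hc.continuousAt.preimage_mem_nhds (isOpen_Iio.mem_nhds
        (show ‖(τ₀ - τ₀) • T‖ ∈ Iio ε by simpa using hε))] with τ hτ
      have : τ • T = (τ - τ₀) • T + τ₀ • T := by rw [← add_smul, sub_add_cancel]
      rw [this, hφadd', hφa _ hτ, ← hy, ha _ y hτ, toE3_smul]
    have h3 := h1.congr_of_eventuallyEq h2
    have h4 : (κ y).symm (κ y y + (τ₀ - τ₀) • toE3 (T, 0)) = y := by
      simp [(κ y).left_inv (hκs y)]
    exact h3.congr_mfderiv (congrArg (fun p : M =>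
      (1 : ℝ →L[ℝ] ℝ).smulRight (generator u B T p : E3)) h4)
  refine ⟨φ, hφ0, hφadd', fun χ hχ x hx t ht => ?_, hcurve⟩
  have := h.integralCurve_eqOn (T := t) (I := Icc (0 : ℝ) 1) isPreconnected_Icc
    (c₁ := fun τ => (φ (τ • t) x : M))
    (c₂ := fun τ => χ.symm (χ x + (τ - 0) • toE3 (t, 0)))
    (fun τ hτ => (hcurve x t).isMIntegralCurveAt τ)
    (fun τ hτ => hχ.isMIntegralCurveAt_line (by simpa using ht τ hτ))
    (fun τ hτ => (φ (τ • t) x).2.1)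
    (left_mem_Icc.2 zero_le_one)
    (by simp [hφ0, χ.left_inv hx]) (right_mem_Icc.2 zero_le_one)
  simpa using this

theorem generator_one_zero : generator u B (1, 0) = u := by
  funext x; simp [generator]

theorem generator_zero_one : generator u B (0, 1) = B := by
  funext x; simp [generator]

namespace IsFlowAction

variable [T2Space M] {φ : ℝ × ℝ → surf ψ U s → surf ψ U s}

/-- The curve given by the action never leaves the surface, so uniqueness applies against any other
integral curve; this ties the abstract action to the definition of the periods. -/
theorem flowsTo_generator_iff (hφ : IsFlowAction u B ψ U s φ) (h : HasFlowBoxes u B ψ U)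
    (T : ℝ × ℝ) (τ : ℝ) (x : surf ψ U s) (y : M) :
    FlowsTo (generator u B T) τ x y ↔ y = φ (τ • T) x := by
  constructor
  · rintro ⟨γ, hγ, h0, rfl⟩
    exact (h.integralCurve_eqOn (T := T) isPreconnected_univ
      (c₁ := fun τ : ℝ => (φ (τ • T) x : M)) (c₂ := γ)
      (fun τ _ => (hφ.curve x T).isMIntegralCurveAt τ) (fun τ _ => hγ.isMIntegralCurveAt τ)
      (fun τ _ => (φ (τ • T) x).2.1) (mem_univ 0) (by simp [hφ.zero, h0]) (mem_univ τ)).symm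
  · rintro rfl
    exact ⟨_, hφ.curve x T, by simp [hφ.zero], rfl⟩

theorem actsTo_iff (hφ : IsFlowAction u B ψ U s φ) (h : HasFlowBoxes u B ψ U) (t : ℝ × ℝ)
    (x : surf ψ U s) (y : M) : ActsTo u B t x y ↔ y = φ t x := by
  have hu := fun z => hφ.flowsTo_generator_iff h (1, 0) t.1 x z
  have hB := fun (w : surf ψ U s) => hφ.flowsTo_generator_iff h (0, 1) t.2 w y
  rw [generator_one_zero] at hu
  rw [generator_zero_one] at hB
  have ht : t = t.2 • ((0, 1) : ℝ × ℝ) + t.1 • (1, 0) := by ext <;> simp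
  rw [ActsTo]
  constructor
  · rintro ⟨z, hz1, hz2⟩
    rw [(hu z).1 hz1] at hz2
    rw [(hB _).1 hz2, ← hφ.add, ← ht]
  · rintro rfl
    refine ⟨φ (t.1 • (1, 0)) x, (hu _).2 rfl, (hB _).2 ?_⟩
    rw [← hφ.add, ← ht]

theorem mem_periods_iff (hφ : IsFlowAction u B ψ U s φ) (h : HasFlowBoxes u B ψ U) (t : ℝ × ℝ) :
    t ∈ periods u B (surf ψ U s) ↔ ∀ x, φ t x = x := by
  refine ⟨fun ht x => ?_, fun ht x hx => ?_⟩
  · exact Subtype.ext ((hφ.actsTo_iff h t x x).1 (ht x x.2)).symm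
  · exact (hφ.actsTo_iff h t ⟨x, hx⟩ x).2 (by rw [ht])

end IsFlowAction

end LocalAction

/-! ### The periods form a lattice. -/

section Lattice

variable {M : Type*} [TopologicalSpace M] [ChartedSpace E3 M] {u B : VField M} {ψ : M → ℝ}
  {U : Set M} {s : ℝ} {φ : ℝ × ℝ → surf ψ U s → surf ψ U s}

namespace IsFlowAction

theorem apply_eq_of_ball (hφ : IsFlowAction u B ψ U s φ) {χ : OpenPartialHomeomorph M E3}
    (hχ : IsFlowBox u B ψ U χ) {x : surf ψ U s} (hx : (x : M) ∈ χ.source) {ε : ℝ}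
    (hε : ∀ t : ℝ × ℝ, ‖t‖ < ε → χ x + toE3 (t, 0) ∈ χ.target) {t : ℝ × ℝ} (ht : ‖t‖ < ε) :
    (φ t x : M) = χ.symm (χ x + toE3 (t, 0)) := by
  refine hφ.box χ hχ x hx t fun τ hτ => ?_
  rw [← toE3_smul]
  refine hε _ ?_
  rw [norm_smul, Real.norm_of_nonneg hτ.1]
  exact (mul_le_of_le_one_left (norm_nonneg t) hτ.2).trans_lt ht

theorem exists_ball (h : HasFlowBoxes u B ψ U) (x : surf ψ U s) :
    ∃ χ : OpenPartialHomeomorph M E3, IsFlowBox u B ψ U χ ∧ (x : M) ∈ χ.source ∧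
      ∃ ε > 0, ∀ t : ℝ × ℝ, ‖t‖ < ε → χ x + toE3 (t, 0) ∈ χ.target := by
  obtain ⟨ε, hε, hball⟩ := h.exists_uniform (S := {(x : M)}) isCompact_singleton
    (singleton_subset_iff.2 x.2.1)
  obtain ⟨χ, hχ, hx, ht⟩ := hball x rfl
  exact ⟨χ, hχ, hx, ε, hε, ht⟩

theorem apply_comm (hφ : IsFlowAction u B ψ U s φ) (t t' : ℝ × ℝ) (x : surf ψ U s) :
    φ t (φ t' x) = φ t' (φ t x) := by
  rw [← hφ.add, ← hφ.add, add_comm]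

/-- Small displacements of the action sweep out a neighbourhood of each point. -/
theorem image_mem_nhds (hφ : IsFlowAction u B ψ U s φ) (h : HasFlowBoxes u B ψ U)
    (x : surf ψ U s) {δ : ℝ} (hδ : 0 < δ) : {y | ∃ t, ‖t‖ < δ ∧ φ t x = y} ∈ 𝓝 x := by
  obtain ⟨χ, hχ, hx, ε, hε, hball⟩ := exists_ball h x
  let d : surf ψ U s → ℝ × ℝ := fun y => (χ y 0 - χ x 0, χ y 1 - χ x 1)
  have hχc : ContinuousAt (fun y : surf ψ U s => χ y) x :=
    (χ.continuousAt hx).comp continuousAt_subtype_val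
  have hci : ∀ i : Fin 3, ContinuousAt (fun y : surf ψ U s => χ y i) x := fun i =>
    (EuclideanSpace.proj (𝕜 := ℝ) i).continuous.continuousAt.comp hχc
  have hd : ContinuousAt d x :=
    ContinuousAt.prodMk ((hci 0).sub continuousAt_const) ((hci 1).sub continuousAt_const)
  have hd0 : d x = 0 := by simp [d]
  have h1 : ∀ᶠ y in 𝓝 x, ‖d y‖ < min ε δ :=
    hd.norm.eventually_lt_const (by simp [hd0, hε, hδ])
  have h2 : ∀ᶠ y : surf ψ U s in 𝓝 x, (y : M) ∈ χ.source :=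
    continuousAt_subtype_val.preimage_mem_nhds (χ.open_source.mem_nhds hx)
  filter_upwards [h1, h2] with y hy hyχ
  refine ⟨d y, hy.trans_le (min_le_right _ _), Subtype.ext ?_⟩
  rw [hφ.apply_eq_of_ball hχ hx hball (hy.trans_le (min_le_left _ _))]
  have : χ x + toE3 (d y, 0) = χ y := by
    have hy2 : ψ (y : M) = s := y.2.2
    have hx2 : ψ (x : M) = s := x.2.2
    ext i
    fin_cases i <;> simp [d, hχ.third _ hx, hχ.third _ hyχ, hy2, hx2]
  rw [this, χ.left_inv hyχ]

theorem continuous_apply (hφ : IsFlowAction u B ψ U s φ) (h : HasFlowBoxes u B ψ U)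
    (x : surf ψ U s) : Continuous fun t => φ t x := by
  rw [continuous_iff_continuousAt]
  intro t
  obtain ⟨χ, hχ, hx, ε, hε, hball⟩ := exists_ball h (φ t x)
  rw [IsInducing.subtypeVal.continuousAt_iff]
  have h1 : Continuous fun t' : ℝ × ℝ => χ (φ t x) + toE3 (t' - t, 0) := by fun_prop
  have h2 : ContinuousAt (fun t' : ℝ × ℝ => χ.symm (χ (φ t x) + toE3 (t' - t, 0))) t := by
    refine ContinuousAt.comp (χ.symm.continuousAt ?_) h1.continuousAt
    exact hball _ (by simpa using hε)
  refine h2.congr ?_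
  filter_upwards [Metric.ball_mem_nhds t hε] with t' ht'
  rw [← hφ.apply_eq_of_ball hχ hx hball (by simpa [dist_eq_norm] using ht'), ← hφ.add,
    sub_add_cancel]
  rfl

theorem isOpen_orbit_ball (hφ : IsFlowAction u B ψ U s φ) (h : HasFlowBoxes u B ψ U)
    (x : surf ψ U s) (r : ℝ) : IsOpen {y | ∃ t, ‖t‖ < r ∧ φ t x = y} := by
  rw [isOpen_iff_mem_nhds]
  rintro _ ⟨t, ht, rfl⟩
  filter_upwards [hφ.image_mem_nhds h (φ t x) (sub_pos.2 ht)] with z hz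
  obtain ⟨t', ht', rfl⟩ := hz
  exact ⟨t' + t, (norm_add_le _ _).trans_lt (by linarith), hφ.add _ _ _⟩

/-- Orbits are open, hence also closed, being complements of unions of other orbits; the surface is
connected. -/
theorem exists_apply_eq (hφ : IsFlowAction u B ψ U s φ) (h : HasFlowBoxes u B ψ U)
    (hS : IsPreconnected (surf ψ U s)) (x y : surf ψ U s) : ∃ t, φ t x = y := by
  have : PreconnectedSpace (surf ψ U s) := isPreconnected_iff_preconnectedSpace.1 hS
  have ho : ∀ z, IsOpen {y | ∃ t, φ t z = y} := by
    intro z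
    rw [isOpen_iff_mem_nhds]
    rintro _ ⟨t, rfl⟩
    filter_upwards [hφ.image_mem_nhds h (φ t z) one_pos] with w hw
    obtain ⟨t', -, rfl⟩ := hw
    exact ⟨t' + t, hφ.add _ _ _⟩
  have hc : IsClosed {y | ∃ t, φ t x = y} := by
    rw [← isOpen_compl_iff, isOpen_iff_mem_nhds]
    intro z hz
    filter_upwards [(ho z).mem_nhds ⟨0, hφ.zero z⟩] with w hw hw'
    obtain ⟨t, rfl⟩ := hw
    obtain ⟨t', ht'⟩ := hw'
    exact hz ⟨-t + t', by rw [hφ.add, ht', ← hφ.add, neg_add_cancel, hφ.zero]⟩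
  have huniv := IsClopen.eq_univ ⟨hc, ho x⟩ ⟨x, 0, hφ.zero x⟩
  exact eq_univ_iff_forall.1 huniv y

/-- The periods of the action. -/
def periodSubgroup (hφ : IsFlowAction u B ψ U s φ) : AddSubgroup (ℝ × ℝ) where
  carrier := {t | ∀ x, φ t x = x}
  zero_mem' := hφ.zero
  add_mem' := fun {t t'} ht ht' x => by rw [hφ.add, ht', ht]
  neg_mem' := fun {t} ht x => by
    conv_lhs => rw [← ht x]
    rw [← hφ.add, neg_add_cancel, hφ.zero]

theorem coe_periodSubgroup [T2Space M] (hφ : IsFlowAction u B ψ U s φ)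
    (h : HasFlowBoxes u B ψ U) :
    (hφ.periodSubgroup : Set (ℝ × ℝ)) = periods u B (surf ψ U s) :=
  Set.ext fun t => (hφ.mem_periods_iff h t).symm

/-- For a transitive action of a commutative group all stabilisers coincide. -/
theorem mem_periodSubgroup_iff_apply_eq (hφ : IsFlowAction u B ψ U s φ)
    (h : HasFlowBoxes u B ψ U) (hS : IsPreconnected (surf ψ U s)) (x : surf ψ U s) {t : ℝ × ℝ} :
    t ∈ hφ.periodSubgroup ↔ φ t x = x := by
  refine ⟨fun ht => ht x, fun ht y => ?_⟩
  obtain ⟨t', rfl⟩ := hφ.exists_apply_eq h hS x y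
  rw [hφ.apply_comm, ht]

theorem apply_eq_apply_iff (hφ : IsFlowAction u B ψ U s φ) (h : HasFlowBoxes u B ψ U)
    (hS : IsPreconnected (surf ψ U s)) (x : surf ψ U s) {t t' : ℝ × ℝ} :
    φ t x = φ t' x ↔ t - t' ∈ hφ.periodSubgroup := by
  rw [hφ.mem_periodSubgroup_iff_apply_eq h hS (φ t' x), ← hφ.add, sub_add_cancel]

/-- A flow box is injective, so a short nonzero translation moves `x`. -/
theorem discreteTopology_periodSubgroup (hφ : IsFlowAction u B ψ U s φ)
    (h : HasFlowBoxes u B ψ U) (x : surf ψ U s) : DiscreteTopology hφ.periodSubgroup := by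
  obtain ⟨χ, hχ, hx, ε, hε, hball⟩ := exists_ball h x
  rw [discreteTopology_iff_isOpen_singleton_zero]
  convert (Metric.isOpen_ball (x := (0 : ℝ × ℝ)) (ε := ε)).preimage
    (continuous_subtype_val (p := fun t => t ∈ hφ.periodSubgroup))
  ext ⟨t, ht⟩
  simp only [mem_singleton_iff, mem_preimage, mem_ball_zero_iff]
  constructor
  · intro h0
    rw [show t = 0 from congrArg Subtype.val h0]
    simpa using hε
  · intro htε
    have h1 := hφ.apply_eq_of_ball hχ hx hball htε
    rw [ht x] at h1
    have h2 := congrArg χ h1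
    rw [χ.right_inv (hball t htε)] at h2
    have h3 : toE3 (t, 0) = 0 := by simpa using h2
    have h4 := (map_eq_zero_iff toE3 toE3.injective).1 h3
    exact Subtype.ext (congrArg Prod.fst h4)

/-- By compactness the orbit map covers the surface already on one ball. Hence `t` acts on `x` like
some `t'` of that ball, and `t - t'` is a period. -/
theorem exists_dist_periodSubgroup_lt (hφ : IsFlowAction u B ψ U s φ) (h : HasFlowBoxes u B ψ U)
    (hS : IsPreconnected (surf ψ U s)) (hSc : IsCompact (surf ψ U s)) (x : surf ψ U s) :
    ∃ R : ℝ, ∀ t, ∃ g ∈ hφ.periodSubgroup, ‖t - g‖ < R := by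
  have : CompactSpace (surf ψ U s) := isCompact_iff_compactSpace.1 hSc
  have hcover : (univ : Set (surf ψ U s)) ⊆ ⋃ R : ℝ, {y | ∃ t, ‖t‖ < R ∧ φ t x = y} := by
    intro y _
    obtain ⟨t, ht⟩ := hφ.exists_apply_eq h hS x y
    exact mem_iUnion.2 ⟨‖t‖ + 1, t, by simp, ht⟩
  obtain ⟨R, hR⟩ := isCompact_univ.elim_directed_cover
    (fun R : ℝ => {y | ∃ t, ‖t‖ < R ∧ φ t x = y}) (fun R => hφ.isOpen_orbit_ball h x R)
    hcover (directed_of_isDirected_le fun a b hab y ⟨t, ht, hty⟩ => ⟨t, ht.trans_le hab, hty⟩)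
  refine ⟨R, fun t => ?_⟩
  obtain ⟨t', ht', heq⟩ := hR (mem_univ (φ t x))
  exact ⟨t - t', (hφ.apply_eq_apply_iff h hS x).1 heq.symm, by simpa using ht'⟩

end IsFlowAction

/-- A set that comes within bounded distance of every point spans. -/
theorem span_eq_top_of_dist_lt {E : Type*} [NormedAddCommGroup E] [NormedSpace ℝ E]
    [FiniteDimensional ℝ E] {Γ : Set E} {R : ℝ} (hR : ∀ t, ∃ g ∈ Γ, ‖t - g‖ < R) :
    Submodule.span ℝ Γ = ⊤ := by
  by_contra hne
  obtain ⟨f, hf0, hf⟩ := Submodule.exists_le_ker_of_lt_top _ (lt_top_iff_ne_top.2 hne)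
  obtain ⟨v, hv⟩ : ∃ v, f v ≠ 0 := by
    by_contra! hv
    exact hf0 (LinearMap.ext hv)
  let F : E →L[ℝ] ℝ := LinearMap.toContinuousLinearMap f
  -- A functional that vanishes on `Γ` would be bounded by `‖F‖ * R` everywhere; a large multiple of
  -- `v` violates this.
  obtain ⟨n, hn⟩ := exists_nat_gt (‖F‖ * R / |f v|)
  obtain ⟨g, hg, hgR⟩ := hR ((n : ℝ) • v)
  have hfg : f g = 0 := hf (Submodule.subset_span hg)
  have h1 : F ((n : ℝ) • v - g) = n * f v := by simp [F, hfg]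
  have h2 := F.le_opNorm ((n : ℝ) • v - g)
  rw [h1, norm_mul, Real.norm_natCast, Real.norm_eq_abs] at h2
  rw [div_lt_iff₀ (abs_pos.2 hv)] at hn
  have h3 := mul_le_mul_of_nonneg_left hgR.le (norm_nonneg F)
  linarith

theorem exists_generates_of_discrete (Γ : AddSubgroup (ℝ × ℝ)) [DiscreteTopology Γ]
    (hspan : Submodule.span ℝ (Γ : Set (ℝ × ℝ)) = ⊤) :
    ∃ T₁ T₂ : ℝ × ℝ, LinearIndependent ℝ ![T₁, T₂] ∧ Generates Γ T₁ T₂ := by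
  let L : Submodule ℤ (ℝ × ℝ) := AddSubgroup.toIntSubmodule Γ
  have hdisc : DiscreteTopology L := ‹DiscreteTopology Γ›
  have hL : IsZLattice ℝ L := ⟨hspan⟩
  have hfree : Module.Free ℤ L := ZLattice.module_free ℝ L
  have hfin : Module.Finite ℤ L := ZLattice.module_finite ℝ L
  have hrank : Module.finrank ℤ L = 2 := by
    rw [ZLattice.rank ℝ L]; simp
  let b := (Module.finBasisOfFinrankEq ℤ L hrank)
  let b' := b.ofZLatticeBasis ℝ L
  have hpair : (![(b 0 : ℝ × ℝ), b 1] : Fin 2 → ℝ × ℝ) = b' := by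
    funext i
    fin_cases i <;> simp [b', Module.Basis.ofZLatticeBasis_apply]
  refine ⟨b 0, b 1, hpair ▸ b'.linearIndependent, ?_⟩
  have h1 := b.ofZLatticeBasis_span ℝ L
  change Submodule.span ℤ (range b') = L at h1
  rw [← hpair] at h1
  have h2 := congrArg (fun N : Submodule ℤ (ℝ × ℝ) => (N.toAddSubgroup : Set (ℝ × ℝ))) h1
  rw [Submodule.span_int_eq_addSubgroupClosure, Matrix.range_cons, Matrix.range_cons,
    Matrix.range_empty, union_empty, singleton_union] at h2
  exact h2.symm

theorem linearIndependent_of_generates {Γ : Set (ℝ × ℝ)} (hspan : Submodule.span ℝ Γ = ⊤)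
    {T₁ T₂ : ℝ × ℝ} (hT : Generates Γ T₁ T₂) : LinearIndependent ℝ ![T₁, T₂] := by
  refine linearIndependent_of_top_le_span_of_card_eq_finrank ?_ (by simp)
  rw [← hspan, Submodule.span_le, hT]
  have : AddSubgroup.closure {T₁, T₂} ≤
      (Submodule.span ℝ (range ![T₁, T₂])).toAddSubgroup := by
    rw [AddSubgroup.closure_le]
    rintro t ht
    exact Submodule.subset_span (by simpa [Matrix.range_cons, or_comm] using ht)
  exact this

end Lattice

/-! ### Lebesgue measure in the coordinates `(t, r)` and the fundamental domain. -/

section Tiles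

theorem measurePreserving_toE3 : MeasurePreserving toE3 volume volume := by
  have h1 : MeasurePreserving (Prod.swap : (ℝ × ℝ) × ℝ → ℝ × ℝ × ℝ) volume volume :=
    Measure.measurePreserving_swap
  have h2 : MeasurePreserving (Prod.map id (MeasurableEquiv.finTwoArrow (α := ℝ)).symm :
      ℝ × ℝ × ℝ → ℝ × (Fin 2 → ℝ)) volume volume :=
    (MeasurePreserving.id volume).prod (volume_preserving_finTwoArrow ℝ).symm
  have h3 := (volume_preserving_piFinSuccAbove (fun _ : Fin 3 => ℝ) 2).symm
  have h4 := ((PiLp.volume_preserving_toLp (Fin 3)).comp h3).comp (h2.comp h1)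
  have h5 : (toE3 : (ℝ × ℝ) × ℝ → E3) =
      (WithLp.toLp 2 ∘ (MeasurableEquiv.piFinSuccAbove (fun _ : Fin 3 => ℝ) 2).symm) ∘
        Prod.map id (MeasurableEquiv.finTwoArrow (α := ℝ)).symm ∘ Prod.swap := by
    funext p
    ext i
    fin_cases i <;> rfl
  rw [h5]
  exact h4

theorem volume_image_add_toE3 (z : E3) (A : Set ((ℝ × ℝ) × ℝ)) :
    volume ((fun p => z + toE3 p) '' A) = volume A := by
  have h1 : (fun p => z + toE3 p) '' A = (fun y => z + y) '' (toE3 '' A) := by rw [image_image]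
  rw [h1, image_add_left, measure_preimage_add,
    ← measurePreserving_toE3.measure_preimage_emb toE3.toHomeomorph.measurableEmbedding,
    preimage_image_eq _ toE3.injective]

theorem volume_image_add_toE3_prod (z : E3) (A : Set (ℝ × ℝ)) (I : Set ℝ) :
    volume ((fun p => z + toE3 p) '' (A ×ˢ I)) = volume A * volume I := by
  rw [volume_image_add_toE3, Measure.volume_eq_prod, Measure.prod_prod]

/-- A bounded measurable set is a finite disjoint union of small measurable pieces. -/
theorem exists_finite_partition {E : Type*} [PseudoMetricSpace E] [ProperSpace E]
    [MeasurableSpace E] [OpensMeasurableSpace E] {F : Set E} (hF : MeasurableSet F)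
    (hb : Bornology.IsBounded F) {ε : ℝ} (hε : 0 < ε) :
    ∃ (n : ℕ) (c : Fin n → E) (A : Fin n → Set E), (∀ i, MeasurableSet (A i)) ∧
      Pairwise (Function.onFun Disjoint A) ∧ ⋃ i, A i = F ∧ ∀ i, A i ⊆ Metric.ball (c i) ε := by
  have hFt : TotallyBounded F := TotallyBounded.subset subset_closure
    (Metric.isCompact_of_isClosed_isBounded isClosed_closure hb.closure).totallyBounded
  obtain ⟨t, -, htf, ht⟩ := hFt.exists_subset (Metric.dist_mem_uniformity hε)
  obtain ⟨n, ⟨e⟩⟩ : ∃ n, Nonempty (t ≃ Fin n) := by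
    have := htf.to_subtype
    exact ⟨_, ⟨Finite.equivFin t⟩⟩
  let c : Fin n → E := fun i => e.symm i
  let f : Fin n → Set E := fun i => Metric.ball (c i) ε
  refine ⟨n, c, fun i => F ∩ disjointed f i, fun i => ?_, fun i j hij => ?_, ?_, fun i => ?_⟩
  · refine hF.inter ?_
    rw [disjointed_apply, Finset.sup_set_eq_biUnion]
    exact Metric.isOpen_ball.measurableSet.diff
      (Finset.measurableSet_biUnion _ fun j _ => Metric.isOpen_ball.measurableSet)
  · exact (disjoint_disjointed f hij).mono inter_subset_right inter_subset_right
  · rw [← inter_iUnion, iUnion_disjointed, inter_eq_left]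
    intro x hx
    obtain ⟨y, hy, hxy⟩ := mem_iUnion₂.1 (ht hx)
    exact mem_iUnion.2 ⟨e ⟨y, hy⟩, by simpa [f, c] using hxy⟩
  · exact inter_subset_right.trans (disjointed_le f i)

/-- The fundamental domain of a period lattice. -/
theorem exists_fundamentalDomain {Γ : Set (ℝ × ℝ)} {T₁ T₂ : ℝ × ℝ} (hT : Generates Γ T₁ T₂)
    (hli : LinearIndependent ℝ ![T₁, T₂]) :
    ∃ F : Set (ℝ × ℝ), MeasurableSet F ∧ Bornology.IsBounded F ∧
      volume F = ENNReal.ofReal |Delta T₁ T₂| ∧ ∀ t, ∃! g, g ∈ Γ ∧ g + t ∈ F := by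
  let b := basisOfLinearIndependentOfCardEqFinrank hli (by simp)
  have hb : (b : Fin 2 → ℝ × ℝ) = ![T₁, T₂] := coe_basisOfLinearIndependentOfCardEqFinrank _ _
  let b₀ := Module.Basis.finTwoProd ℝ
  have hΓ : ∀ g, g ∈ Submodule.span ℤ (range b) ↔ g ∈ Γ := by
    intro g
    rw [hT, hb, ← Submodule.mem_toAddSubgroup, Submodule.span_int_eq_addSubgroupClosure,
      Matrix.range_cons, Matrix.range_cons, Matrix.range_empty, union_empty, singleton_union]
    rfl
  refine ⟨ZSpan.fundamentalDomain b, ZSpan.fundamentalDomain_measurableSet b,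
    ZSpan.fundamentalDomain_isBounded b, ?_, fun t => ?_⟩
  · have h0 : ZSpan.fundamentalDomain b₀ = Ico (0 : ℝ) 1 ×ˢ Ico (0 : ℝ) 1 := by
      ext m
      simp [ZSpan.mem_fundamentalDomain, Fin.forall_fin_two, b₀]
    have hdet : b₀.det b = Delta T₁ T₂ := by
      rw [hb, Module.Basis.det_apply, Delta, Matrix.det_fin_two, Matrix.det_fin_two]
      simp [b₀, Module.Basis.toMatrix_apply]
    rw [ZSpan.measure_fundamentalDomain b volume b₀, hdet, h0, Measure.volume_eq_prod,
      Measure.prod_prod]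
    simp
  · obtain ⟨g, hg, huniq⟩ := ZSpan.exist_unique_vadd_mem_fundamentalDomain b t
    refine ⟨g, ⟨(hΓ _).1 g.2, hg⟩, fun g' hg' => ?_⟩
    exact congrArg Subtype.val (huniq ⟨g', (hΓ _).2 hg'.1⟩ hg'.2)

end Tiles

/-! ### Volume of a thin layer inside one flow box. -/

section TileVolume

variable {M : Type*} [TopologicalSpace M] [ChartedSpace E3 M] {Ω : DForm M 3} {u B : VField M}
  {ψ : M → ℝ} {U : Set M} {χ : OpenPartialHomeomorph M E3} {s : ℝ}

variable [SecondCountableTopology M] [Nonempty M] [MeasurableSpace M] [BorelSpace M]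
  [IsManifold (𝓡 3) ∞ M]

/-- The layer over a compact set of a flux surface has at least the expected volume. -/
theorem IsFlowBox.eventually_le_volumeMeasure (hχ : IsFlowBox u B ψ U χ)
    (hsym : IsFluxFormSymmetryOn Ω B u ψ U) {z : E3} (hz : z 2 = 0) {K : Set (ℝ × ℝ)}
    (hK : IsCompact K) {G : Set M} (hG : IsOpen G)
    (hKG : ∀ t ∈ K, z + toE3 (t, s) ∈ χ.target ∧ χ.symm (z + toE3 (t, s)) ∈ G) :
    ∀ᶠ p : ℝ × ℝ in 𝓝 (s, s), volume K * ENNReal.ofReal (p.2 - p.1) ≤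
      volumeMeasure Ω (G ∩ band ψ U (Ioo p.1 p.2)) := by
  have hc : Continuous fun p : (ℝ × ℝ) × ℝ => z + toE3 p := by fun_prop
  have hO : IsOpen (χ.target ∩ χ.symm ⁻¹' G) := χ.isOpen_inter_preimage_symm hG
  -- The tube lemma around `K × {s}` yields one thickness valid over all of `K`.
  obtain ⟨V, I, -, hI, hKV, hsI, hVI⟩ := generalized_tube_lemma hK (isCompact_singleton (x := s))
    (hO.preimage hc) (by rintro ⟨t, r⟩ ⟨ht, rfl⟩; exact hKG t ht)
  obtain ⟨η, hη, hball⟩ := Metric.isOpen_iff.1 hI s (hsI rfl)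
  rw [Real.ball_eq_Ioo] at hball
  have hev : ∀ᶠ p : ℝ × ℝ in 𝓝 (s, s), p.1 ∈ Ioo (s - η) (s + η) ∧ p.2 ∈ Ioo (s - η) (s + η) :=
    prod_mem_nhds (Ioo_mem_nhds (by linarith) (by linarith))
      (Ioo_mem_nhds (by linarith) (by linarith))
  filter_upwards [hev] with p hp
  set Q : Set E3 := (fun q => z + toE3 q) '' (K ×ˢ Ioo p.1 p.2) with hQ
  have hQO : Q ⊆ χ.target ∩ χ.symm ⁻¹' G := by
    rintro _ ⟨⟨t, r⟩, ⟨ht, hr⟩, rfl⟩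
    exact hVI ⟨hKV ht, hball ⟨hp.1.1.trans hr.1, hr.2.trans hp.2.2⟩⟩
  have hQm : MeasurableSet Q :=
    ((toE3.toHomeomorph.trans (Homeomorph.addLeft z)).measurableEmbedding.measurableSet_image'
      (hK.measurableSet.prod measurableSet_Ioo) : _)
  have hQt : Q ⊆ χ.symm.source := hQO.trans inter_subset_left
  have hAs : χ.symm '' Q ⊆ χ.source := by
    rintro _ ⟨y, hy, rfl⟩
    exact χ.map_target (hQt hy)
  have hχQ : χ '' (χ.symm '' Q) = Q := by
    rw [image_image]
    refine (image_congr fun y hy => χ.right_inv (hQt hy)).trans (image_id' Q)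
  have hvol := hχ.volumeMeasure_apply hsym
    (measurableSet_image_of_subset_source χ.symm hQm hQt) hAs
  rw [hχQ, hQ, volume_image_add_toE3_prod, Real.volume_Ioo] at hvol
  rw [← hvol]
  refine measure_mono ?_
  rintro _ ⟨y, hy, rfl⟩
  refine ⟨(hQO hy).2, hχ.subset (hAs ⟨y, hy, rfl⟩), ?_⟩
  rw [mem_preimage, ← hχ.third _ (hAs ⟨y, hy, rfl⟩), χ.right_inv (hQt hy)]
  obtain ⟨⟨t, r⟩, ⟨-, hr⟩, rfl⟩ := hy
  simpa [hz] using hr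

/-- The layer over a set of a flux surface has at most the expected volume. -/
theorem IsFlowBox.volumeMeasure_le (hχ : IsFlowBox u B ψ U χ)
    (hsym : IsFluxFormSymmetryOn Ω B u ψ U) {z : E3} (hz : z 2 = 0) {O : Set (ℝ × ℝ)}
    (hO : IsOpen O) (s₁ s₂ : ℝ) :
    volumeMeasure Ω (χ.source ∩ χ ⁻¹' {y | (toE3.symm (y - z)).1 ∈ O} ∩ band ψ U (Icc s₁ s₂)) ≤
      volume O * ENNReal.ofReal (s₂ - s₁) := by
  set Q : Set E3 := (fun q => z + toE3 q) '' (O ×ˢ Icc s₁ s₂) with hQ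
  have hQm : MeasurableSet Q :=
    ((toE3.toHomeomorph.trans (Homeomorph.addLeft z)).measurableEmbedding.measurableSet_image'
      (hO.measurableSet.prod measurableSet_Icc) : _)
  have hAm : MeasurableSet (χ.source ∩ χ ⁻¹' Q) :=
    measurableSet_inter_preimage_of_isOpen χ.continuousOn χ.open_source hQm
  calc _ ≤ volumeMeasure Ω (χ.source ∩ χ ⁻¹' Q) := by
        refine measure_mono ?_
        rintro x ⟨⟨hx, hxO⟩, hxb⟩
        refine ⟨hx, toE3.symm (χ x - z), ⟨hxO, ?_⟩, by simp [-toE3_symm_apply]⟩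
        have : (toE3.symm (χ x - z)).2 = ψ x := by simp [hχ.third x hx, hz]
        rw [this]
        exact hxb.2
    _ = volume (χ '' (χ.source ∩ χ ⁻¹' Q)) := hχ.volumeMeasure_apply hsym hAm inter_subset_left
    _ ≤ volume Q := by
        refine measure_mono ?_
        rintro _ ⟨x, hx, rfl⟩
        exact hx.2
    _ = _ := by rw [hQ, volume_image_add_toE3_prod, Real.volume_Icc]

end TileVolume

/-! ### Volume of a thin layer around a whole flux surface. -/

section BandVolume

variable {M : Type*} [TopologicalSpace M] [ChartedSpace E3 M] {Ω : DForm M 3} {u B : VField M}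
  {ψ : M → ℝ} {U : Set M} {s : ℝ} {φ : ℝ × ℝ → surf ψ U s → surf ψ U s}

/-- A finite family of flow boxes centred at the points `φ_{c i} x`, in which the action is the
translation. -/
theorem IsFlowAction.exists_tiles (hφ : IsFlowAction u B ψ U s φ) (h : HasFlowBoxes u B ψ U)
    (hS : IsCompact (surf ψ U s)) (x : surf ψ U s) :
    ∃ ε > 0, ∀ c : ℝ × ℝ, ∃ (χ : OpenPartialHomeomorph M E3) (z : E3), IsFlowBox u B ψ U χ ∧
      z 2 = 0 ∧ ∀ t ∈ Metric.ball c ε, z + toE3 (t, s) ∈ χ.target ∧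
        (φ t x : M) = χ.symm (z + toE3 (t, s)) := by
  obtain ⟨ε, hε, hbox⟩ := h.exists_uniform hS inter_subset_left
  refine ⟨ε, hε, fun c => ?_⟩
  obtain ⟨χ, hχ, hx, ht⟩ := hbox (φ c x) (φ c x).2
  have hz : ∀ t, χ (φ c x) - toE3 (c, s) + toE3 (t, s) = χ (φ c x) + toE3 (t - c, 0) := by
    intro t
    rw [sub_add_eq_add_sub, add_sub_assoc, ← map_sub]
    simp
  -- With this offset the action time `t` and the value of `ψ` are themselves the coordinates of the
  -- tile.
  refine ⟨χ, χ (φ c x) - toE3 (c, s), hχ, ?_, fun t htc => ?_⟩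
  · have h2 : ψ (φ c x : M) = s := (φ c x).2.2
    simp [hχ.third _ hx, h2]
  · have htc' : ‖t - c‖ < ε := by rwa [← dist_eq_norm]
    rw [hz]
    refine ⟨ht _ htc', ?_⟩
    rw [← hφ.apply_eq_of_ball hχ hx ht htc', ← hφ.add, sub_add_cancel]

variable [IsManifold (𝓡 3) ∞ M] [SecondCountableTopology M] [T2Space M] [Nonempty M]
  [MeasurableSpace M] [BorelSpace M]

/-- Thin layers around a flux surface have volume `|Δ|` times their thickness, asymptotically. -/
theorem IsFlowAction.eventually_volumeMeasure_band (hφ : IsFlowAction u B ψ U s φ)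
    (h : HasFlowBoxes u B ψ U) (hf : IsProperFoliation ψ U)
    (hsym : IsFluxFormSymmetryOn Ω B u ψ U) (hs : s ∈ ψ '' U) {T₁ T₂ : ℝ × ℝ}
    (hT : Generates (periods u B (surf ψ U s)) T₁ T₂) (hli : LinearIndependent ℝ ![T₁, T₂])
    {δ : ℝ≥0∞} (hδ : δ ≠ 0) :
    ∀ᶠ p : ℝ × ℝ in 𝓝 (s, s),
      ENNReal.ofReal |Delta T₁ T₂| * ENNReal.ofReal (p.2 - p.1) ≤
        volumeMeasure Ω (band ψ U (Ioo p.1 p.2)) + δ * ENNReal.ofReal (p.2 - p.1) ∧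
      volumeMeasure Ω (band ψ U (Icc p.1 p.2)) ≤
        (ENNReal.ofReal |Delta T₁ T₂| + δ) * ENNReal.ofReal (p.2 - p.1) := by
  have : LocallyCompactSpace M := ChartedSpace.locallyCompactSpace E3 M
  have hS := hf.compact s hs
  have hpre := (hf.connected s hs).isPreconnected
  obtain ⟨x₀, hx₀⟩ := (hf.connected s hs).nonempty
  let x : surf ψ U s := ⟨x₀, hx₀⟩
  obtain ⟨F, hFm, hFb, hFv, hF⟩ := exists_fundamentalDomain hT hli
  obtain ⟨ε, hε, htile⟩ := hφ.exists_tiles h hS x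
  obtain ⟨n, c, A, hAm, hAd, hAF, hAc⟩ := exists_finite_partition hFm hFb hε
  choose! χ z hχ hz hball using htile
  obtain ⟨δ', hδ'0, hδ'⟩ := ENNReal.exists_pos_sum_of_countable' hδ (Fin n)
  rw [tsum_fintype] at hδ'
  have hAtop : ∀ i, volume (A i) ≠ ⊤ := fun i =>
    ((Metric.isBounded_ball.subset (hAc i)).measure_lt_top).ne
  have hsum : ∑ i, volume (A i) = ENNReal.ofReal |Delta T₁ T₂| := by
    rw [← hFv, ← hAF, measure_iUnion hAd hAm, tsum_fintype]
  have hper : ∀ {t t'}, φ t x = φ t' x → t ∈ F → t' ∈ F → t = t' := by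
    intro t t' heq ht ht'
    have h1 := (hφ.apply_eq_apply_iff h hpre x).1 heq
    have h2 : t - t' ∈ periods u B (surf ψ U s) := hφ.coe_periodSubgroup h ▸ h1
    have h3 : (0 : ℝ × ℝ) ∈ periods u B (surf ψ U s) :=
      hφ.coe_periodSubgroup h ▸ hφ.periodSubgroup.zero_mem
    have h4 := (hF t').unique ⟨h2, by rwa [sub_add_cancel]⟩ ⟨h3, by rwa [zero_add]⟩
    exact sub_eq_zero.1 h4
  have hcov : ∀ y : surf ψ U s, ∃ t ∈ F, φ t x = y := by
    intro y
    obtain ⟨t, rfl⟩ := hφ.exists_apply_eq h hpre x y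
    obtain ⟨g, ⟨hg, hgt⟩, -⟩ := hF t
    rw [← hφ.coe_periodSubgroup h] at hg
    exact ⟨g + t, hgt, by rw [hφ.add]; exact hg _⟩
  have hlow : ∀ᶠ p : ℝ × ℝ in 𝓝 (s, s),
      ENNReal.ofReal |Delta T₁ T₂| * ENNReal.ofReal (p.2 - p.1) ≤
        volumeMeasure Ω (band ψ U (Ioo p.1 p.2)) + δ * ENNReal.ofReal (p.2 - p.1) := by
    -- Inner approximation by compact sets: their images in the surface are compact and disjoint, so
    -- they have disjoint neighbourhoods and the layers over them do not overlap.
    have hK := fun i => (hAm i).exists_isCompact_lt_add (hAtop i) (hδ'0 i).ne'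
    choose K hKA hKc hKv using hK
    have hKF : ∀ i, K i ⊆ F := fun i => (hKA i).trans (hAF ▸ subset_iUnion A i)
    have hcont : Continuous fun t => (φ t x : M) :=
      continuous_subtype_val.comp (hφ.continuous_apply h x)
    have hdisj : Pairwise (Function.onFun Disjoint fun i =>
        𝓝ˢ ((fun t => (φ t x : M)) '' K i)) := by
      intro i j hij
      refine SeparatedNhds.disjoint_nhdsSet (SeparatedNhds.of_isCompact_isCompact
        ((hKc i).image hcont) ((hKc j).image hcont) ?_)
      rw [disjoint_left]
      rintro _ ⟨t, ht, rfl⟩ ⟨t', ht', heq⟩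
      have := hper (Subtype.ext heq) (hKF j ht') (hKF i ht)
      exact (hAd hij).le_bot ⟨hKA i ht, this ▸ hKA j ht'⟩
    obtain ⟨V, hV, hVd⟩ := hdisj.exists_mem_filter_of_disjoint
    have hev := eventually_all.2 fun i => (hχ (c i)).eventually_le_volumeMeasure (s := s) hsym
      (hz (c i)) (hKc i) (isOpen_interior (s := V i)) fun t ht => by
        obtain ⟨h1, h2⟩ := hball (c i) t (hAc i (hKA i ht))
        exact ⟨h1, h2 ▸ (subset_interior_iff_mem_nhdsSet.2 (hV i) ⟨t, ht, rfl⟩)⟩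
    filter_upwards [hev] with p hp
    have hopen : IsOpen (band ψ U (Ioo p.1 p.2)) := hf.isOpen_band isOpen_Ioo
    calc ENNReal.ofReal |Delta T₁ T₂| * ENNReal.ofReal (p.2 - p.1)
        = (∑ i, volume (A i)) * ENNReal.ofReal (p.2 - p.1) := by rw [hsum]
      _ ≤ (∑ i, (volume (K i) + δ' i)) * ENNReal.ofReal (p.2 - p.1) := by
          gcongr with i; exact (hKv i).le
      _ = ∑ i, volume (K i) * ENNReal.ofReal (p.2 - p.1) +
            (∑ i, δ' i) * ENNReal.ofReal (p.2 - p.1) := by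
          rw [Finset.sum_add_distrib, add_mul, Finset.sum_mul]
      _ ≤ ∑ i, volumeMeasure Ω (interior (V i) ∩ band ψ U (Ioo p.1 p.2)) +
            δ * ENNReal.ofReal (p.2 - p.1) := by
          gcongr with i; exact hp i
      _ = volumeMeasure Ω (⋃ i, interior (V i) ∩ band ψ U (Ioo p.1 p.2)) +
            δ * ENNReal.ofReal (p.2 - p.1) := by
          rw [measure_iUnion, tsum_fintype]
          · exact fun i j hij => (hVd hij).mono (inter_subset_left.trans interior_subset)
              (inter_subset_left.trans interior_subset)
          · exact fun i => (isOpen_interior.inter hopen).measurableSet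
      _ ≤ _ := by
          gcongr
          exact iUnion_subset fun i => inter_subset_right
  have hup : ∀ᶠ p : ℝ × ℝ in 𝓝 (s, s), volumeMeasure Ω (band ψ U (Icc p.1 p.2)) ≤
        (ENNReal.ofReal |Delta T₁ T₂| + δ) * ENNReal.ofReal (p.2 - p.1) := by
    -- Outer approximation by open sets: the sets over them cover the surface, hence also all
    -- surfaces close to it.
    have hO := fun i => (A i).exists_isOpen_lt_add (hAtop i) (hδ'0 i).ne'
    choose O hAO hOo hOv using hO
    let W : Fin n → Set M := fun i =>
      (χ (c i)).source ∩ χ (c i) ⁻¹' {y | (toE3.symm (y - z (c i))).1 ∈ O i}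
    have hW : ∀ i, IsOpen (W i) := by
      intro i
      refine (χ (c i)).isOpen_inter_preimage ((hOo i).preimage ?_)
      fun_prop
    have hSW : surf ψ U s ⊆ ⋃ i, W i := by
      intro y hy
      obtain ⟨t, ht, hty⟩ := hcov ⟨y, hy⟩
      rw [← hAF] at ht
      obtain ⟨i, hi⟩ := mem_iUnion.1 ht
      obtain ⟨h1, h2⟩ := hball (c i) t (hAc i hi)
      have hy' : y = (χ (c i)).symm (z (c i) + toE3 (t, s)) := by rw [← h2, hty]
      refine mem_iUnion.2 ⟨i, hy' ▸ (χ (c i)).map_target h1, ?_⟩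
      rw [mem_preimage, mem_ofPred_eq, hy', (χ (c i)).right_inv h1, add_sub_cancel_left,
        ContinuousLinearEquiv.symm_apply_apply]
      exact hAO i hi
    obtain ⟨η, hη, hsub⟩ := Metric.eventually_nhds_iff_ball.1
      (hf.eventually_surf_subset hs (isOpen_iUnion hW) hSW)
    rw [Real.ball_eq_Ioo] at hsub
    have hev : ∀ᶠ p : ℝ × ℝ in 𝓝 (s, s), p.1 ∈ Ioo (s - η) (s + η) ∧ p.2 ∈ Ioo (s - η) (s + η) :=
      prod_mem_nhds (Ioo_mem_nhds (by linarith) (by linarith))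
        (Ioo_mem_nhds (by linarith) (by linarith))
    filter_upwards [hev] with p hp
    calc volumeMeasure Ω (band ψ U (Icc p.1 p.2))
        ≤ volumeMeasure Ω (⋃ i, W i ∩ band ψ U (Icc p.1 p.2)) := by
          refine measure_mono fun y hy => ?_
          rw [← iUnion_inter]
          exact ⟨hsub (ψ y) ⟨hp.1.1.trans_le hy.2.1, hy.2.2.trans_lt hp.2.2⟩ ⟨hy.1, rfl⟩, hy⟩
      _ ≤ ∑ i, volumeMeasure Ω (W i ∩ band ψ U (Icc p.1 p.2)) := measure_iUnion_fintype_le _ _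
      _ ≤ ∑ i, volume (O i) * ENNReal.ofReal (p.2 - p.1) := by
          gcongr with i
          exact (hχ (c i)).volumeMeasure_le hsym (hz (c i)) (hOo i) p.1 p.2
      _ ≤ (∑ i, (volume (A i) + δ' i)) * ENNReal.ofReal (p.2 - p.1) := by
          rw [Finset.sum_mul]
          gcongr with i
          exact (hOv i).le
      _ ≤ _ := by
          rw [Finset.sum_add_distrib, hsum]
          gcongr
  exact hlow.and hup

end BandVolume

/-! ### From estimates on increments to derivatives. -/

section Derivative

theorem hasDerivAt_of_eventually_abs_sub_le {G : ℝ → ℝ} {A s : ℝ}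
    (h : ∀ δ > 0, ∀ᶠ p : ℝ × ℝ in 𝓝 (s, s), p.1 < p.2 →
      |G p.2 - G p.1 - A * (p.2 - p.1)| ≤ δ * (p.2 - p.1)) : HasDerivAt G A s := by
  rw [hasDerivAt_iff_isLittleO, Asymptotics.isLittleO_iff]
  intro δ hδ
  have h1 : Tendsto (fun r : ℝ => (r, s)) (𝓝 s) (𝓝 (s, s)) :=
    (Continuous.prodMk continuous_id continuous_const).tendsto s
  have h2 : Tendsto (fun r : ℝ => (s, r)) (𝓝 s) (𝓝 (s, s)) :=
    (Continuous.prodMk continuous_const continuous_id).tendsto s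
  filter_upwards [h1.eventually (h δ hδ), h2.eventually (h δ hδ)] with r hr₁ hr₂
  rw [smul_eq_mul, Real.norm_eq_abs, Real.norm_eq_abs]
  rcases lt_trichotomy r s with hlt | rfl | hgt
  · have := hr₁ hlt
    rw [abs_of_neg (sub_neg.2 hlt), ← abs_neg]
    calc _ = |G s - G r - A * (s - r)| := by congr 1; ring
      _ ≤ _ := by simpa using this
  · simp
  · have := hr₂ hgt
    rw [abs_of_pos (sub_pos.2 hgt), mul_comm (r - s)]
    exact this

theorem nonneg_of_hasDerivAt {k : ℝ → ℝ} {k' : ℝ} (hk : HasDerivAt k k' 0)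
    (h0 : k 0 = 0) (h : ∀ᶠ t in 𝓝[>] 0, 0 ≤ k t) : 0 ≤ k' := by
  refine ge_of_tendsto hk.tendsto_slope_zero_right ?_
  filter_upwards [h, self_mem_nhdsWithin] with t ht ht0
  rw [h0, zero_add, sub_zero, smul_eq_mul]
  exact mul_nonneg (inv_nonneg.2 (le_of_lt ht0)) ht

theorem abs_toReal_sub_le {m : ℝ≥0∞} {A d δ : ℝ} (hA : 0 ≤ A) (hδ : 0 ≤ δ)
    (hlow : ENNReal.ofReal A * ENNReal.ofReal d ≤ m + ENNReal.ofReal δ * ENNReal.ofReal d)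
    (hup : m ≤ (ENNReal.ofReal A + ENNReal.ofReal δ) * ENNReal.ofReal d) (hd : 0 ≤ d) :
    |m.toReal - A * d| ≤ δ * d := by
  have hm : m ≠ ⊤ := (hup.trans_lt (ENNReal.mul_lt_top
    (ENNReal.add_lt_top.2 ⟨ENNReal.ofReal_lt_top, ENNReal.ofReal_lt_top⟩)
    ENNReal.ofReal_lt_top)).ne
  rw [← ENNReal.ofReal_toReal hm] at hlow hup
  rw [← ENNReal.ofReal_mul hA, ← ENNReal.ofReal_mul hδ,
    ← ENNReal.ofReal_add ENNReal.toReal_nonneg (mul_nonneg hδ hd),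
    ENNReal.ofReal_le_ofReal_iff (by positivity)] at hlow
  rw [← ENNReal.ofReal_add hA hδ, ← ENNReal.ofReal_mul (add_nonneg hA hδ),
    ENNReal.ofReal_le_ofReal_iff (by positivity)] at hup
  rw [abs_le]
  constructor <;> linarith

end Derivative

/-! ### The sign of `Δ` and the side of the region. -/

section Orientation

theorem alternating_pair_apply (f : E3 [⋀^Fin 3]→L[ℝ] ℝ) (X Y w : E3) (S T : ℝ × ℝ) :
    f ![T.1 • X + T.2 • Y, S.1 • X + S.2 • Y, w] = Delta S T * f ![Y, X, w] := by
  have h1 : ∀ (a b : ℝ) (p q y : E3),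
      f ![a • p + b • q, y, w] = a * f ![p, y, w] + b * f ![q, y, w] := by
    intro a b p q y
    have h := congrArg (fun g : E3 [⋀^Fin 2]→L[ℝ] ℝ => g ![y, w])
      ((f.curryLeft.map_add (a • p) (b • q)).trans
        (congrArg₂ (· + ·) (f.curryLeft.map_smul a p) (f.curryLeft.map_smul b q)))
    exact h
  have h2 : ∀ p q : E3, f ![p, q, w] = -f ![q, p, w] := by
    intro p q
    have := f.toAlternatingMap.map_swap ![q, p, w] (i := 0) (j := 1) (by decide)
    have he : ![q, p, w] ∘ Equiv.swap (0 : Fin 3) 1 = ![p, q, w] := by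
      funext i; fin_cases i <;> simp [Equiv.swap_apply_def]
    rw [he] at this
    exact this
  have h3 : ∀ p : E3, f ![p, p, w] = 0 := fun p => by linarith [h2 p p]
  rw [h1, h2 X, h2 Y, h1, h1, h3, h3, h2 X Y, Delta, Matrix.det_fin_two_of]
  ring

theorem Delta_swap (T₁ T₂ : ℝ × ℝ) : Delta T₂ T₁ = -Delta T₁ T₂ := by
  rw [Delta, Delta, Matrix.det_fin_two_of, Matrix.det_fin_two_of]
  ring

theorem Delta_ne_zero {T₁ T₂ : ℝ × ℝ} (h : LinearIndependent ℝ ![T₁, T₂]) : Delta T₁ T₂ ≠ 0 := by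
  intro h0
  rw [Delta, Matrix.det_fin_two_of] at h0
  rw [LinearIndependent.pair_iff] at h
  have h1 := h T₂.1 (-T₁.1) (by ext <;> simp <;> linarith)
  have h2 := h T₂.2 (-T₁.2) (by ext <;> simp <;> linarith)
  have hT : T₁ = 0 := Prod.ext (neg_eq_zero.1 h1.2) (neg_eq_zero.1 h2.2)
  simpa [hT] using h 1 0

/-- The level sets of `ψ` close to `s` with `σ (ψ - s) < 0` lie in `D`, the others outside. -/
structure IsSide {X : Type*} [TopologicalSpace X] (ψ : X → ℝ) (U D : Set X) (s σ : ℝ) : Prop where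
  abs_eq : |σ| = 1
  inside : ∀ᶠ r in 𝓝 s, σ * (r - s) < 0 → surf ψ U r ⊆ D
  outside : ∀ᶠ r in 𝓝 s, 0 < σ * (r - s) → Disjoint (surf ψ U r) (closure D)

variable {M : Type*} [TopologicalSpace M] [ChartedSpace E3 M]
  {Ω : DForm M 3} {u B : VField M} {ψ : M → ℝ} {U : Set M} {s : ℝ}

/-- Together with `i_u i_B Ω = dψ`, this reads `i_{∂θ₁} i_{∂θ₂} Ω = Δ dψ`, so that compatibility of
the order concerns only the sign of `Δ` and the side. -/
theorem interiorProd_generator (x : M) (T₁ T₂ : ℝ × ℝ) (w : TangentSpace (𝓡 3) x) :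
    interiorProd (generator u B T₁) (interiorProd (generator u B T₂) Ω) x ![w] =
      Delta T₁ T₂ * interiorProd u (interiorProd B Ω) x ![w] :=
  alternating_pair_apply (Ω x) (u x) (B x) w T₁ T₂

variable [IsManifold (𝓡 3) ∞ M] {D : Set M} {σ : ℝ}

/-- The curve is the straight line in the third direction of a flow box, run with velocity `σ`. -/
theorem IsSide.exists_leavesThrough (hσ : IsSide ψ U D s σ) (h : HasFlowBoxes u B ψ U)
    (hsym : IsFluxFormSymmetryOn Ω B u ψ U) {x : M} (hx : x ∈ surf ψ U s) :
    ∃ c : ℝ → M, LeavesThrough c (surf ψ U s) D ∧ c 0 ∈ U ∧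
      interiorProd u (interiorProd B Ω) (c 0)
        ![(mfderiv 𝓘(ℝ, ℝ) (𝓡 3) c 0 (1 : ℝ) : TangentSpace (𝓡 3) (c 0))] = σ := by
  obtain ⟨χ, hχ, hxχ⟩ := h x hx.1
  have hψx : ψ x = s := hx.2
  have hσ2 : σ * σ = 1 := by rw [← abs_mul_abs_self, hσ.abs_eq, one_mul]
  let v : E3 := σ • toE3 ((0, 0), 1)
  let l : ℝ → E3 := fun t => χ x + t • v
  have hl : Continuous l := by fun_prop
  have hl0 : l 0 = χ x := by simp [l]
  have htar : ∀ᶠ t in 𝓝 (0 : ℝ), l t ∈ χ.target :=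
    hl.continuousAt.preimage_mem_nhds (χ.open_target.mem_nhds (hl0 ▸ χ.map_source hxχ))
  have hl2 : ∀ t, l t 2 = s + t * σ := fun t => by simp [l, v, hχ.third x hxχ, hψx]
  have hψ : ∀ t, l t ∈ χ.target → χ.symm (l t) ∈ surf ψ U (s + t * σ) := fun t ht => by
    refine ⟨hχ.subset (χ.map_target ht), ?_⟩
    rw [mem_preimage, ← hχ.third _ (χ.map_target ht), χ.right_inv ht, hl2]
    rfl
  have hc0 : χ.symm (l 0) = x := by rw [hl0, χ.left_inv hxχ]
  have hder : HasMFDerivAt 𝓘(ℝ, ℝ) (𝓡 3) (fun t => χ.symm (l t)) 0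
      ((mfderiv (𝓡 3) (𝓡 3) χ.symm (l 0)).comp ((1 : ℝ →L[ℝ] ℝ).smulRight v)) := by
    have h1 : HasDerivAt l v 0 := by
      have h2 := ((hasDerivAt_id (0 : ℝ)).smul_const v).const_add (χ x)
      rw [one_smul] at h2
      exact h2
    exact (hχ.mdiff.mdifferentiableAt_symm htar.self_of_nhds).hasMFDerivAt.comp 0
      h1.hasFDerivAt.hasMFDerivAt
  have hsc : Tendsto (fun t : ℝ => s + t * σ) (𝓝 0) (𝓝 s) := by
    have : Continuous fun t : ℝ => s + t * σ := by fun_prop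
    simpa using this.tendsto 0
  refine ⟨fun t => χ.symm (l t), ⟨?_, hder.mdifferentiableAt, ?_, ?_⟩, ?_, ?_⟩
  · change χ.symm (l 0) ∈ _
    rwa [hc0]
  · filter_upwards [nhdsWithin_le_nhds htar, nhdsWithin_le_nhds (hsc.eventually hσ.inside),
      self_mem_nhdsWithin] with t ht hin ht0
    refine hin ?_ (hψ t ht)
    rw [add_sub_cancel_left, mul_left_comm, hσ2, mul_one]
    exact ht0
  · filter_upwards [nhdsWithin_le_nhds htar, nhdsWithin_le_nhds (hsc.eventually hσ.outside),
      self_mem_nhdsWithin] with t ht hout ht0 htD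
    refine (hout ?_).le_bot ⟨hψ t ht, htD⟩
    rw [add_sub_cancel_left, mul_left_comm, hσ2, mul_one]
    exact ht0
  · change χ.symm (l 0) ∈ _
    rw [hc0]
    exact hx.1
  · rw [hsym.dpsi _ (by change χ.symm (l 0) ∈ U; rw [hc0]; exact hx.1), hder.mfderiv]
    have h1 := hχ.mfderiv_psi_symm hsym.diff htar.self_of_nhds v
    have h2 : v 2 = σ := by simp [v]
    rw [h2] at h1
    exact (congrArg (fun w : E3 => mfderiv (𝓡 3) 𝓘(ℝ, ℝ) ψ (χ.symm (l 0))
      (mfderiv (𝓡 3) (𝓡 3) χ.symm (l 0) w)) (one_smul ℝ v)).trans h1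

/-- Just after time `0` the curve is outside `D`, so `σ * (ψ - s)` is nonnegative on it and vanishes
at the start. Equality is possible for a curve tangent to the surface. -/
theorem IsSide.mul_mfderiv_nonneg (hσ : IsSide ψ U D s σ) (hU : IsOpen U)
    (hsym : IsFluxFormSymmetryOn Ω B u ψ U) {c : ℝ → M} (hc : LeavesThrough c (surf ψ U s) D) :
    0 ≤ σ * interiorProd u (interiorProd B Ω) (c 0)
      ![(mfderiv 𝓘(ℝ, ℝ) (𝓡 3) c 0 (1 : ℝ) : TangentSpace (𝓡 3) (c 0))] := by
  obtain ⟨hc0, hcd, -, hout⟩ := hc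
  rw [hsym.dpsi _ hc0.1]
  have hψc : ψ (c 0) = s := hc0.2
  let g' : ℝ →L[ℝ] ℝ := (mfderiv (𝓡 3) 𝓘(ℝ, ℝ) ψ (c 0)).comp (mfderiv 𝓘(ℝ, ℝ) (𝓡 3) c 0)
  have hg : HasFDerivAt (fun t => ψ (c t)) g' 0 :=
    (((hsym.diff _ hc0.1).hasMFDerivAt).comp (0 : ℝ) hcd.hasMFDerivAt).hasFDerivAt
  have hk : HasDerivAt (fun t => σ * (ψ (c t) - s)) (σ * g' 1) 0 :=
    (hg.hasDerivAt.sub_const s).const_mul σ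
  refine nonneg_of_hasDerivAt hk (by simp [hψc]) ?_
  have hψt : Tendsto (fun t => ψ (c t)) (𝓝 0) (𝓝 s) := by
    simpa [hψc] using hg.continuousAt.tendsto
  have hcU : ∀ᶠ t in 𝓝 (0 : ℝ), c t ∈ U :=
    hcd.continuousAt.preimage_mem_nhds (hU.mem_nhds hc0.1)
  filter_upwards [hout, nhdsWithin_le_nhds (hψt.eventually hσ.inside), nhdsWithin_le_nhds hcU]
    with t ht hin htU
  by_contra hneg
  exact ht (subset_closure (hin (not_le.1 hneg) ⟨htU, rfl⟩))

end Orientation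

/-! ### Differentiating the enclosed volume. -/

section EnclosedVolume

variable {X : Type*} [TopologicalSpace X] {ψ : X → ℝ} {U : Set X} {D : ℝ → Set X} {s a b A : ℝ}

theorem IsRegionFamily.isSide_one [PreconnectedSpace X]
    (hR : IsRegionFamily ψ U D a b) (hs : s ∈ Ioo a b) (hb : band ψ U (Ioo a s) ⊆ D s) :
    IsSide ψ U (D s) s 1 := by
  refine ⟨abs_one, ?_, ?_⟩
  · filter_upwards [Ioo_mem_nhds hs.1 hs.2] with r hr hrs x hx
    exact hb (mem_band_of_mem_surf hx ⟨hr.1, by linarith⟩)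
  · filter_upwards [Ioo_mem_nhds hs.1 hs.2] with r hr hrs
    refine (hR.disjoint_closure_above hs hb).symm.mono_left fun x hx => ?_
    exact mem_band_of_mem_surf hx ⟨by linarith, hr.2⟩

theorem IsRegionFamily.isSide_neg_one [PreconnectedSpace X]
    (hR : IsRegionFamily ψ U D a b) (hs : s ∈ Ioo a b) (ha : band ψ U (Ioo s b) ⊆ D s) :
    IsSide ψ U (D s) s (-1) := by
  refine ⟨by simp, ?_, ?_⟩
  · filter_upwards [Ioo_mem_nhds hs.1 hs.2] with r hr hrs x hx
    exact ha (mem_band_of_mem_surf hx ⟨by linarith, hr.2⟩)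
  · filter_upwards [Ioo_mem_nhds hs.1 hs.2] with r hr hrs
    refine (hR.disjoint_closure_below hs ha).symm.mono_left fun x hx => ?_
    exact mem_band_of_mem_surf hx ⟨hr.1, by linarith⟩

/-- If thin layers have volume `A` times their thickness, then the enclosed volume has derivative
`A` or `-A`, depending on the side on which the region lies. -/
theorem IsRegionFamily.exists_side [T2Space X] [PreconnectedSpace X] [MeasurableSpace X]
    [BorelSpace X] {μ : Measure X} (hR : IsRegionFamily ψ U D a b) (hs : s ∈ Ioo a b)
    (hfin : ∀ r ∈ Ioo a b, μ (D r) ≠ ⊤)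
    (hband : ∀ δ > 0, ∀ᶠ p : ℝ × ℝ in 𝓝 (s, s), p.1 < p.2 → ∀ I, Ioo p.1 p.2 ⊆ I →
      I ⊆ Icc p.1 p.2 → |(μ (band ψ U I)).toReal - A * (p.2 - p.1)| ≤ δ * (p.2 - p.1)) :
    ∃ σ, IsSide ψ U (D s) s σ ∧ HasDerivAt (fun r => (μ (D r)).toReal) (σ * A) s := by
  have hev : ∀ᶠ p : ℝ × ℝ in 𝓝 (s, s), p.1 ∈ Ioo a b ∧ p.2 ∈ Ioo a b :=
    prod_mem_nhds (Ioo_mem_nhds hs.1 hs.2) (Ioo_mem_nhds hs.1 hs.2)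
  have hmeas : ∀ {I : Set ℝ}, MeasurableSet I → MeasurableSet (band ψ U I) := fun hI =>
    measurableSet_inter_preimage_of_isOpen hR.foliation.continuousOn
      hR.foliation.isOpen hI
  have hadd : ∀ {D₁ D₂ L : Set X}, MeasurableSet L → D₂ = D₁ ∪ L → Disjoint D₁ L → μ D₂ ≠ ⊤ →
      (μ D₂).toReal - (μ D₁).toReal = (μ L).toReal := by
    intro D₁ D₂ L hL heq hdis hD₂
    rw [heq, measure_union hdis hL] at hD₂ ⊢
    rw [ENNReal.toReal_add (ne_top_of_le_ne_top hD₂ le_self_add)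
      (ne_top_of_le_ne_top hD₂ le_add_self), add_sub_cancel_left]
  -- The layer between two regions is closed at the lower end in one case and at the upper end in
  -- the other, whence the hypothesis for every `I` between the open and the closed interval.
  rcases hR.forall_below_or_forall_above with hb | ha
  · refine ⟨1, hR.isSide_one hs (hb s hs), hasDerivAt_of_eventually_abs_sub_le fun δ hδ => ?_⟩
    filter_upwards [hev, hband δ hδ] with p hp hpδ hlt
    obtain ⟨h1, h2⟩ := hR.eq_union_band hp.1 hp.2 hlt (hb _ hp.1) (hb _ hp.2)
    rw [hadd (hmeas measurableSet_Ico) h1 h2 (hfin _ hp.2), one_mul]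
    exact hpδ hlt _ Ioo_subset_Ico_self Ico_subset_Icc_self
  · refine ⟨-1, hR.isSide_neg_one hs (ha s hs), hasDerivAt_of_eventually_abs_sub_le fun δ hδ => ?_⟩
    filter_upwards [hev, hband δ hδ] with p hp hpδ hlt
    obtain ⟨h1, h2⟩ := hR.eq_union_band_of_above hp.1 hp.2 hlt (ha _ hp.1) (ha _ hp.2)
    have h3 := hadd (hmeas measurableSet_Ioc) h1 h2 (hfin _ hp.1)
    have h4 := hpδ hlt _ Ioo_subset_Ioc_self Ioc_subset_Icc_self
    rw [← h3, ← abs_neg] at h4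
    convert h4 using 2
    ring

end EnclosedVolume

/-! ### Combining flow boxes, foliation and orientation. -/

section FluxSurfaces

variable {M : Type*} [TopologicalSpace M] [ChartedSpace E3 M] {Ω : DForm M 3} {u B : VField M}
  {ψ : M → ℝ} {U : Set M} {s : ℝ}

/-- In a flow box `ψ` is a coordinate projection, hence open. -/
theorem HasFlowBoxes.isProperFoliation (h : HasFlowBoxes u B ψ U)
    (hdiff : ∀ x ∈ U, MDifferentiableAt (𝓡 3) 𝓘(ℝ, ℝ) ψ x)
    (hU : IsFoliatedByFluxSurfaces ψ U) : IsProperFoliation ψ U where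
  isOpen := hU.isOpen
  continuousOn := fun x hx => (hdiff x hx).continuousAt.continuousWithinAt
  openMap := by
    intro V hVU hV
    rw [isOpen_iff_mem_nhds]
    rintro _ ⟨x, hx, rfl⟩
    obtain ⟨χ, hχ, hxχ⟩ := h x (hVU hx)
    have hsurj : Function.Surjective (EuclideanSpace.proj (𝕜 := ℝ) (2 : Fin 3) : E3 →L[ℝ] ℝ) :=
      fun r => ⟨toE3 ((0, 0), r), rfl⟩
    have ho := (EuclideanSpace.proj (𝕜 := ℝ) (2 : Fin 3) : E3 →L[ℝ] ℝ).isOpenMap hsurj _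
      (χ.isOpen_inter_preimage_symm hV)
    refine mem_of_superset (ho.mem_nhds ⟨χ x, ⟨χ.map_source hxχ, ?_⟩, hχ.third x hxχ⟩) ?_
    · rwa [mem_preimage, χ.left_inv hxχ]
    · rintro _ ⟨y, ⟨hy, hyV⟩, rfl⟩
      refine ⟨χ.symm y, hyV, ?_⟩
      rw [← hχ.third _ (χ.map_target hy), χ.right_inv hy]
      rfl
  compact := hU.compact
  connected := hU.connected

variable [IsManifold (𝓡 3) ∞ M]

theorem IsSide.compatiblyOrdered_or {D : Set M} {σ : ℝ} (hσ : IsSide ψ U D s σ)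
    (h : HasFlowBoxes u B ψ U) (hsym : IsFluxFormSymmetryOn Ω B u ψ U)
    (hne : (surf ψ U s).Nonempty) {T₁ T₂ : ℝ × ℝ} (hΔ : Delta T₁ T₂ ≠ 0) :
    CompatiblyOrdered Ω u B (surf ψ U s) D T₁ T₂ ∨
      CompatiblyOrdered Ω u B (surf ψ U s) D T₂ T₁ := by
  obtain ⟨x, hx⟩ := hne
  obtain ⟨c, hc, -, hder⟩ := hσ.exists_leavesThrough h hsym hx
  have hσ0 : σ ≠ 0 := fun h0 => by simpa [h0] using hσ.abs_eq
  rcases lt_or_gt_of_ne (mul_ne_zero hΔ hσ0) with hneg | hpos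
  · refine Or.inr ⟨c, hc, ?_⟩
    rw [interiorProd_generator, hder, Delta_swap]
    linarith
  · refine Or.inl ⟨c, hc, ?_⟩
    rwa [interiorProd_generator, hder]

/-- On the curve that witnesses compatibility `Δ dψ` is positive while `σ dψ` is nonnegative, so `Δ`
has the sign `σ`. -/
theorem IsSide.mul_abs_Delta_eq {D : Set M} {σ : ℝ} (hσ : IsSide ψ U D s σ) (hU : IsOpen U)
    (hsym : IsFluxFormSymmetryOn Ω B u ψ U) {T₁ T₂ : ℝ × ℝ}
    (hT : CompatiblyOrdered Ω u B (surf ψ U s) D T₁ T₂) : σ * |Delta T₁ T₂| = Delta T₁ T₂ := by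
  obtain ⟨c, hc, hpos⟩ := hT
  rw [interiorProd_generator] at hpos
  have hnonneg := hσ.mul_mfderiv_nonneg hU hsym hc
  rcases eq_or_eq_neg_of_abs_eq hσ.abs_eq with rfl | rfl
  · rw [one_mul] at hnonneg
    rw [one_mul, abs_of_pos (pos_of_mul_pos_left hpos hnonneg)]
  · rw [abs_of_neg (by nlinarith)]
    ring

end FluxSurfaces

end FluxSurface

theorem theorem3 {M : Type*} [TopologicalSpace M] [T2Space M] [SecondCountableTopology M]
    [ConnectedSpace M] [ChartedSpace FluxSurface.E3 M] [IsManifold (𝓡 3) ∞ M]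
    [MeasurableSpace M] [BorelSpace M]
    (Ω : FluxSurface.DForm M 3) (hΩ : FluxSurface.IsVolumeForm Ω)
    (B u : FluxSurface.VField M) (ψ : M → ℝ) (U : Set M)
    (hU : FluxSurface.IsFoliatedByFluxSurfaces ψ U)
    (hsym : FluxSurface.IsFluxFormSymmetryOn Ω B u ψ U)
    (D : ℝ → Set M)
    (hD : FluxSurface.IsEnclosedFamily (FluxSurface.surf ψ U) D (ψ '' U)) :
    ∀ s ∈ ψ '' U,
      (∃ T₁ T₂ : ℝ × ℝ, LinearIndependent ℝ ![T₁, T₂] ∧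
        FluxSurface.Generates (FluxSurface.periods u B (FluxSurface.surf ψ U s)) T₁ T₂) ∧
      ∀ T₁ T₂ : ℝ × ℝ,
        FluxSurface.Generates (FluxSurface.periods u B (FluxSurface.surf ψ U s)) T₁ T₂ →
        (FluxSurface.CompatiblyOrdered Ω u B (FluxSurface.surf ψ U s) (D s) T₁ T₂ ∨
          FluxSurface.CompatiblyOrdered Ω u B (FluxSurface.surf ψ U s) (D s) T₂ T₁) ∧
        (FluxSurface.CompatiblyOrdered Ω u B (FluxSurface.surf ψ U s) (D s) T₁ T₂ →
          FluxSurface.volumeMeasure Ω (D s) < ⊤ ∧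
          HasDerivAt (fun r => (FluxSurface.volumeMeasure Ω (D r)).toReal)
            (FluxSurface.Delta T₁ T₂) s) := by
  intro s hs
  have : LocallyCompactSpace M := ChartedSpace.locallyCompactSpace FluxSurface.E3 M
  have : LocallyConnectedSpace M := ChartedSpace.locallyConnectedSpace FluxSurface.E3 M
  have h : FluxSurface.HasFlowBoxes u B ψ U := fun x hx =>
    FluxSurface.exists_flowBox hΩ hU.isOpen hU.regular hsym hx
  have hf := h.isProperFoliation hsym.diff hU
  have hS := hf.compact s hs
  have hSconn := hf.connected s hs
  obtain ⟨φ, hφ⟩ := h.exists_action hS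
  let x : FluxSurface.surf ψ U s := ⟨_, hSconn.nonempty.some_mem⟩
  have hΓ := hφ.coe_periodSubgroup h
  obtain ⟨R, hR⟩ := hφ.exists_dist_periodSubgroup_lt h hSconn.isPreconnected hS x
  have hspan := FluxSurface.span_eq_top_of_dist_lt hR
  have hdisc := hφ.discreteTopology_periodSubgroup h x
  refine ⟨?_, fun T₁ T₂ hT => ?_⟩
  · rw [← hΓ]
    exact FluxSurface.exists_generates_of_discrete hφ.periodSubgroup hspan
  have hli := FluxSurface.linearIndependent_of_generates (hΓ ▸ hspan) hT
  obtain ⟨a, b, hsab, hreg⟩ := hD.exists_isRegionFamily hf hs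
  have hfin : ∀ r ∈ Ioo a b, FluxSurface.volumeMeasure Ω (D r) < ⊤ := fun r hr =>
    (measure_mono subset_closure).trans_lt
      (FluxSurface.volumeMeasure_lt_top_of_isCompact hΩ (hreg.isRegion r hr).isCompact)
  -- The layer estimate knows only `|Δ|`; the side `σ` restores the sign below.
  obtain ⟨σ, hσ, hder⟩ := hreg.exists_side (μ := FluxSurface.volumeMeasure Ω)
    (A := |FluxSurface.Delta T₁ T₂|) hsab (fun r hr => (hfin r hr).ne) fun δ hδ => by
      filter_upwards [hφ.eventually_volumeMeasure_band h hf hsym hs hT hli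
        (ENNReal.ofReal_pos.2 hδ).ne'] with p hp hlt I hI hI'
      exact FluxSurface.abs_toReal_sub_le (abs_nonneg _) hδ.le
        (hp.1.trans (by gcongr; exact FluxSurface.band_mono hI))
        ((measure_mono (FluxSurface.band_mono hI')).trans hp.2) (sub_nonneg.2 hlt.le)
  refine ⟨hσ.compatiblyOrdered_or h hsym hSconn.nonempty (FluxSurface.Delta_ne_zero hli),
    fun hcomp => ⟨hfin s hsab, ?_⟩⟩
  rwa [hσ.mul_abs_Delta_eq hU.isOpen hsym hcomp] at hder
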